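/- **Setting.** Let $p\in\mathbb N\cup\{\infty\}$ and let $x=(x_k)_{1\le k\le p}$ be a random feature vector with law $\mu$ whose second moment matrix is diagonal, $\mathbb E[xx^\top]=\Sigma=\mathrm{diag}(\lambda_1,\lambda_2,\dots)$, with $\lambda_1\ge\lambda_2\ge\dots>0$ and $\sum_k\lambda_k<\infty$. Put $z=\Sigma^{-1/2}x$. Let $X$ be the matrix whose rows are $n$ i.i.d. draws of $x$, let $\lambda\ge 0$ be the ridge, and let $\hat\theta(y)=X^\top(XX^\top+n\lambda I_n)^{-1}y$. Let $\varepsilon\in\mathbb R^n$ have i.i.d. centred entries of variance $\sigma^2<\infty$, independent of $X$. The variance term is the function $\mathcal V=\mathbb E_{x,\varepsilon}\big[(x^\top\hat\theta(\varepsilon))^2\big]$ of the sample $X$, where $x$ is a fresh feature vector. **Decay.** Let $a>0$ and $b\in[1+a,\infty]$. Assume $\lambda_k=\Theta(k^{-1-a})$ and $\lambda=\Theta(n^{-b})$, where $b=\infty$ means $\lambda=0$. **Features.** For a vector $v$ write $v_{\le k}$ for its first $k$ coordinates and $v_{>k}$ for the others; $\Sigma_{>k}=\mathrm{diag}(\lambda_{k+1},\lambda_{k+2},\dots)$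 and $\|v\|_M^2=v^\top Mv$. * (GF) The quantities $$\alpha_k=\operatorname{ess\,inf}\frac{\|z_{>k}\|_{\Sigma_{>k}}^2}{\mathrm{tr}\,\Sigma_{>k}},\qquad \beta_k=\operatorname{ess\,sup}\max\Big\{\frac{\|z_{\le k}\|_2^2}{k},\frac{\|z_{>k}\|_{\Sigma_{>k}}^2}{\mathrm{tr}\,\Sigma_{>k}},\frac{\|z_{>k}\|_{\Sigma_{>k}^2}^2}{\mathrm{tr}\,\Sigma_{>k}^2}\Big\}$$ are $\Theta(1)$ over $0\le k<p$ (for $k=0$ the first term of the maximum is omitted). * (IF) The coordinates $z_k$ are independent, with sub-Gaussian norms at most a constant $G$. **Claim.** 1. Under (GF), if the dimension $p=p_n\in\mathbb N\cup\{\infty\}$ satisfies $p_n/(n^2\log n)\to\infty$ (for instance $p=\infty$), then there are constants $C>0$, $q\ge0$ and a function $\varphi(n)=o(1/\log n)$ such that, for all $n\ge1$, with probability at least $1-\varphi(n)$ the matrix $XX^\top+n\lambda I_n$ is invertible and $$\mathcal V\le C\,\sigma^2\,n^{2a}(\log n)^q,\qquad\text{that is, } \mathcal V=\tilde O(\sigma^2n^{2a}).$$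 2. Under (IF), if $p>\eta n$ for some constant $\eta>1$, then there are constants $c_1,C>0$ such that, for all $n\ge1$, with probability at least $1-3e^{-c_1n}$ the matrix $XX^\top+n\lambda I_n$ is invertible and $$\mathcal V\le C\,\sigma^2,\qquad\text{that is, } \mathcal V=O(\sigma^2).$$ The constants $C,q,c_1$ and the function $\varphi$ depend only on $a$, $b$, the constants implied in the $\Theta$'s and, in 1, on the sequence $(p_n)$, in 2, on $G$ and $\eta$. In particular $p$ (in 2), $\mu$, $(\lambda_k)$, $\lambda$, $\sigma$ and the noise law may vary with $n$. -/

import Mathlib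

open MeasureTheory ProbabilityTheory Filter Topology
open scoped ENNReal Matrix

noncomputable section

namespace RidgeVariance

/-- Coordinates of a feature vector of dimension `p ∈ ℕ ∪ {∞}`. Counting starts at zero:
the element with value `k` is the coordinate that is usually numbered `k + 1`. -/
abbrev Idx (p : ℕ∞) : Type := {k : ℕ // (k : ℕ∞) < p}

/-- `μ` is the law of a random feature vector in `ℝ^p` whose second moment matrix is
`diag(eig)`, with positive, non-increasing, summable entries. -/
structure IsFeatureLaw {p : ℕ∞} (eig : Idx p → ℝ) (μ : Measure (Idx p → ℝ)) : Prop where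
  eig_pos : ∀ k, 0 < eig k
  eig_antitone : Antitone eig
  trace_class : Summable eig
  memLp : ∀ k, MemLp (fun x : Idx p → ℝ => x k) 2 μ
  second_moment : ∀ k l, ∫ x, x k * x l ∂μ = if k = l then eig k else 0

/-- Polynomial eigen-decay with explicit constants: `c k^(-1-a) ≤ λ_k ≤ C k^(-1-a)`. -/
def PolyDecay {p : ℕ∞} (a c C : ℝ) (eig : Idx p → ℝ) : Prop :=
  ∀ k : Idx p, c * ((k.1 : ℝ) + 1) ^ (-1 - a) ≤ eig k ∧ eig k ≤ C * ((k.1 : ℝ) + 1) ^ (-1 - a)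

/-- The ridge at sample size `n` is of order `n^(-b)` with explicit constants; `b = ∞` means
that there is no ridge. -/
def RidgeOrder (b : WithTop ℝ) (c C : ℝ) (n : ℕ) (lam : ℝ) : Prop :=
  (b = ⊤ → lam = 0) ∧
    ∀ β : ℝ, b = (β : WithTop ℝ) → c * (n : ℝ) ^ (-β) ≤ lam ∧ lam ≤ C * (n : ℝ) ^ (-β)

/-- The whitened vector `z = Σ^(-1/2) x`. -/
def whiten {p : ℕ∞} (eig : Idx p → ℝ) (x : Idx p → ℝ) : Idx p → ℝ :=
  fun k => x k / √(eig k)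

/-- `‖z_{≤k}‖²`, the sum over the first `k` coordinates. -/
def headSq {p : ℕ∞} (k : ℕ) (z : Idx p → ℝ) : ℝ≥0∞ :=
  ∑' l : Idx p, if l.1 < k then ENNReal.ofReal (z l ^ 2) else 0

/-- `‖z_{>k}‖²` in the norm of `(Σ_{>k})^j`, the sum over all coordinates but the first `k`. -/
def tailSq {p : ℕ∞} (eig : Idx p → ℝ) (j k : ℕ) (z : Idx p → ℝ) : ℝ≥0∞ :=
  ∑' l : Idx p, if k ≤ l.1 then ENNReal.ofReal (eig l ^ j * z l ^ 2) else 0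

/-- `tr[(Σ_{>k})^j]`. -/
def tailTrace {p : ℕ∞} (eig : Idx p → ℝ) (j k : ℕ) : ℝ≥0∞ :=
  ∑' l : Idx p, if k ≤ l.1 then ENNReal.ofReal (eig l ^ j) else 0

/-- `α_k`, the essential infimum of `‖z_{>k}‖²_{Σ_{>k}} / tr[Σ_{>k}]`. -/
def alphaCoeff {p : ℕ∞} (eig : Idx p → ℝ) (μ : Measure (Idx p → ℝ)) (k : ℕ) : ℝ≥0∞ :=
  essInf (fun x => tailSq eig 1 k (whiten eig x) / tailTrace eig 1 k) μ

/-- `β_k`, the essential supremum of the largest of the three normalised squared norms.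
For `k = 0` the first of them is `0 / 0 = 0`, so it is left out, as is the convention. -/
def betaCoeff {p : ℕ∞} (eig : Idx p → ℝ) (μ : Measure (Idx p → ℝ)) (k : ℕ) : ℝ≥0∞ :=
  essSup (fun x => max (headSq k (whiten eig x) / (k : ℝ≥0∞))
    (max (tailSq eig 1 k (whiten eig x) / tailTrace eig 1 k)
      (tailSq eig 2 k (whiten eig x) / tailTrace eig 2 k))) μ

/-- Generic features: `α_k` and `β_k` are bounded below and above by positive constants, at all
truncation levels `k < p`. (Always `α_k ≤ 1 ≤ β_k`, so these two bounds say that both are of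
constant order.) -/
def GenericFeatures {p : ℕ∞} (α β : ℝ) (eig : Idx p → ℝ) (μ : Measure (Idx p → ℝ)) : Prop :=
  ∀ k : ℕ, (k : ℕ∞) < p →
    ENNReal.ofReal α ≤ alphaCoeff eig μ k ∧ betaCoeff eig μ k ≤ ENNReal.ofReal β

/-- The sub-Gaussian norm `inf {t > 0 : 𝔼 exp(f²/t²) ≤ 2}`, with value `∞` if there is no
such `t`. -/
def subGaussianNorm {Ω : Type*} [MeasurableSpace Ω] (f : Ω → ℝ) (μ : Measure Ω) : ℝ≥0∞ :=
  ⨅ t ∈ {t : ℝ | 0 < t ∧ ∫⁻ ω, ENNReal.ofReal (Real.exp (f ω ^ 2 / t ^ 2)) ∂μ ≤ 2},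
    ENNReal.ofReal t

/-- Independent sub-Gaussian features: the whitened coordinates are independent and their
sub-Gaussian norms are at most `G`. -/
def IndependentFeatures {p : ℕ∞} (G : ℝ) (eig : Idx p → ℝ) (μ : Measure (Idx p → ℝ)) : Prop :=
  iIndepFun (fun (k : Idx p) (x : Idx p → ℝ) => whiten eig x k) μ ∧
    ∀ k : Idx p, subGaussianNorm (fun x : Idx p → ℝ => whiten eig x k) μ ≤ ENNReal.ofReal G

/-- The matrix `X Xᵀ + n λ I`, where the rows of `X` are the `n` sampled feature vectors. -/
def kernelMatrix {p : ℕ∞} {n : ℕ} (X : Fin n → Idx p → ℝ) (lam : ℝ) :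
    Matrix (Fin n) (Fin n) ℝ :=
  Matrix.of (fun i j => ∑' k : Idx p, X i k * X j k) + ((n : ℝ) * lam) • 1

/-- The ridge regressor `Xᵀ (X Xᵀ + n λ I)⁻¹ y`. -/
def regressor {p : ℕ∞} {n : ℕ} (X : Fin n → Idx p → ℝ) (lam : ℝ) (y : Fin n → ℝ) :
    Idx p → ℝ :=
  fun k => ∑ i, X i k * ((kernelMatrix X lam)⁻¹ *ᵥ y) i

/-- The variance term `𝔼_{x,ε} (xᵀ θ̂(ε))²` for a given sample `X`: `x` is a fresh feature vector
with law `μ`, and `ε` has i.i.d. entries with law `ν`. -/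
def varianceTerm {p : ℕ∞} {n : ℕ} (μ : Measure (Idx p → ℝ)) (ν : Measure ℝ) (lam : ℝ)
    (X : Fin n → Idx p → ℝ) : ℝ≥0∞ :=
  ∫⁻ ε, ∫⁻ x, ENNReal.ofReal ((∑' k : Idx p, x k * regressor X lam ε k) ^ 2) ∂μ
    ∂(Measure.pi fun _ : Fin n => ν)

/-- The noise law: centred with variance `σ²`. -/
structure IsNoiseLaw (σ : ℝ) (ν : Measure ℝ) : Prop where
  memLp : MemLp id 2 ν
  centered : ∫ e, e ∂ν = 0
  second_moment : ∫ e, e ^ 2 ∂ν = σ ^ 2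

/-- The regressor is well defined on the sample `X`, and its variance term is at most `B`. -/
def VarianceBound {p : ℕ∞} {n : ℕ} (μ : Measure (Idx p → ℝ)) (ν : Measure ℝ) (lam B : ℝ)
    (X : Fin n → Idx p → ℝ) : Prop :=
  IsUnit (kernelMatrix X lam).det ∧ varianceTerm μ ν lam X ≤ ENNReal.ofReal B

end RidgeVariance

end

/-!
The variance of ridge regression at a fixed sample is controlled by three quadratic forms
(`varianceBound_of_forms`). Let `k` be a truncation level, and suppose that the Gram matrix of the
coordinates from `k` on, with the ridge, has its spectrum in `[s, S]`, that these coordinates have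
variances at most `L`, and that the squared singular values of the whitened sample of the first `k`
coordinates are at least `τ`. Then the regressor is well defined, and the variance is at most
`n (4 S / (s τ) + L / s) σ²`. In both parts `k` is chosen so that `τ` is of order `n`; what remains
is to bound `s` from below and `S` from above, with high probability over the sample.

**Generic features.** Only almost sure bounds for the norms of the rows are available, and no
independence of the coordinates. With `m` slightly above `n² log n`, the parts of the rows beyond
coordinate `m` are nearly orthogonal: their squared norms are at least `α tr Σ_{>m}`, and Markov's
inequality for the sum of the squared inner products (`measure_offDiagSq_ge_le`) gives
`s = α tr Σ_{>m} / 2`, which is `n^(-2a)` up to logarithms. The dimension is large enough for this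
by assumption. The head, of dimension `k` of order `n / log n`, and the norm of the tail are treated
by matrix moments: traces of powers of `1 + W` and of `(δ + W)⁻¹`, where `W` is the sum of the
rank-one matrices of the rows, are followed while the rows are added one at a time. The growth or
decrease of these traces under rank-one perturbations is elementary (`trace_pow_update_le` and
`trace_inv_pow_update_le`), and with moments of order `log n` they yield `τ` of order `n` and `S` of
constant order with failure probability `O(1 / n)`. The total failure probability
`O(1 / (g log n))`, where `g → ∞` is a part of the excess of `p` over `n² log n`, is `o(1 / log n)`.

**Independent features.** By independence, `𝔼 z_k z_l = 0` is the product of the means, so at most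
one coordinate is not centred (`IndependentFeatures.mean_mul_mean`). The upper bound `S` of order
`n^(-a)` and the lower bound for the head, of dimension a small multiple of `n`, follow from
exponential moments and nets on the sphere. For `s` it suffices to bound the least singular value of
a matrix with `n` rows and `(1 + 2γ) n` independent centred sub-Gaussian columns by a multiple of
`√n` from below (`exists_measure_two_groups_lt_le`), with failure probability `exp(-c n)`; the
variances of these coordinates are of order `n^(-1-a)`, so that `s` is of order `n^(-a)` as well.
This is done in two steps. The columns of a first group of size `(1 + γ) n` are added one at a time,
while a barrier `-u` below the spectrum moves up by a fixed amount per column. The trace of the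
resolvent at the barrier has a nonpositive drift as long as it is at most a constant `φ`, so that it
stays bounded with exponentially small failure probability (`measure_resolventTrace_gt_le`). Hence
at most a small multiple of `n` eigenvalues are below `θ n`, and on the space of their eigenvectors,
whose dimension is small compared with the size of the second group, a net argument applies to the
second group (`exists_small_subspace`, `measure_two_groups_lt_le`).
-/

noncomputable section

namespace RidgeVariance

/-! ### Variance term of a fixed sample -/

instance instCountableIdx (p : ℕ∞) : Countable (Idx p) := Subtype.countable

/-- The coordinates with index below `k`. -/
def headSet (p : ℕ∞) (k : ℕ) : Finset (Idx p) :=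
  (Set.Finite.preimage (Subtype.val_injective.injOn) (Set.finite_Iio k) :
    Set.Finite {l : Idx p | l.1 < k}).toFinset

@[simp] theorem mem_headSet {p : ℕ∞} {k : ℕ} {l : Idx p} : l ∈ headSet p k ↔ l.1 < k := by
  simp [headSet]

theorem card_headSet_le (p : ℕ∞) (k : ℕ) : (headSet p k).card ≤ k := by
  classical
  rw [← Finset.card_image_of_injective (headSet p k) Subtype.val_injective]
  refine (Finset.card_le_card (t := Finset.range k) ?_).trans (by simp)
  intro x hx
  obtain ⟨l, hl, rfl⟩ := Finset.mem_image.1 hx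
  simpa using hl

theorem lintegral_sq_sum_of_orthogonal {Ω ι : Type*} [MeasurableSpace Ω] [DecidableEq ι]
    {μ : Measure Ω} {f : ι → Ω → ℝ} (hf : ∀ k, MemLp (f k) 2 μ) {c : ι → ℝ}
    (ho : ∀ k l, ∫ ω, f k ω * f l ω ∂μ = if k = l then c k else 0) (s : Finset ι) (v : ι → ℝ) :
    ∫⁻ ω, ENNReal.ofReal ((∑ k ∈ s, f k ω * v k) ^ 2) ∂μ =
      ENNReal.ofReal (∑ k ∈ s, c k * v k ^ 2) := by
  have hint : ∀ k l, Integrable (fun ω => f k ω * f l ω) μ := fun k l =>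
    (hf k).integrable_mul (hf l)
  have hexp : ∀ ω, (∑ k ∈ s, f k ω * v k) ^ 2 =
      ∑ k ∈ s, ∑ l ∈ s, (v k * v l) * (f k ω * f l ω) := by
    intro ω
    rw [sq, Finset.sum_mul_sum]
    refine Finset.sum_congr rfl fun k _ => Finset.sum_congr rfl fun l _ => by ring
  have hI : ∀ k ∈ s, Integrable (fun ω => ∑ l ∈ s, (v k * v l) * (f k ω * f l ω)) μ :=
    fun k _ => integrable_finsetSum _ fun l _ => (hint k l).const_mul _
  rw [← ofReal_integral_eq_lintegral_ofReal]
  · congr 1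
    simp_rw [hexp]
    rw [integral_finsetSum _ hI]
    refine Finset.sum_congr rfl fun k hk => ?_
    rw [integral_finsetSum _ fun l _ => (hint k l).const_mul _]
    simp_rw [integral_const_mul, ho]
    simp only [mul_ite, mul_zero, Finset.sum_ite_eq, hk, if_true]
    ring
  · simp_rw [hexp]
    exact integrable_finsetSum _ hI
  · exact Eventually.of_forall fun ω => sq_nonneg _

section FeatureLaw

variable {p : ℕ∞} {eig : Idx p → ℝ} {μ : Measure (Idx p → ℝ)}

theorem IsFeatureLaw.lintegral_sq (h : IsFeatureLaw eig μ) (k : Idx p) :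
    ∫⁻ x, ENNReal.ofReal (x k ^ 2) ∂μ = ENNReal.ofReal (eig k) := by
  classical
  simpa using lintegral_sq_sum_of_orthogonal h.memLp
    (c := eig) (fun k l => by simpa using h.second_moment k l) {k} (fun _ => 1)

/-- A feature vector is almost surely square-summable. -/
theorem IsFeatureLaw.ae_summable_sq (h : IsFeatureLaw eig μ) :
    ∀ᵐ x ∂μ, Summable fun k => x k ^ 2 := by
  have hlt : ∫⁻ x, ∑' k, ENNReal.ofReal (x k ^ 2) ∂μ ≠ ⊤ := by
    rw [lintegral_tsum fun k => Measurable.aemeasurable (by fun_prop)]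
    simp_rw [h.lintegral_sq]
    rw [← ENNReal.ofReal_tsum_of_nonneg (fun k => (h.eig_pos k).le) h.trace_class]
    exact ENNReal.ofReal_ne_top
  filter_upwards [ae_lt_top (Measurable.tsum fun k => by fun_prop) hlt] with x hx
  have := ENNReal.summable_toReal hx.ne
  simpa [ENNReal.toReal_ofReal, sq_nonneg] using this

theorem summable_mul_of_sq {ι : Type*} {u v : ι → ℝ} (hu : Summable fun k => u k ^ 2)
    (hv : Summable fun k => v k ^ 2) : Summable fun k => u k * v k := by
  refine Summable.of_norm_bounded (hu.add hv) fun k => ?_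
  rw [Real.norm_eq_abs, abs_mul]
  nlinarith [sq_nonneg (|u k| - |v k|), sq_abs (u k), sq_abs (v k), sq_nonneg (u k),
    sq_nonneg (v k)]

/-- For a square-summable direction `v`, `𝔼 (xᵀ v)² ≤ vᵀ Σ v`. Only this inequality is needed, so
Fatou's lemma replaces convergence in `L²`. -/
theorem IsFeatureLaw.lintegral_sq_tsum_le (h : IsFeatureLaw eig μ) {v : Idx p → ℝ}
    (hv : Summable fun k => v k ^ 2) :
    ∫⁻ x, ENNReal.ofReal ((∑' k, x k * v k) ^ 2) ∂μ ≤ ∑' k, ENNReal.ofReal (eig k * v k ^ 2) := by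
  classical
  have hnn : ∀ k, 0 ≤ eig k * v k ^ 2 := fun k => mul_nonneg (h.eig_pos k).le (sq_nonneg _)
  calc ∫⁻ x, ENNReal.ofReal ((∑' k, x k * v k) ^ 2) ∂μ
      = ∫⁻ x, liminf (fun s : Finset (Idx p) =>
          ENNReal.ofReal ((∑ k ∈ s, x k * v k) ^ 2)) atTop ∂μ := by
        refine lintegral_congr_ae ?_
        filter_upwards [h.ae_summable_sq] with x hx
        have := (summable_mul_of_sq hx hv).hasSum
        exact ((ENNReal.continuous_ofReal.tendsto _).comp (this.pow 2)).liminf_eq.symm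
    _ ≤ liminf (fun s : Finset (Idx p) =>
          ∫⁻ x, ENNReal.ofReal ((∑ k ∈ s, x k * v k) ^ 2) ∂μ) atTop :=
        lintegral_liminf_le' fun s => Measurable.aemeasurable (by fun_prop)
    _ = liminf (fun s : Finset (Idx p) => ∑ k ∈ s, ENNReal.ofReal (eig k * v k ^ 2)) atTop := by
        congr 1
        ext s
        rw [lintegral_sq_sum_of_orthogonal h.memLp h.second_moment,
          ENNReal.ofReal_sum_of_nonneg fun k _ => hnn k]
    _ = ∑' k, ENNReal.ofReal (eig k * v k ^ 2) := ENNReal.summable.hasSum.liminf_eq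

end FeatureLaw

theorem IsNoiseLaw.lintegral_sq_sum {σ : ℝ} {ν : Measure ℝ} [IsProbabilityMeasure ν]
    (h : IsNoiseLaw σ ν) {n : ℕ} (c : Fin n → ℝ) :
    ∫⁻ ε, ENNReal.ofReal ((∑ j, ε j * c j) ^ 2) ∂(Measure.pi fun _ : Fin n => ν) =
      ENNReal.ofReal (σ ^ 2 * ∑ j, c j ^ 2) := by
  have hmp : ∀ j : Fin n, MeasurePreserving (fun ε : Fin n → ℝ => ε j)
      (Measure.pi fun _ : Fin n => ν) ν := fun j => measurePreserving_eval (fun _ : Fin n => ν) j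
  have hf : ∀ j : Fin n, MemLp (fun ε : Fin n → ℝ => ε j) 2 (Measure.pi fun _ : Fin n => ν) :=
    fun j => h.memLp.comp_measurePreserving (hmp j)
  have hmean : ∀ j : Fin n, ∫ ε, ε j ∂(Measure.pi fun _ : Fin n => ν) = 0 := fun j => by
    have := integral_map (hmp j).measurable.aemeasurable (f := fun e : ℝ => e)
      (μ := Measure.pi fun _ : Fin n => ν) (by fun_prop)
    rw [(hmp j).map_eq, h.centered] at this
    exact this.symm
  rw [lintegral_sq_sum_of_orthogonal hf (c := fun _ => σ ^ 2) ?_ Finset.univ c, Finset.mul_sum]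
  intro j l
  split_ifs with hjl
  · subst hjl
    have := integral_map (hmp j).measurable.aemeasurable (f := fun e : ℝ => e ^ 2)
      (μ := Measure.pi fun _ : Fin n => ν) (by fun_prop)
    rw [(hmp j).map_eq, h.second_moment] at this
    rw [this]
    exact integral_congr_ae (Eventually.of_forall fun ε => (sq (ε j)).symm)
  · have hind : IndepFun (fun ε : Fin n → ℝ => ε j) (fun ε : Fin n → ℝ => ε l)
        (Measure.pi fun _ : Fin n => ν) :=
      (iIndepFun_pi (μ := fun _ : Fin n => ν) (X := fun _ e => e)
        (fun _ => aemeasurable_id)).indepFun hjl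
    rw [hind.integral_fun_mul_eq_mul_integral (hf j).aestronglyMeasurable
      (hf l).aestronglyMeasurable, hmean, zero_mul]

/-! ### Quadratic forms -/

section Forms

variable {ι : Type*} [Fintype ι] [DecidableEq ι]

/-- The Cauchy-Schwarz inequality for the form of a symmetric positive semidefinite matrix. -/
theorem sq_dotProduct_mulVec_le {A : Matrix ι ι ℝ} (hA : A.IsSymm)
    (hpos : ∀ x : ι → ℝ, 0 ≤ x ⬝ᵥ A *ᵥ x) (x y : ι → ℝ) :
    (x ⬝ᵥ A *ᵥ y) ^ 2 ≤ (x ⬝ᵥ A *ᵥ x) * (y ⬝ᵥ A *ᵥ y) := by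
  have hs : LinearMap.IsSymm (Matrix.toBilin' A) := by
    refine ⟨fun u v => ?_⟩
    simp only [Matrix.toBilin'_apply', RingHom.id_apply]
    rw [Matrix.dotProduct_mulVec, ← Matrix.mulVec_transpose, hA.eq, dotProduct_comm]
  have := LinearMap.BilinForm.apply_sq_le_of_symm (Matrix.toBilin' A)
    (fun u => by simpa [Matrix.toBilin'_apply'] using hpos u) hs x y
  simpa [Matrix.toBilin'_apply'] using this

theorem mulVec_dotProduct_self_le {A : Matrix ι ι ℝ} (hA : A.IsSymm)
    (hpos : ∀ x : ι → ℝ, 0 ≤ x ⬝ᵥ A *ᵥ x) {S : ℝ} (hS : ∀ x : ι → ℝ, x ⬝ᵥ A *ᵥ x ≤ S * (x ⬝ᵥ x))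
    (y : ι → ℝ) : (A *ᵥ y) ⬝ᵥ (A *ᵥ y) ≤ S * (y ⬝ᵥ A *ᵥ y) := by
  set z := A *ᵥ y with hz
  have h1 := sq_dotProduct_mulVec_le hA hpos z y
  rw [← hz] at h1
  have hzz : 0 ≤ z ⬝ᵥ z := Finset.sum_nonneg fun i _ => mul_self_nonneg (z i)
  have h2 := mul_le_mul_of_nonneg_right (hS z) (hpos y)
  rcases hzz.eq_or_lt with h0 | h0
  · have hz0 : z = 0 := dotProduct_self_eq_zero.1 h0.symm
    rw [hz0]
    simp
  · rw [← hz] at h2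
    have : (z ⬝ᵥ z) * (z ⬝ᵥ z) ≤ (z ⬝ᵥ z) * (S * (y ⬝ᵥ z)) := by nlinarith
    exact le_of_mul_le_mul_left this h0

end Forms

section Sample

variable {p : ℕ∞} {n : ℕ}

/-- The inner product of column `l` of the sample with `w`. -/
def colDot (X : Fin n → Idx p → ℝ) (w : Fin n → ℝ) (l : Idx p) : ℝ := ∑ i, X i l * w i

/-- The Gram matrix of the sample, restricted to the coordinates from `k` on. -/
def tailMat (k : ℕ) (X : Fin n → Idx p → ℝ) : Matrix (Fin n) (Fin n) ℝ :=
  Matrix.of fun i j => ∑' l : Idx p, if k ≤ l.1 then X i l * X j l else 0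

/-- The quadratic form `w ↦ wᵀ X_{>k} X_{>k}ᵀ w`. -/
def tailForm (k : ℕ) (X : Fin n → Idx p → ℝ) (w : Fin n → ℝ) : ℝ :=
  ∑' l : Idx p, if k ≤ l.1 then colDot X w l ^ 2 else 0

variable {X : Fin n → Idx p → ℝ}

theorem summable_mul_rows (hX : ∀ i, Summable fun l => X i l ^ 2) (i j : Fin n) :
    Summable fun l => X i l * X j l := summable_mul_of_sq (hX i) (hX j)

theorem Summable.ite_tail {f : Idx p → ℝ} (hf : Summable f) (k : ℕ) :
    Summable fun l : Idx p => if k ≤ l.1 then f l else 0 :=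
  (hf.indicator {l : Idx p | k ≤ l.1}).congr fun l => by simp [Set.indicator_apply]

theorem summable_colDot_mul (hX : ∀ i, Summable fun l => X i l ^ 2) (u w : Fin n → ℝ) :
    Summable fun l => colDot X u l * colDot X w l := by
  have : (fun l => colDot X u l * colDot X w l) =
      fun l => ∑ i, ∑ j, (u i * w j) * (X i l * X j l) := by
    ext l
    rw [colDot, colDot, Finset.sum_mul_sum]
    exact Finset.sum_congr rfl fun i _ => Finset.sum_congr rfl fun j _ => by ring
  rw [this]
  exact summable_sum fun i _ => summable_sum fun j _ => (summable_mul_rows hX i j).mul_left _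

theorem summable_colDot_sq (hX : ∀ i, Summable fun l => X i l ^ 2) (w : Fin n → ℝ) :
    Summable fun l => colDot X w l ^ 2 := by
  simpa [sq] using summable_colDot_mul hX w w

theorem summable_tailForm (hX : ∀ i, Summable fun l => X i l ^ 2) (k : ℕ) (w : Fin n → ℝ) :
    Summable fun l : Idx p => if k ≤ l.1 then colDot X w l ^ 2 else 0 :=
  Summable.ite_tail (summable_colDot_sq hX w) k

theorem tailForm_nonneg (k : ℕ) (w : Fin n → ℝ) : 0 ≤ tailForm k X w :=
  tsum_nonneg fun l => by split_ifs <;> positivity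

theorem tailMat_isSymm (k : ℕ) : (tailMat k X).IsSymm := by
  ext i j
  simp only [tailMat, Matrix.transpose_apply, Matrix.of_apply]
  exact tsum_congr fun l => by simp only [mul_comm]

theorem dotProduct_tailMat (hX : ∀ i, Summable fun l => X i l ^ 2) (k : ℕ) (w : Fin n → ℝ) :
    w ⬝ᵥ tailMat k X *ᵥ w = tailForm k X w := by
  have hs : ∀ i j, Summable fun l : Idx p => w i * w j * (if k ≤ l.1 then X i l * X j l else 0) :=
    fun i j => (Summable.ite_tail (summable_mul_rows hX i j) k).mul_left _
  have hterm : ∀ l : Idx p, (if k ≤ l.1 then colDot X w l ^ 2 else 0) =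
      ∑ i, ∑ j, w i * w j * (if k ≤ l.1 then X i l * X j l else 0) := by
    intro l
    split_ifs
    · rw [colDot, sq, Finset.sum_mul_sum]
      exact Finset.sum_congr rfl fun i _ => Finset.sum_congr rfl fun j _ => by ring
    · simp
  rw [tailForm, tsum_congr hterm, Summable.tsum_finsetSum fun i _ => summable_sum fun j _ => hs i j]
  simp only [dotProduct, Matrix.mulVec, tailMat, Matrix.of_apply, Finset.mul_sum]
  refine Finset.sum_congr rfl fun i _ => ?_
  rw [Summable.tsum_finsetSum fun j _ => hs i j]
  refine Finset.sum_congr rfl fun j _ => ?_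
  rw [tsum_mul_left]
  ring

/-- Splitting the kernel matrix at a truncation level. -/
theorem kernelMatrix_mulVec (hX : ∀ i, Summable fun l => X i l ^ 2) (k : ℕ) (lam : ℝ)
    (w : Fin n → ℝ) (i : Fin n) :
    (kernelMatrix X lam *ᵥ w) i = ∑ l ∈ headSet p k, X i l * colDot X w l +
      ((tailMat k X + ((n : ℝ) * lam) • 1) *ᵥ w) i := by
  have hent : ∀ j, ∑' l : Idx p, X i l * X j l = ∑ l ∈ headSet p k, X i l * X j l +
      ∑' l : Idx p, if k ≤ l.1 then X i l * X j l else 0 := by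
    intro j
    have hhead : ∑ l ∈ headSet p k, X i l * X j l =
        ∑' l : Idx p, if l.1 < k then X i l * X j l else 0 := by
      rw [tsum_eq_sum (s := headSet p k) fun l hl => by simp_all]
      exact Finset.sum_congr rfl fun l hl => (if_pos (by simpa using hl)).symm
    rw [hhead, ← Summable.tsum_add]
    · refine tsum_congr fun l => ?_
      by_cases h : l.1 < k
      · simp [h]
      · simp [h, not_lt.1 h]
    · exact ((summable_mul_rows hX i j).indicator {l : Idx p | l.1 < k}).congr
        fun l => by simp [Set.indicator_apply]
    · exact Summable.ite_tail (summable_mul_rows hX i j) k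
  rw [kernelMatrix, Matrix.add_mulVec, Matrix.add_mulVec, Pi.add_apply, Pi.add_apply, ← add_assoc]
  congr 1
  simp only [Matrix.mulVec, dotProduct, Matrix.of_apply, tailMat, hent, add_mul,
    Finset.sum_add_distrib]
  congr 1
  simp only [colDot, Finset.mul_sum, Finset.sum_mul]
  rw [Finset.sum_comm]
  refine Finset.sum_congr rfl fun l _ => Finset.sum_congr rfl fun j _ => by ring

end Sample

section Deterministic

variable {p : ℕ∞} {n : ℕ} {X : Fin n → Idx p → ℝ}

theorem regressor_eq_colDot (X : Fin n → Idx p → ℝ) (lam : ℝ) (y : Fin n → ℝ) (k : Idx p) :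
    regressor X lam y k = colDot X ((kernelMatrix X lam)⁻¹ *ᵥ y) k := rfl

theorem regressor_eq_sum (X : Fin n → Idx p → ℝ) (lam : ℝ) (y : Fin n → ℝ) (k : Idx p) :
    regressor X lam y k = ∑ j, y j * colDot X (fun i => (kernelMatrix X lam)⁻¹ i j) k := by
  simp only [regressor, colDot, Matrix.mulVec, dotProduct, Finset.mul_sum]
  rw [Finset.sum_comm]
  exact Finset.sum_congr rfl fun j _ => Finset.sum_congr rfl fun i _ => by ring

/-- The variance term is controlled column by column of the inverse kernel matrix. -/
theorem varianceTerm_le {eig : Idx p → ℝ} {μ : Measure (Idx p → ℝ)} {ν : Measure ℝ}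
    [IsProbabilityMeasure ν] {σ : ℝ} (hμ : IsFeatureLaw eig μ) (hν : IsNoiseLaw σ ν)
    (hX : ∀ i, Summable fun l => X i l ^ 2) (lam : ℝ) :
    varianceTerm μ ν lam X ≤ ENNReal.ofReal (σ ^ 2) * ∑ j, ∑' k, ENNReal.ofReal
      (eig k * colDot X (fun i => (kernelMatrix X lam)⁻¹ i j) k ^ 2) := by
  classical
  calc varianceTerm μ ν lam X
      ≤ ∫⁻ ε, ∑' k, ENNReal.ofReal (eig k * regressor X lam ε k ^ 2)
          ∂(Measure.pi fun _ : Fin n => ν) := by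
        refine lintegral_mono fun ε => hμ.lintegral_sq_tsum_le ?_
        simp_rw [regressor_eq_colDot]
        exact summable_colDot_sq hX _
    _ = ∑' k, ENNReal.ofReal (eig k) * ENNReal.ofReal
          (σ ^ 2 * ∑ j, colDot X (fun i => (kernelMatrix X lam)⁻¹ i j) k ^ 2) := by
        simp_rw [regressor_eq_sum]
        rw [lintegral_tsum fun k => Measurable.aemeasurable (by fun_prop)]
        refine tsum_congr fun k => ?_
        simp_rw [ENNReal.ofReal_mul (hμ.eig_pos k).le]
        rw [lintegral_const_mul _ (by fun_prop), hν.lintegral_sq_sum]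
    _ = ∑' k, ENNReal.ofReal (σ ^ 2) * ∑ j, ENNReal.ofReal
          (eig k * colDot X (fun i => (kernelMatrix X lam)⁻¹ i j) k ^ 2) := by
        refine tsum_congr fun k => ?_
        rw [ENNReal.ofReal_mul (sq_nonneg σ), ENNReal.ofReal_sum_of_nonneg fun j _ => sq_nonneg _,
          mul_left_comm, Finset.mul_sum]
        simp_rw [ENNReal.ofReal_mul (hμ.eig_pos k).le]
    _ = _ := by
        rw [ENNReal.tsum_mul_left, Summable.tsum_finsetSum fun j _ => ENNReal.summable]

theorem dotProduct_self_eq_sum_sq (w : Fin n → ℝ) : w ⬝ᵥ w = ∑ i, w i ^ 2 := by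
  simp only [dotProduct, sq]

/-- The variance of ridge regression at a fixed sample: if the Gram matrix of the coordinates
from `k` on (with the ridge) has its spectrum in `[s, S]` and the whitened sample of the first `k`
coordinates has its squared singular values at least `τ`, then the variance is at most
`n (4 S / (s τ) + L / s) σ²`, where `L` bounds the remaining eigenvalues.

For a column `w = K⁻¹ e` of the inverse kernel matrix, the coordinates from `k` on contribute at
most `L wᵀ K w ≤ L / s`; on the first `k` coordinates `e - A w` is the image of
`h = Σ^{1/2} Xᵀ w` under the whitened sample, and `|A w|² ≤ S wᵀ A w ≤ S / s`. -/
theorem varianceBound_of_forms {eig : Idx p → ℝ} {μ : Measure (Idx p → ℝ)} {ν : Measure ℝ}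
    [IsProbabilityMeasure ν] {σ lam : ℝ} (hμ : IsFeatureLaw eig μ) (hν : IsNoiseLaw σ ν)
    (hX : ∀ i, Summable fun l => X i l ^ 2) (k : ℕ) {s S τ L B : ℝ} (hs : 0 < s) (hSpos : 0 < S)
    (hτ : 0 < τ) (hL0 : 0 ≤ L) (hlam : 0 ≤ lam) (hL : ∀ l : Idx p, k ≤ l.1 → eig l ≤ L)
    (hlow : ∀ w : Fin n → ℝ, s * ∑ i, w i ^ 2 ≤ tailForm k X w)
    (hup : ∀ w : Fin n → ℝ, tailForm k X w + n * lam * ∑ i, w i ^ 2 ≤ S * ∑ i, w i ^ 2)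
    (hhead : ∀ h : Idx p → ℝ, τ * ∑ l ∈ headSet p k, h l ^ 2 ≤
      ∑ i, (∑ l ∈ headSet p k, whiten eig (X i) l * h l) ^ 2)
    (hB : n * (4 * S / (s * τ) + L / s) * σ ^ 2 ≤ B) :
    VarianceBound μ ν lam B X := by
  classical
  set K := kernelMatrix X lam with hK
  set A := tailMat k X + ((n : ℝ) * lam) • (1 : Matrix (Fin n) (Fin n) ℝ) with hA
  have hnl : (0 : ℝ) ≤ n * lam := by positivity
  have hAform : ∀ w : Fin n → ℝ, w ⬝ᵥ A *ᵥ w = tailForm k X w + n * lam * ∑ i, w i ^ 2 := by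
    intro w
    rw [hA, Matrix.add_mulVec, dotProduct_add, dotProduct_tailMat hX, Matrix.smul_mulVec,
      Matrix.one_mulVec, dotProduct_smul, dotProduct_self_eq_sum_sq, smul_eq_mul]
  have hAsymm : A.IsSymm := (tailMat_isSymm k).add (Matrix.isSymm_one.smul _)
  have hApos : ∀ w : Fin n → ℝ, 0 ≤ w ⬝ᵥ A *ᵥ w := fun w => by
    rw [hAform]
    have := tailForm_nonneg (X := X) k w
    have : 0 ≤ ∑ i, w i ^ 2 := Finset.sum_nonneg fun i _ => sq_nonneg _
    positivity
  have hKmul : ∀ (w : Fin n → ℝ) i, (K *ᵥ w) i =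
      ∑ l ∈ headSet p k, X i l * colDot X w l + (A *ᵥ w) i := kernelMatrix_mulVec hX k lam
  have hKform : ∀ w : Fin n → ℝ,
      w ⬝ᵥ K *ᵥ w = ∑ l ∈ headSet p k, colDot X w l ^ 2 + w ⬝ᵥ A *ᵥ w := by
    intro w
    have : K *ᵥ w = (fun i => ∑ l ∈ headSet p k, X i l * colDot X w l) + A *ᵥ w :=
      funext fun i => hKmul w i
    rw [this, dotProduct_add]
    congr 1
    simp only [dotProduct, Finset.mul_sum]
    rw [Finset.sum_comm]
    refine Finset.sum_congr rfl fun l _ => ?_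
    rw [sq]
    nth_rw 2 [colDot]
    rw [Finset.sum_mul]
    exact Finset.sum_congr rfl fun i _ => by ring
  have hKlow : ∀ w : Fin n → ℝ, s * ∑ i, w i ^ 2 ≤ w ⬝ᵥ A *ᵥ w ∧ w ⬝ᵥ A *ᵥ w ≤ w ⬝ᵥ K *ᵥ w := by
    intro w
    have h0 : 0 ≤ n * lam * ∑ i, w i ^ 2 :=
      mul_nonneg hnl (Finset.sum_nonneg fun i _ => sq_nonneg _)
    have h1 : 0 ≤ ∑ l ∈ headSet p k, colDot X w l ^ 2 := Finset.sum_nonneg fun i _ => sq_nonneg _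
    refine ⟨by rw [hAform]; linarith [hlow w], by rw [hKform]; linarith⟩
  have hKunit : IsUnit K := by
    rw [← Matrix.mulVec_injective_iff_isUnit]
    refine (injective_iff_map_eq_zero K.mulVecLin).2 fun w hw => ?_
    rw [Matrix.mulVecLin_apply] at hw
    have h1 := hKlow w
    rw [hw, dotProduct_zero] at h1
    have h2 : ∑ i, w i ^ 2 ≤ 0 := by
      have : s * ∑ i, w i ^ 2 ≤ s * 0 := by linarith [h1.1, h1.2]
      exact le_of_mul_le_mul_left this hs
    rw [← dotProduct_self_eq_sum_sq] at h2
    exact dotProduct_self_eq_zero.1 (le_antisymm h2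
      (Finset.sum_nonneg fun i _ => mul_self_nonneg (w i)))
  have hKdet : IsUnit K.det := (Matrix.isUnit_iff_isUnit_det K).1 hKunit
  refine ⟨hKdet, ?_⟩
  have hcol : ∀ j, ∑' l, ENNReal.ofReal (eig l * colDot X (fun i => K⁻¹ i j) l ^ 2) ≤
      ENNReal.ofReal (4 * S / (s * τ) + L / s) := by
    intro j
    have hsS : s ≤ S := by
      have h1 := hlow (Pi.single j 1)
      have h2 := hup (Pi.single j 1)
      have h3 : ∑ i, (Pi.single j 1 : Fin n → ℝ) i ^ 2 = 1 := by simp [Pi.single_apply]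
      rw [h3] at h1 h2
      linarith
    set w : Fin n → ℝ := fun i => K⁻¹ i j with hw
    have hKw : K *ᵥ w = Pi.single j 1 := by
      have h1 : K * K⁻¹ = 1 := Matrix.mul_nonsing_inv K hKdet
      ext i
      have := congrFun (congrFun h1 i) j
      simp only [Matrix.mul_apply, Matrix.one_apply] at this
      simp only [Matrix.mulVec, dotProduct, hw, this, Pi.single_apply]
    have hwK : w ⬝ᵥ K *ᵥ w = w j := by rw [hKw]; simp
    obtain ⟨h1, h2⟩ := hKlow w
    rw [hwK] at h2
    have hwj : w j ≤ 1 / s := by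
      have h3 : w j ^ 2 ≤ ∑ i, w i ^ 2 :=
        Finset.single_le_sum (f := fun i => w i ^ 2) (fun i _ => sq_nonneg _) (Finset.mem_univ j)
      have h4 : s * w j ^ 2 ≤ w j := (mul_le_mul_of_nonneg_left h3 hs.le).trans (h1.trans h2)
      rw [le_div_iff₀ hs]
      by_contra hc
      push Not at hc
      have h5 : 0 < w j := by
        by_contra h6
        push Not at h6
        nlinarith
      nlinarith
    have hAw : w ⬝ᵥ A *ᵥ w ≤ 1 / s := h2.trans hwj
    have hAw2 : ∑ i, (A *ᵥ w) i ^ 2 ≤ S / s := by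
      rw [← dotProduct_self_eq_sum_sq]
      refine (mulVec_dotProduct_self_le hAsymm hApos (S := S) (fun x => ?_) w).trans ?_
      · rw [hAform, dotProduct_self_eq_sum_sq]
        exact hup x
      · rw [div_eq_mul_one_div S s]
        exact mul_le_mul_of_nonneg_left hAw hSpos.le
    have hheadj : ∑ l ∈ headSet p k, eig l * colDot X w l ^ 2 ≤ 4 * S / (s * τ) := by
      have h3 := hhead fun l => √(eig l) * colDot X w l
      have h4 : ∀ l, (√(eig l) * colDot X w l) ^ 2 = eig l * colDot X w l ^ 2 := fun l => by
        rw [mul_pow, Real.sq_sqrt (hμ.eig_pos l).le]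
      simp_rw [h4] at h3
      have h5 : ∀ i, ∑ l ∈ headSet p k, whiten eig (X i) l * (√(eig l) * colDot X w l) =
          (Pi.single j 1 : Fin n → ℝ) i - (A *ᵥ w) i := by
        intro i
        rw [← hKw, hKmul, add_sub_cancel_right]
        refine Finset.sum_congr rfl fun l _ => ?_
        have : √(eig l) ≠ 0 := (Real.sqrt_pos.2 (hμ.eig_pos l)).ne'
        rw [whiten]
        field_simp
      simp_rw [h5] at h3
      have h6 : ∑ i, ((Pi.single j 1 : Fin n → ℝ) i - (A *ᵥ w) i) ^ 2 ≤
          2 * (1 + S / s) := by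
        have h7 : ∑ i, (Pi.single j 1 : Fin n → ℝ) i ^ 2 = 1 := by
          simp [Pi.single_apply]
        calc ∑ i, ((Pi.single j 1 : Fin n → ℝ) i - (A *ᵥ w) i) ^ 2
            ≤ ∑ i, (2 * (Pi.single j 1 : Fin n → ℝ) i ^ 2 + 2 * (A *ᵥ w) i ^ 2) :=
              Finset.sum_le_sum fun i _ => by
                nlinarith [sq_nonneg ((Pi.single j 1 : Fin n → ℝ) i + (A *ᵥ w) i)]
          _ = 2 * (1 + ∑ i, (A *ᵥ w) i ^ 2) := by
              rw [Finset.sum_add_distrib, ← Finset.mul_sum, ← Finset.mul_sum, h7]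
              ring
          _ ≤ 2 * (1 + S / s) := by linarith
      have h8 : 1 ≤ S / s := (one_le_div hs).2 hsS
      have h9 : 4 * S / (s * τ) = 4 * (S / s) / τ := by field_simp
      rw [h9, le_div_iff₀ hτ]
      nlinarith
    rw [ENNReal.tsum_eq_iSup_sum]
    refine iSup_le fun t => ?_
    rw [← ENNReal.ofReal_sum_of_nonneg fun l _ => mul_nonneg (hμ.eig_pos l).le (sq_nonneg _)]
    refine ENNReal.ofReal_le_ofReal ?_
    have htail : tailForm k X w ≤ 1 / s := by
      refine le_trans ?_ hAw
      rw [hAform]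
      have : 0 ≤ ∑ i, w i ^ 2 := Finset.sum_nonneg fun i _ => sq_nonneg _
      nlinarith [mul_nonneg hnl this]
    have htail' : ∑ l ∈ t with k ≤ l.1, eig l * colDot X w l ^ 2 ≤ L / s := by
      calc ∑ l ∈ t with k ≤ l.1, eig l * colDot X w l ^ 2
          ≤ ∑ l ∈ t with k ≤ l.1, L * colDot X w l ^ 2 :=
            Finset.sum_le_sum fun l hl => mul_le_mul_of_nonneg_right
              (hL l (Finset.mem_filter.1 hl).2) (sq_nonneg _)
        _ = L * ∑ l ∈ t, if k ≤ l.1 then colDot X w l ^ 2 else 0 := by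
            rw [← Finset.mul_sum, Finset.sum_filter]
        _ ≤ L * tailForm k X w := mul_le_mul_of_nonneg_left
            ((summable_tailForm hX k w).sum_le_tsum t fun l _ => by split_ifs <;> positivity) hL0
        _ ≤ L / s := by
            rw [div_eq_mul_one_div L s]
            exact mul_le_mul_of_nonneg_left htail hL0
    rw [← Finset.sum_filter_add_sum_filter_not t fun l => k ≤ l.1, add_comm]
    refine add_le_add (le_trans ?_ hheadj) htail'
    refine Finset.sum_le_sum_of_subset_of_nonneg (fun l hl => ?_) fun l _ _ =>
      mul_nonneg (hμ.eig_pos l).le (sq_nonneg _)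
    simpa using (Finset.mem_filter.1 hl).2
  refine (varianceTerm_le hμ hν hX lam).trans ?_
  calc ENNReal.ofReal (σ ^ 2) * ∑ j, ∑' l, ENNReal.ofReal
        (eig l * colDot X (fun i => K⁻¹ i j) l ^ 2)
      ≤ ENNReal.ofReal (σ ^ 2) * ∑ _j : Fin n, ENNReal.ofReal (4 * S / (s * τ) + L / s) := by
        gcongr with j
        exact hcol j
    _ = ENNReal.ofReal (n * (4 * S / (s * τ) + L / s) * σ ^ 2) := by
        have h0 : 0 ≤ 4 * S / (s * τ) + L / s := by positivity
        rw [Finset.sum_const, Finset.card_univ, Fintype.card_fin, nsmul_eq_mul,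
          ENNReal.ofReal_mul (by positivity), ENNReal.ofReal_mul (by positivity),
          ENNReal.ofReal_natCast, mul_comm]
    _ ≤ ENNReal.ofReal B := ENNReal.ofReal_le_ofReal hB

end Deterministic

theorem ae_rows {E : Type*} [MeasurableSpace E] {μ : Measure E} [IsProbabilityMeasure μ] (n : ℕ)
    {P : E → Prop} (h : ∀ᵐ x ∂μ, P x) : ∀ᵐ X ∂(Measure.pi fun _ : Fin n => μ), ∀ i, P (X i) :=
  ae_all_iff.2 fun i =>
    (measurePreserving_eval (fun _ : Fin n => μ) i).quasiMeasurePreserving.ae h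

/-- Almost surely all rows of the sample are square-summable. -/
theorem IsFeatureLaw.ae_rows_summable {p : ℕ∞} {eig : Idx p → ℝ} {μ : Measure (Idx p → ℝ)}
    [IsProbabilityMeasure μ] (h : IsFeatureLaw eig μ) (n : ℕ) :
    ∀ᵐ X ∂(Measure.pi fun _ : Fin n => μ), ∀ i, Summable fun l => X i l ^ 2 :=
  ae_rows n h.ae_summable_sq

/-! ### Polynomial eigen-decay -/

/-- `tr Σ_{>k}` as a real number. -/
def tailTr {p : ℕ∞} (eig : Idx p → ℝ) (k : ℕ) : ℝ := ∑' l : Idx p, if k ≤ l.1 then eig l else 0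

theorem rpow_neg_sub_rpow_neg_ge {a : ℝ} (ha : 0 < a) {x : ℝ} (hx : 0 < x) :
    a * (x + 1) ^ (-1 - a) ≤ x ^ (-a) - (x + 1) ^ (-a) := by
  have hx1 : 0 < x + 1 := by linarith
  have h1 : x ^ (-a) = (x + 1) ^ (-a) * ((x + 1) / x) ^ a := by
    rw [Real.div_rpow hx1.le hx.le, Real.rpow_neg hx1.le, Real.rpow_neg hx.le]
    have := (Real.rpow_pos_of_pos hx1 a).ne'
    field_simp
  have h2 : (x + 1) ^ (-1 - a) = (x + 1) ^ (-a) * (1 / (x + 1)) := by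
    rw [show -1 - a = -a + (-1) by ring, Real.rpow_add hx1, Real.rpow_neg_one, one_div]
  have h3 : 1 + a * (1 / (x + 1)) ≤ ((x + 1) / x) ^ a := by
    rw [Real.rpow_def_of_pos (by positivity)]
    have h4 : 1 / (x + 1) ≤ Real.log ((x + 1) / x) := by
      have := Real.one_sub_inv_le_log_of_pos (x := (x + 1) / x) (by positivity)
      refine le_trans (le_of_eq ?_) this
      field_simp
      ring
    have := Real.add_one_le_exp (Real.log ((x + 1) / x) * a)
    nlinarith
  have h5 := Real.rpow_pos_of_pos hx1 (-a)
  rw [h1, h2]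
  nlinarith

theorem sum_rpow_Ico_le {a : ℝ} (ha : 0 < a) {k : ℕ} (hk : 1 ≤ k) (N : ℕ) :
    ∑ l ∈ Finset.Ico k N, ((l : ℝ) + 1) ^ (-1 - a) ≤ (k : ℝ) ^ (-a) / a := by
  rcases le_total N k with h | h
  · rw [Finset.Ico_eq_empty_of_le h]
    positivity
  have h1 : ∀ l ∈ Finset.Ico k N, ((l : ℝ) + 1) ^ (-1 - a) ≤
      ((l : ℝ) ^ (-a) - ((l + 1 : ℕ) : ℝ) ^ (-a)) / a := by
    intro l hl
    have hl1 : (0 : ℝ) < l := by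
      have := (Finset.mem_Ico.1 hl).1
      exact_mod_cast (by lia : 0 < l)
    rw [le_div_iff₀ ha, mul_comm]
    push_cast
    exact rpow_neg_sub_rpow_neg_ge ha hl1
  refine (Finset.sum_le_sum h1).trans ?_
  rw [← Finset.sum_div]
  have h2 : ∑ l ∈ Finset.Ico k N, ((l : ℝ) ^ (-a) - ((l + 1 : ℕ) : ℝ) ^ (-a)) =
      (k : ℝ) ^ (-a) - (N : ℝ) ^ (-a) := by
    have := Finset.sum_Ico_sub (fun l : ℕ => -(l : ℝ) ^ (-a)) h
    simp only [neg_sub_neg] at this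
    rw [this]
  rw [h2]
  have := Real.rpow_nonneg (Nat.cast_nonneg N) (-a)
  gcongr
  linarith

section Decay

variable {p : ℕ∞} {eig : Idx p → ℝ} {a c C : ℝ}

theorem PolyDecay.le_of_le (h : PolyDecay a c C eig) (ha : 0 < a) (hC : 0 ≤ C) {k : ℕ}
    (hk : 1 ≤ k) {l : Idx p} (hl : k ≤ l.1) : eig l ≤ C * (k : ℝ) ^ (-1 - a) := by
  refine (h l).2.trans (mul_le_mul_of_nonneg_left ?_ hC)
  refine Real.rpow_le_rpow_of_nonpos (by exact_mod_cast hk) ?_ (by linarith)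
  have : (k : ℝ) ≤ l.1 := by exact_mod_cast hl
  linarith

theorem PolyDecay.sum_le (h : PolyDecay a c C eig) (ha : 0 < a) (hC : 0 ≤ C) {k : ℕ}
    (hk : 1 ≤ k) (t : Finset (Idx p)) (ht : ∀ l ∈ t, k ≤ l.1) :
    ∑ l ∈ t, eig l ≤ C / a * (k : ℝ) ^ (-a) := by
  classical
  obtain ⟨N, hN⟩ : ∃ N, ∀ l ∈ t, l.1 < N := by
    refine ⟨t.sup (fun l => l.1) + 1, fun l hl => ?_⟩
    have : l.1 ≤ t.sup (fun l => l.1) := Finset.le_sup (f := fun l : Idx p => l.1) hl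
    lia
  calc ∑ l ∈ t, eig l ≤ ∑ l ∈ t, C * ((l.1 : ℝ) + 1) ^ (-1 - a) :=
        Finset.sum_le_sum fun l _ => (h l).2
    _ = C * ∑ l ∈ t.image Subtype.val, ((l : ℝ) + 1) ^ (-1 - a) := by
        rw [Finset.sum_image fun x _ y _ hxy => Subtype.val_injective hxy, Finset.mul_sum]
    _ ≤ C * ∑ l ∈ Finset.Ico k N, ((l : ℝ) + 1) ^ (-1 - a) := by
        refine mul_le_mul_of_nonneg_left ?_ hC
        refine Finset.sum_le_sum_of_subset_of_nonneg ?_ fun l _ _ => by positivity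
        intro l hl
        obtain ⟨l', hl', rfl⟩ := Finset.mem_image.1 hl
        exact Finset.mem_Ico.2 ⟨ht l' hl', hN l' hl'⟩
    _ ≤ C * ((k : ℝ) ^ (-a) / a) := mul_le_mul_of_nonneg_left (sum_rpow_Ico_le ha hk N) hC
    _ = _ := by ring

theorem PolyDecay.tailTr_le (h : PolyDecay a c C eig) (hpos : ∀ l, 0 < eig l)
    (ha : 0 < a) (hC : 0 ≤ C) {k : ℕ} (hk : 1 ≤ k) : tailTr eig k ≤ C / a * (k : ℝ) ^ (-a) := by
  classical
  refine Real.tsum_le_of_sum_le (fun l => by split_ifs; exacts [(hpos l).le, le_rfl])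
    fun t => ?_
  rw [← Finset.sum_filter]
  exact h.sum_le ha hC hk _ fun l hl => (Finset.mem_filter.1 hl).2

theorem tailTr_nonneg (hpos : ∀ l, 0 < eig l) (k : ℕ) : 0 ≤ tailTr eig k :=
  tsum_nonneg fun l => by split_ifs; exacts [(hpos l).le, le_rfl]

/-- Only the coordinates from `m` to `2m` are used. -/
theorem PolyDecay.le_tailTr (h : PolyDecay a c C eig) (hpos : ∀ l, 0 < eig l) (hs : Summable eig)
    (ha : 0 < a) (hc : 0 ≤ c) {m : ℕ} (hm : 1 ≤ m) (hp : ((2 * m : ℕ) : ℕ∞) ≤ p) :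
    c * 2 ^ (-1 - a) * (m : ℝ) ^ (-a) ≤ tailTr eig m := by
  classical
  have hlt : ∀ i : Fin m, ((m + i.1 : ℕ) : ℕ∞) < p := fun i =>
    lt_of_lt_of_le (by exact_mod_cast (by have := i.2; lia : m + i.1 < 2 * m)) hp
  let e : Fin m → Idx p := fun i => ⟨m + i.1, hlt i⟩
  have he : Function.Injective e := fun i j hij => by
    have := congrArg Subtype.val hij
    simp only [e] at this
    exact Fin.ext (by lia)
  have hm0 : (0 : ℝ) < m := by exact_mod_cast hm
  calc c * 2 ^ (-1 - a) * (m : ℝ) ^ (-a) = ∑ _i : Fin m, c * (2 * m : ℝ) ^ (-1 - a) := by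
        rw [Finset.sum_const, Finset.card_univ, Fintype.card_fin, nsmul_eq_mul,
          Real.mul_rpow (by norm_num) hm0.le, show -a = -1 - a + 1 by ring, Real.rpow_add hm0,
          Real.rpow_one]
        ring
    _ ≤ ∑ i : Fin m, eig (e i) := by
        refine Finset.sum_le_sum fun i _ => le_trans ?_ (h (e i)).1
        refine mul_le_mul_of_nonneg_left ?_ hc
        refine Real.rpow_le_rpow_of_nonpos (by positivity) ?_ (by linarith)
        have : ((i.1 + 1 : ℕ) : ℝ) ≤ m := by exact_mod_cast i.2
        simp only [e]
        push_cast at this ⊢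
        linarith
    _ = ∑ l ∈ Finset.univ.image e, if m ≤ l.1 then eig l else 0 := by
        rw [Finset.sum_image fun x _ y _ hxy => he hxy]
        exact Finset.sum_congr rfl fun i _ => by simp [e]
    _ ≤ tailTr eig m :=
        (Summable.ite_tail hs m).sum_le_tsum _
          fun l _ => by split_ifs; exacts [(hpos l).le, le_rfl]

end Decay

/-! ### Generic features -/

section Generic

variable {p : ℕ∞} {eig : Idx p → ℝ} {μ : Measure (Idx p → ℝ)}

/-- `‖x_{>k}‖²` as a real number. -/
def tailNormSq {p : ℕ∞} (k : ℕ) (x : Idx p → ℝ) : ℝ := ∑' l : Idx p, if k ≤ l.1 then x l ^ 2 else 0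

theorem tailSq_one_whiten (hpos : ∀ l, 0 < eig l) {x : Idx p → ℝ}
    (hx : Summable fun l => x l ^ 2) (k : ℕ) :
    tailSq eig 1 k (whiten eig x) = ENNReal.ofReal (tailNormSq k x) := by
  rw [tailNormSq, ENNReal.ofReal_tsum_of_nonneg (fun l => by split_ifs <;> positivity)
    (Summable.ite_tail hx k), tailSq]
  refine tsum_congr fun l => ?_
  split_ifs
  · rw [whiten, div_pow, Real.sq_sqrt (hpos l).le, pow_one, mul_div_cancel₀ _ (hpos l).ne']
  · simp

theorem tailTrace_one (hpos : ∀ l, 0 < eig l) (hs : Summable eig) (k : ℕ) :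
    tailTrace eig 1 k = ENNReal.ofReal (tailTr eig k) := by
  rw [tailTr, ENNReal.ofReal_tsum_of_nonneg
    (fun l => by split_ifs; exacts [(hpos l).le, le_rfl]) (Summable.ite_tail hs k), tailTrace]
  refine tsum_congr fun l => ?_
  split_ifs <;> simp

theorem tailTr_pos (hpos : ∀ l, 0 < eig l) (hs : Summable eig) {k : ℕ} (hk : (k : ℕ∞) < p) :
    0 < tailTr eig k := by
  refine (Summable.ite_tail hs k).tsum_pos (fun l => ?_) (⟨k, hk⟩ : Idx p) ?_
  · split_ifs; exacts [(hpos l).le, le_rfl]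
  · simpa using hpos _

theorem GenericFeatures.ae_bounds {α β : ℝ} (h : GenericFeatures α β eig μ)
    (hβ : 0 ≤ β) (hμ : IsFeatureLaw eig μ) {k : ℕ} (hk : (k : ℕ∞) < p) :
    ∀ᵐ x ∂μ, α * tailTr eig k ≤ tailNormSq k x ∧ tailNormSq k x ≤ β * tailTr eig k ∧
      (1 ≤ k → ∑ l ∈ headSet p k, whiten eig x l ^ 2 ≤ β * k) := by
  classical
  obtain ⟨h1, h2⟩ := h k hk
  have htr := tailTr_pos hμ.eig_pos hμ.trace_class hk
  have hα' := ae_essInf_le (μ := μ)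
    (f := fun x => tailSq eig 1 k (whiten eig x) / tailTrace eig 1 k)
  have hβ' := ENNReal.ae_le_essSup (μ := μ) (fun x => max (headSq k (whiten eig x) / (k : ℝ≥0∞))
    (max (tailSq eig 1 k (whiten eig x) / tailTrace eig 1 k)
      (tailSq eig 2 k (whiten eig x) / tailTrace eig 2 k)))
  filter_upwards [hμ.ae_summable_sq, hα', hβ'] with x hx hxα hxβ
  have hnn : 0 ≤ tailNormSq k x := tsum_nonneg fun l => by split_ifs <;> positivity
  have hq : tailSq eig 1 k (whiten eig x) / tailTrace eig 1 k =
      ENNReal.ofReal (tailNormSq k x / tailTr eig k) := by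
    rw [tailSq_one_whiten hμ.eig_pos hx, tailTrace_one hμ.eig_pos hμ.trace_class,
      ENNReal.ofReal_div_of_pos htr]
  refine ⟨?_, ?_, fun hk1 => ?_⟩
  · have := h1.trans hxα
    rw [hq, ENNReal.ofReal_le_ofReal_iff (by positivity), le_div_iff₀ htr] at this
    exact this
  · have := ((le_max_left _ _).trans (le_max_right _ _)).trans (hxβ.trans h2)
    rw [hq, ENNReal.ofReal_le_ofReal_iff hβ, div_le_iff₀ htr] at this
    exact this
  · have := (le_max_left _ _).trans (hxβ.trans h2)
    have hk0 : (0 : ℝ) < k := by exact_mod_cast hk1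
    have hhead : headSq k (whiten eig x) =
        ENNReal.ofReal (∑ l ∈ headSet p k, whiten eig x l ^ 2) := by
      rw [headSq, tsum_eq_sum (s := headSet p k) fun l hl => if_neg (by simpa using hl),
        ENNReal.ofReal_sum_of_nonneg fun l _ => sq_nonneg _]
      exact Finset.sum_congr rfl fun l hl => if_pos (by simpa using hl)
    rw [hhead, ← ENNReal.ofReal_natCast k, ← ENNReal.ofReal_div_of_pos hk0,
      ENNReal.ofReal_le_ofReal_iff hβ, div_le_iff₀ hk0] at this
    exact this

end Generic

/-! ### Near-orthogonality of the tails of the rows -/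

section OffDiagonal

variable {p : ℕ∞} {eig : Idx p → ℝ} {μ : Measure (Idx p → ℝ)} {n : ℕ}

theorem tailForm_anti {X : Fin n → Idx p → ℝ} (hX : ∀ i, Summable fun l => X i l ^ 2) {k m : ℕ}
    (hkm : k ≤ m) (w : Fin n → ℝ) : tailForm m X w ≤ tailForm k X w := by
  refine (summable_tailForm hX m w).tsum_le_tsum (fun l => ?_) (summable_tailForm hX k w)
  split_ifs with h1 h2
  · exact le_rfl
  · exact absurd (hkm.trans h1) h2
  · positivity
  · exact le_rfl

theorem measurable_tailMat (k : ℕ) (i j : Fin n) :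
    Measurable fun X : Fin n → Idx p → ℝ => tailMat k X i j := by
  simp only [tailMat, Matrix.of_apply]
  exact Measurable.tsum fun l => by split_ifs <;> fun_prop

theorem lintegral_tailMat_sq_le [IsProbabilityMeasure μ] (hμ : IsFeatureLaw eig μ) {k : ℕ} {L : ℝ}
    (hL0 : 0 ≤ L) (hL : ∀ l : Idx p, k ≤ l.1 → eig l ≤ L) {i j : Fin n} (hij : i ≠ j) :
    ∫⁻ X, ENNReal.ofReal (tailMat k X i j ^ 2) ∂(Measure.pi fun _ : Fin n => μ) ≤
      ENNReal.ofReal (L * tailTr eig k) := by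
  let F : (Idx p → ℝ) × (Idx p → ℝ) → ℝ≥0∞ := fun z =>
    ENNReal.ofReal ((∑' l : Idx p, z.2 l * (if k ≤ l.1 then z.1 l else 0)) ^ 2)
  have hF : Measurable F := by
    refine ENNReal.measurable_ofReal.comp (Measurable.pow_const (Measurable.tsum fun l => ?_) 2)
    split_ifs <;> fun_prop
  have hind : IndepFun (fun X : Fin n → Idx p → ℝ => X i) (fun X : Fin n → Idx p → ℝ => X j)
      (Measure.pi fun _ : Fin n => μ) :=
    (iIndepFun_pi (μ := fun _ : Fin n => μ) (X := fun _ e => e)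
      (fun _ => aemeasurable_id)).indepFun hij
  have hmap : (Measure.pi fun _ : Fin n => μ).map (fun X => (X i, X j)) = μ.prod μ := by
    rw [(indepFun_iff_map_prod_eq_prod_map_map
      (measurable_pi_apply i).aemeasurable (measurable_pi_apply j).aemeasurable).1 hind,
      (measurePreserving_eval (fun _ : Fin n => μ) i).map_eq,
      (measurePreserving_eval (fun _ : Fin n => μ) j).map_eq]
  calc ∫⁻ X, ENNReal.ofReal (tailMat k X i j ^ 2) ∂(Measure.pi fun _ : Fin n => μ)
      = ∫⁻ X, F (X i, X j) ∂(Measure.pi fun _ : Fin n => μ) := by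
        refine lintegral_congr fun X => ?_
        simp only [F, tailMat, Matrix.of_apply]
        congr 2
        refine tsum_congr fun l => ?_
        split_ifs <;> ring
    _ = ∫⁻ z, F z ∂(μ.prod μ) := by
        rw [← hmap, lintegral_map hF (by fun_prop)]
    _ = ∫⁻ x, ∫⁻ y, F (x, y) ∂μ ∂μ := lintegral_prod _ hF.aemeasurable
    _ ≤ ∫⁻ x, ∑' l : Idx p, ENNReal.ofReal (eig l * (if k ≤ l.1 then x l else 0) ^ 2) ∂μ := by
        refine lintegral_mono_ae ?_
        filter_upwards [hμ.ae_summable_sq] with x hx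
        refine hμ.lintegral_sq_tsum_le ((Summable.ite_tail hx k).congr fun l => ?_)
        split_ifs <;> simp
    _ = ∑' l : Idx p, if k ≤ l.1 then ENNReal.ofReal (eig l) * ENNReal.ofReal (eig l) else 0 := by
        rw [lintegral_tsum fun l => Measurable.aemeasurable (by split_ifs <;> fun_prop)]
        refine tsum_congr fun l => ?_
        split_ifs
        · simp_rw [ENNReal.ofReal_mul (hμ.eig_pos l).le]
          rw [lintegral_const_mul _ (by fun_prop), hμ.lintegral_sq]
        · simp
    _ ≤ ∑' l : Idx p, ENNReal.ofReal L * ENNReal.ofReal (if k ≤ l.1 then eig l else 0) := by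
        refine ENNReal.tsum_le_tsum fun l => ?_
        split_ifs with h
        · gcongr
          exact hL l h
        · simp
    _ = ENNReal.ofReal (L * tailTr eig k) := by
        rw [ENNReal.tsum_mul_left, ENNReal.ofReal_mul hL0, tailTr, ENNReal.ofReal_tsum_of_nonneg
          (fun l => by split_ifs; exacts [(hμ.eig_pos l).le, le_rfl])
          (Summable.ite_tail hμ.trace_class k)]

/-- The squared Frobenius norm of the off-diagonal part of the tail Gram matrix. -/
def offDiagSq (k : ℕ) (X : Fin n → Idx p → ℝ) : ℝ :=
  ∑ i, ∑ j, if i = j then 0 else tailMat k X i j ^ 2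

theorem measure_offDiagSq_ge_le [IsProbabilityMeasure μ] (hμ : IsFeatureLaw eig μ) {k : ℕ} {L : ℝ}
    (hL0 : 0 ≤ L) (hL : ∀ l : Idx p, k ≤ l.1 → eig l ≤ L) {t : ℝ} (ht : 0 < t) :
    (Measure.pi fun _ : Fin n => μ) {X | t ≤ offDiagSq k X} ≤
      ENNReal.ofReal (n ^ 2 * (L * tailTr eig k) / t) := by
  have hmeas : ∀ i j : Fin n, Measurable fun X : Fin n → Idx p → ℝ =>
      ENNReal.ofReal (if i = j then 0 else tailMat k X i j ^ 2) := fun i j => by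
    split_ifs
    · fun_prop
    · exact ENNReal.measurable_ofReal.comp ((measurable_tailMat k i j).pow_const 2)
  have hLt : 0 ≤ L * tailTr eig k := mul_nonneg hL0 (tailTr_nonneg hμ.eig_pos k)
  have hsum : ∀ X : Fin n → Idx p → ℝ, ENNReal.ofReal (offDiagSq k X) =
      ∑ i, ∑ j, ENNReal.ofReal (if i = j then 0 else tailMat k X i j ^ 2) := fun X => by
    rw [offDiagSq, ENNReal.ofReal_sum_of_nonneg fun i _ => Finset.sum_nonneg fun j _ => by
      split_ifs <;> positivity]
    exact Finset.sum_congr rfl fun i _ => ENNReal.ofReal_sum_of_nonneg fun j _ => by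
      split_ifs <;> positivity
  have hint : ∫⁻ X, ENNReal.ofReal (offDiagSq k X) ∂(Measure.pi fun _ : Fin n => μ) ≤
      ENNReal.ofReal (n ^ 2 * (L * tailTr eig k)) := by
    simp_rw [hsum]
    rw [lintegral_finsetSum _ fun i _ => Finset.measurable_sum _ fun j _ => hmeas i j]
    simp_rw [lintegral_finsetSum _ fun j _ => hmeas _ j]
    calc _ ≤ ∑ _i : Fin n, ∑ _j : Fin n, ENNReal.ofReal (L * tailTr eig k) := by
          refine Finset.sum_le_sum fun i _ => Finset.sum_le_sum fun j _ => ?_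
          split_ifs with hij
          · simp
          · exact lintegral_tailMat_sq_le hμ hL0 hL hij
      _ = ENNReal.ofReal (n ^ 2 * (L * tailTr eig k)) := by
          simp only [Finset.sum_const, Finset.card_univ, Fintype.card_fin, nsmul_eq_mul]
          rw [sq, mul_assoc, ENNReal.ofReal_mul n.cast_nonneg, ENNReal.ofReal_mul n.cast_nonneg,
            ENNReal.ofReal_natCast]
  have hsub : {X : Fin n → Idx p → ℝ | t ≤ offDiagSq k X} ⊆
      {X | ENNReal.ofReal t ≤ ENNReal.ofReal (offDiagSq k X)} :=
    fun X hX => ENNReal.ofReal_le_ofReal hX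
  refine (measure_mono hsub).trans ?_
  refine (meas_ge_le_lintegral_div ?_ (by simpa using ht) ENNReal.ofReal_ne_top).trans ?_
  · simp_rw [hsum]
    exact (Finset.measurable_sum _ fun i _ => Finset.measurable_sum _ fun j _ =>
      hmeas i j).aemeasurable
  · rw [ENNReal.ofReal_div_of_pos ht]
    gcongr

theorem tailForm_ge_of_offDiagSq {X : Fin n → Idx p → ℝ} (hX : ∀ i, Summable fun l => X i l ^ 2)
    {k : ℕ} {t d : ℝ} (ht : 0 ≤ t) (hdiag : ∀ i, d ≤ tailNormSq k (X i))
    (hoff : offDiagSq k X ≤ t ^ 2) (w : Fin n → ℝ) :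
    (d - t) * ∑ i, w i ^ 2 ≤ tailForm k X w := by
  set W := ∑ i, w i ^ 2 with hW
  have hW0 : 0 ≤ W := Finset.sum_nonneg fun i _ => sq_nonneg _
  set O : Fin n × Fin n → ℝ := fun q => if q.1 = q.2 then 0 else tailMat k X q.1 q.2 with hO
  have hOsq : ∑ q, O q ^ 2 = offDiagSq k X := by
    rw [Fintype.sum_prod_type, offDiagSq]
    refine Finset.sum_congr rfl fun i _ => Finset.sum_congr rfl fun j _ => ?_
    simp only [hO]
    split_ifs <;> simp
  have hCS := Finset.sum_mul_sq_le_sq_mul_sq Finset.univ O fun q => w q.1 * w q.2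
  have hWW : ∑ q : Fin n × Fin n, (w q.1 * w q.2) ^ 2 = W ^ 2 := by
    rw [Fintype.sum_prod_type, sq W, hW, Finset.sum_mul_sum]
    exact Finset.sum_congr rfl fun i _ => Finset.sum_congr rfl fun j _ => by ring
  rw [hOsq, hWW] at hCS
  have hcross : -(t * W) ≤ ∑ q, O q * (w q.1 * w q.2) := by
    have h1 : (∑ q, O q * (w q.1 * w q.2)) ^ 2 ≤ (t * W) ^ 2 := by
      rw [mul_pow]
      exact hCS.trans (mul_le_mul_of_nonneg_right hoff (sq_nonneg W))
    exact (abs_le.1 (abs_le_of_sq_le_sq h1 (mul_nonneg ht hW0))).1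
  have hform : tailForm k X w =
      ∑ i, w i ^ 2 * tailNormSq k (X i) + ∑ q, O q * (w q.1 * w q.2) := by
    rw [← dotProduct_tailMat hX, Fintype.sum_prod_type, ← Finset.sum_add_distrib]
    simp only [dotProduct, Matrix.mulVec, Finset.mul_sum]
    refine Finset.sum_congr rfl fun i _ => ?_
    have hdiag' : tailNormSq k (X i) = tailMat k X i i := by
      simp only [tailNormSq, tailMat, Matrix.of_apply, sq]
    rw [← Finset.add_sum_erase _ _ (Finset.mem_univ i),
      ← Finset.add_sum_erase (a := i) (f := fun j => O (i, j) * (w i * w j)) _ (Finset.mem_univ i),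
      hdiag']
    have : ∀ j ∈ Finset.univ.erase i, w i * (tailMat k X i j * w j) = O (i, j) * (w i * w j) := by
      intro j hj
      simp only [hO]
      rw [if_neg (Finset.ne_of_mem_erase hj).symm]
      ring
    rw [Finset.sum_congr rfl this]
    simp only [hO, if_true]
    ring
  have hd : d * W ≤ ∑ i, w i ^ 2 * tailNormSq k (X i) := by
    rw [hW, Finset.mul_sum]
    refine Finset.sum_le_sum fun i _ => ?_
    rw [mul_comm]
    exact mul_le_mul_of_nonneg_left (hdiag i) (sq_nonneg _)
  rw [hform]
  linarith

end OffDiagonal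

/-! ### Trace powers under rank-one perturbations -/

section RankOne

/-- Moments of a measure on `[0, ∞)` are positively correlated. -/
theorem sum_pow_mul_sum_pow_le {ι : Type*} [Fintype ι] {d w : ι → ℝ} (hd : ∀ i, 0 ≤ d i)
    (hw : ∀ i, 0 ≤ w i) (a b : ℕ) :
    (∑ i, d i ^ a * w i) * (∑ i, d i ^ b * w i) ≤ (∑ i, w i) * ∑ i, d i ^ (a + b) * w i := by
  have key : 0 ≤ ∑ i, ∑ j, w i * w j * ((d i ^ a - d j ^ a) * (d i ^ b - d j ^ b)) := by
    refine Finset.sum_nonneg fun i _ => Finset.sum_nonneg fun j _ =>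
      mul_nonneg (mul_nonneg (hw i) (hw j)) ?_
    rcases le_total (d i) (d j) with h | h
    · exact mul_nonneg_of_nonpos_of_nonpos (sub_nonpos.2 (pow_le_pow_left₀ (hd i) h a))
        (sub_nonpos.2 (pow_le_pow_left₀ (hd i) h b))
    · exact mul_nonneg (sub_nonneg.2 (pow_le_pow_left₀ (hd j) h a))
        (sub_nonneg.2 (pow_le_pow_left₀ (hd j) h b))
  have hexp : ∑ i, ∑ j, w i * w j * ((d i ^ a - d j ^ a) * (d i ^ b - d j ^ b)) =
      2 * ((∑ i, w i) * ∑ i, d i ^ (a + b) * w i) -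
        2 * ((∑ i, d i ^ a * w i) * (∑ i, d i ^ b * w i)) := by
    have e1 : ∑ i, ∑ j, w i * w j * ((d i ^ a - d j ^ a) * (d i ^ b - d j ^ b)) =
        ∑ i, ∑ j, ((d i ^ (a + b) * w i) * w j + w i * (d j ^ (a + b) * w j)
          - (d i ^ a * w i) * (d j ^ b * w j) - (d i ^ b * w i) * (d j ^ a * w j)) :=
      Finset.sum_congr rfl fun i _ => Finset.sum_congr rfl fun j _ => by ring
    rw [e1]
    simp only [Finset.sum_sub_distrib, Finset.sum_add_distrib, ← Finset.sum_mul_sum]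
    ring
  rw [hexp] at key
  linarith

theorem posSemidef_vecMulVec {ι : Type*} [Fintype ι] (y : ι → ℝ) :
    (Matrix.vecMulVec y y).PosSemidef := by
  simpa using Matrix.posSemidef_vecMulVec_self_star y

theorem trace_mul_vecMulVec_mul {ι : Type*} [Fintype ι] (A B : Matrix ι ι ℝ) (u w : ι → ℝ) :
    (A * Matrix.vecMulVec u w * B).trace = w ⬝ᵥ (B * A) *ᵥ u := by
  rw [Matrix.trace_mul_comm, ← mul_assoc, Matrix.mul_vecMulVec, Matrix.trace_vecMulVec,
    dotProduct_comm]

variable {ι : Type*} [Fintype ι] [DecidableEq ι]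

theorem pow_sub_pow_eq_sum {R : Type*} [Ring R] (A B : R) (q : ℕ) :
    A ^ q - B ^ q = ∑ j ∈ Finset.range q, A ^ j * (A - B) * B ^ (q - 1 - j) := by
  induction q with
  | zero => simp
  | succ q ih =>
    rw [Finset.sum_range_succ]
    have h : ∀ j ∈ Finset.range q, A ^ j * (A - B) * B ^ (q + 1 - 1 - j) =
        A ^ j * (A - B) * B ^ (q - 1 - j) * B := by
      intro j hj
      have := Finset.mem_range.1 hj
      rw [mul_assoc _ _ B, ← pow_succ]
      congr 2
      lia
    rw [Finset.sum_congr rfl h, ← Finset.sum_mul, ← ih]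
    simp only [Nat.add_sub_cancel, Nat.sub_self, pow_zero, mul_one, pow_succ]
    noncomm_ring

theorem exists_spectral {A : Matrix ι ι ℝ} (hA : A.PosSemidef) :
    ∃ (U : Matrix ι ι ℝ) (d : ι → ℝ), (∀ i, 0 ≤ d i) ∧ Uᵀ * U = 1 ∧ U * Uᵀ = 1 ∧
      A = U * Matrix.diagonal d * Uᵀ := by
  refine ⟨(hA.isHermitian.eigenvectorUnitary : Matrix ι ι ℝ), hA.isHermitian.eigenvalues,
    hA.eigenvalues_nonneg, ?_, ?_, ?_⟩
  · exact Unitary.coe_star_mul_self hA.isHermitian.eigenvectorUnitary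
  · exact Unitary.coe_mul_star_self hA.isHermitian.eigenvectorUnitary
  · have := hA.isHermitian.spectral_theorem
    rw [Unitary.conjStarAlgAut_apply] at this
    simpa [Matrix.star_eq_conjTranspose, Function.comp_def] using this

theorem spectral_pow {U : Matrix ι ι ℝ} {d : ι → ℝ} (hU : Uᵀ * U = 1) (hU' : U * Uᵀ = 1) (q : ℕ) :
    (U * Matrix.diagonal d * Uᵀ) ^ q = U * Matrix.diagonal (fun i => d i ^ q) * Uᵀ := by
  induction q with
  | zero => simp [hU']
  | succ q ih =>
    rw [pow_succ, ih]
    calc U * Matrix.diagonal (fun i => d i ^ q) * Uᵀ * (U * Matrix.diagonal d * Uᵀ)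
        = U * Matrix.diagonal (fun i => d i ^ q) * (Uᵀ * U) * Matrix.diagonal d * Uᵀ := by
          noncomm_ring
      _ = U * (Matrix.diagonal (fun i => d i ^ q) * Matrix.diagonal d) * Uᵀ := by
          rw [hU]; noncomm_ring
      _ = _ := by rw [Matrix.diagonal_mul_diagonal]; simp only [pow_succ]

theorem spectral_form (U : Matrix ι ι ℝ) (d : ι → ℝ) (y : ι → ℝ) :
    y ⬝ᵥ (U * Matrix.diagonal d * Uᵀ) *ᵥ y = ∑ i, d i * (Uᵀ *ᵥ y) i ^ 2 := by
  rw [mul_assoc, ← Matrix.mulVec_mulVec, Matrix.dotProduct_mulVec, ← Matrix.mulVec_transpose,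
    ← Matrix.mulVec_mulVec]
  simp only [dotProduct, Matrix.mulVec_diagonal]
  exact Finset.sum_congr rfl fun i _ => by ring

theorem spectral_trace {U : Matrix ι ι ℝ} {d : ι → ℝ} (hU : Uᵀ * U = 1) :
    (U * Matrix.diagonal d * Uᵀ).trace = ∑ i, d i := by
  rw [Matrix.trace_mul_comm, ← mul_assoc, hU, one_mul, Matrix.trace_diagonal]

theorem sum_sq_transpose_mulVec {U : Matrix ι ι ℝ} (hU' : U * Uᵀ = 1) (y : ι → ℝ) :
    ∑ i, (Uᵀ *ᵥ y) i ^ 2 = y ⬝ᵥ y := by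
  have := spectral_form U (fun _ => 1) y
  simp only [one_mul] at this
  rw [← this, Matrix.diagonal_one, mul_one, hU', Matrix.one_mulVec]

theorem form_pow_mul_form_pow_le {A : Matrix ι ι ℝ} (hA : A.PosSemidef) (y : ι → ℝ) (a b : ℕ) :
    (y ⬝ᵥ (A ^ a) *ᵥ y) * (y ⬝ᵥ (A ^ b) *ᵥ y) ≤ (y ⬝ᵥ y) * (y ⬝ᵥ (A ^ (a + b)) *ᵥ y) := by
  obtain ⟨U, d, hd, hU, hU', rfl⟩ := exists_spectral hA
  simp only [spectral_pow hU hU', spectral_form]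
  rw [← sum_sq_transpose_mulVec hU' y]
  exact sum_pow_mul_sum_pow_le hd (fun i => sq_nonneg _) a b

theorem form_le_of_trace_pow_le {A : Matrix ι ι ℝ} (hA : A.PosSemidef) {q : ℕ} (hq : q ≠ 0) {t : ℝ}
    (ht : 0 ≤ t) (h : (A ^ q).trace ≤ t ^ q) (x : ι → ℝ) : x ⬝ᵥ A *ᵥ x ≤ t * (x ⬝ᵥ x) := by
  obtain ⟨U, d, hd, hU, hU', rfl⟩ := exists_spectral hA
  rw [spectral_pow hU hU', spectral_trace hU] at h
  rw [spectral_form, ← sum_sq_transpose_mulVec hU' x, Finset.mul_sum]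
  refine Finset.sum_le_sum fun i _ => mul_le_mul_of_nonneg_right ?_ (sq_nonneg _)
  refine le_of_pow_le_pow_left₀ hq ht (le_trans ?_ h)
  exact Finset.single_le_sum (f := fun i => d i ^ q) (fun i _ => pow_nonneg (hd i) q)
    (Finset.mem_univ i)

theorem mul_trace_pow_le {A : Matrix ι ι ℝ} (hA : A.PosSemidef) (q : ℕ) {θ : ℝ} (hθ : 0 ≤ θ) :
    θ * (A ^ q).trace ≤ (A ^ (q + 1)).trace + Fintype.card ι * θ ^ (q + 1) := by
  obtain ⟨U, d, hd, hU, hU', rfl⟩ := exists_spectral hA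
  rw [spectral_pow hU hU', spectral_pow hU hU', spectral_trace hU, spectral_trace hU,
    Finset.mul_sum, ← nsmul_eq_mul, ← Finset.card_univ, ← Finset.sum_const,
    ← Finset.sum_add_distrib]
  refine Finset.sum_le_sum fun i _ => ?_
  rcases le_total θ (d i) with h | h
  · have : θ * d i ^ q ≤ d i ^ (q + 1) := by
      rw [pow_succ, mul_comm]
      exact mul_le_mul_of_nonneg_left h (pow_nonneg (hd i) q)
    have := pow_nonneg hθ (q + 1)
    linarith
  · have : θ * d i ^ q ≤ θ ^ (q + 1) := by
      rw [pow_succ, mul_comm]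
      exact mul_le_mul_of_nonneg_right (pow_le_pow_left₀ (hd i) h q) hθ
    have := pow_nonneg (hd i) (q + 1)
    linarith

theorem form_pow_le_form_pow_succ {W : Matrix ι ι ℝ} (hW : W.PosSemidef) (y : ι → ℝ) (q : ℕ) :
    y ⬝ᵥ ((1 + W) ^ q) *ᵥ y ≤ y ⬝ᵥ ((1 + W) ^ (q + 1)) *ᵥ y := by
  obtain ⟨U, d, hd, hU, hU', rfl⟩ := exists_spectral hW
  have h1 : 1 + U * Matrix.diagonal d * Uᵀ = U * Matrix.diagonal (fun i => 1 + d i) * Uᵀ := by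
    have : Matrix.diagonal (fun i => 1 + d i) = 1 + Matrix.diagonal d := by
      rw [← Matrix.diagonal_one, Matrix.diagonal_add]
    rw [this, mul_add, mul_one, add_mul, hU']
  rw [h1, spectral_pow hU hU', spectral_pow hU hU', spectral_form, spectral_form]
  refine Finset.sum_le_sum fun i _ => mul_le_mul_of_nonneg_right ?_ (sq_nonneg _)
  exact pow_le_pow_right₀ (by linarith [hd i]) (Nat.le_succ q)

/-- Mixed powers of `M = 1 + W` and its rank-one update, tested against the update vector, are
comparable with the powers of `M` alone. -/
theorem form_pow_mul_update_pow_le {W : Matrix ι ι ℝ} (hW : W.PosSemidef) {y : ι → ℝ} {R : ℝ}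
    (hy : y ⬝ᵥ y ≤ R) (b : ℕ) : ∀ a : ℕ,
    y ⬝ᵥ ((1 + W) ^ a * (1 + W + Matrix.vecMulVec y y) ^ b) *ᵥ y ≤
      (1 + R) ^ b * (y ⬝ᵥ ((1 + W) ^ (a + b)) *ᵥ y) := by
  have hR : 0 ≤ R := le_trans (Finset.sum_nonneg fun i _ => mul_self_nonneg (y i)) hy
  have hM : (1 + W).PosSemidef := Matrix.PosSemidef.one.add hW
  have hm : ∀ q, 0 ≤ y ⬝ᵥ ((1 + W) ^ q) *ᵥ y := fun q => by
    simpa using (hM.pow q).dotProduct_mulVec_nonneg y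
  induction b with
  | zero => intro a; simp
  | succ b ih =>
    intro a
    have hsplit : y ⬝ᵥ ((1 + W) ^ a * (1 + W + Matrix.vecMulVec y y) ^ (b + 1)) *ᵥ y =
        y ⬝ᵥ ((1 + W) ^ (a + 1) * (1 + W + Matrix.vecMulVec y y) ^ b) *ᵥ y +
        (y ⬝ᵥ ((1 + W) ^ a) *ᵥ y) *
          (y ⬝ᵥ ((1 + W) ^ 0 * (1 + W + Matrix.vecMulVec y y) ^ b) *ᵥ y) := by
      rw [pow_succ' _ b, add_mul, mul_add, ← mul_assoc, ← pow_succ, Matrix.add_mulVec,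
        dotProduct_add, pow_zero, one_mul]
      congr 1
      rw [← Matrix.mulVec_mulVec, ← Matrix.mulVec_mulVec, Matrix.vecMulVec_mulVec,
        Matrix.mulVec_smul, dotProduct_smul]
      simp
    rw [hsplit]
    have h1 := ih (a + 1)
    have h2 := ih 0
    rw [zero_add] at h2
    have h3 := form_pow_mul_form_pow_le hM y a b
    have h4 := form_pow_le_form_pow_succ hW y (a + b)
    have h5 : (y ⬝ᵥ y) * (y ⬝ᵥ ((1 + W) ^ (a + b)) *ᵥ y) ≤
        R * (y ⬝ᵥ ((1 + W) ^ (a + b + 1)) *ᵥ y) :=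
      mul_le_mul hy h4 (hm _) hR
    have h6 : (0 : ℝ) ≤ (1 + R) ^ b := by positivity
    have h7 := mul_le_mul_of_nonneg_left h2 (hm a)
    have h8 := mul_le_mul_of_nonneg_left (h3.trans h5) h6
    rw [show a + 1 + b = a + b + 1 by ring] at h1
    rw [show a + (b + 1) = a + b + 1 by ring, pow_succ (1 + R) b]
    nlinarith

/-- Growth of a trace power under a rank-one update. -/
theorem trace_pow_update_le {W : Matrix ι ι ℝ} (hW : W.PosSemidef) {y : ι → ℝ} {R : ℝ}
    (hy : y ⬝ᵥ y ≤ R) (q : ℕ) :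
    ((1 + W + Matrix.vecMulVec y y) ^ q).trace ≤
      ((1 + W) ^ q).trace + q * (1 + R) ^ q * (y ⬝ᵥ ((1 + W) ^ (q - 1)) *ᵥ y) := by
  have hR : 0 ≤ R := le_trans (Finset.sum_nonneg fun i _ => mul_self_nonneg (y i)) hy
  have hm : ∀ q, 0 ≤ y ⬝ᵥ ((1 + W) ^ q) *ᵥ y := fun q => by
    simpa using ((Matrix.PosSemidef.one.add hW).pow q).dotProduct_mulVec_nonneg y
  have hdiff : ((1 + W + Matrix.vecMulVec y y) ^ q).trace - ((1 + W) ^ q).trace =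
      ∑ j ∈ Finset.range q,
        y ⬝ᵥ ((1 + W) ^ (q - 1 - j) * (1 + W + Matrix.vecMulVec y y) ^ j) *ᵥ y := by
    rw [← Matrix.trace_sub, pow_sub_pow_eq_sum, Matrix.trace_sum]
    refine Finset.sum_congr rfl fun j _ => ?_
    rw [add_sub_cancel_left, trace_mul_vecMulVec_mul]
  have hsum : ∑ j ∈ Finset.range q,
      y ⬝ᵥ ((1 + W) ^ (q - 1 - j) * (1 + W + Matrix.vecMulVec y y) ^ j) *ᵥ y ≤
      ∑ _j ∈ Finset.range q, (1 + R) ^ q * (y ⬝ᵥ ((1 + W) ^ (q - 1)) *ᵥ y) := by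
    refine Finset.sum_le_sum fun j hj => ?_
    have hjq := Finset.mem_range.1 hj
    refine (form_pow_mul_update_pow_le hW hy j _).trans ?_
    rw [show q - 1 - j + j = q - 1 by lia]
    exact mul_le_mul_of_nonneg_right (pow_le_pow_right₀ (by linarith) hjq.le) (hm _)
  rw [Finset.sum_const, Finset.card_range, nsmul_eq_mul, ← mul_assoc] at hsum
  linarith

/-- Decrease of a trace power of the inverse under a rank-one update. With `v = M⁻¹ y`,
`r = yᵀ v` and the positive semidefinite matrix `B = M⁻¹ - v vᵀ / r`, the two inverses are
`B + v vᵀ / r` and `B + κ v vᵀ / r`. Both preserve the cone of the vectors `x` with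
`vᵀ B ^ j x ≥ 0` for all `j`, and in the order of this cone the updated inverse is at least `κ`
times the original one. -/
theorem trace_inv_pow_update_le {M : Matrix ι ι ℝ} (hM : M.PosDef) (y : ι → ℝ) {κ : ℝ}
    (hκ : κ = (1 + y ⬝ᵥ M⁻¹ *ᵥ y)⁻¹) (q : ℕ) :
    (((M + Matrix.vecMulVec y y)⁻¹) ^ q).trace + q * κ ^ q * (y ⬝ᵥ (M⁻¹ ^ (q + 1)) *ᵥ y) ≤
      (M⁻¹ ^ q).trace := by
  rcases eq_or_ne y 0 with rfl | hy0
  · simp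
  set N := M⁻¹ with hN
  have hNpd : N.PosDef := hM.inv
  have hNsymm : N.IsSymm := by simpa [Matrix.IsHermitian, Matrix.IsSymm] using hNpd.isHermitian
  have hNpos : ∀ x : ι → ℝ, 0 ≤ x ⬝ᵥ N *ᵥ x := fun x => by
    simpa using hNpd.posSemidef.dotProduct_mulVec_nonneg x
  set r := y ⬝ᵥ N *ᵥ y with hr
  have hrpos : 0 < r := by simpa using hNpd.dotProduct_mulVec_pos hy0
  have hκ0 : 0 < κ := by rw [hκ]; positivity
  have hκ1 : κ ≤ 1 := by rw [hκ]; exact inv_le_one_of_one_le₀ (by linarith)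
  set M' := M + Matrix.vecMulVec y y with hM'
  have hM'pd : M'.PosDef := hM.add_posSemidef (posSemidef_vecMulVec y)
  set N' := M'⁻¹ with hN'
  have hN'symm : N'.IsSymm := by
    simpa [Matrix.IsHermitian, Matrix.IsSymm] using hM'pd.inv.isHermitian
  have hMN : M * N = 1 := Matrix.mul_nonsing_inv M ((Matrix.isUnit_iff_isUnit_det M).1 hM.isUnit)
  have hNM : N * M = 1 := Matrix.nonsing_inv_mul M ((Matrix.isUnit_iff_isUnit_det M).1 hM.isUnit)
  have hMN' : M' * N' = 1 :=
    Matrix.mul_nonsing_inv M' ((Matrix.isUnit_iff_isUnit_det M').1 hM'pd.isUnit)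
  have hNM' : N' * M' = 1 :=
    Matrix.nonsing_inv_mul M' ((Matrix.isUnit_iff_isUnit_det M').1 hM'pd.isUnit)
  set v := N *ᵥ y with hv
  clear_value v
  have hN'y : N' *ᵥ y = κ • v := by
    have h1 : M' *ᵥ (κ • v) = y := by
      rw [hM', Matrix.add_mulVec, Matrix.mulVec_smul, Matrix.mulVec_smul, hv,
        Matrix.mulVec_mulVec, hMN, Matrix.one_mulVec, Matrix.vecMulVec_mulVec, ← hv, ← hr]
      ext i
      simp only [Pi.add_apply, Pi.smul_apply, smul_eq_mul, MulOpposite.smul_eq_mul_unop,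
        MulOpposite.unop_op, hκ]
      field_simp
    calc N' *ᵥ y = N' *ᵥ (M' *ᵥ (κ • v)) := by rw [h1]
      _ = κ • v := by rw [Matrix.mulVec_mulVec, hNM', Matrix.one_mulVec]
  have hdiff : N - N' = κ • Matrix.vecMulVec v v := by
    have h1 : N - N' = N * Matrix.vecMulVec y y * N' := by
      have : Matrix.vecMulVec y y = M' - M := by rw [hM', add_sub_cancel_left]
      rw [this, mul_sub, sub_mul, mul_assoc, hMN', hNM, one_mul, mul_one]
    rw [h1, Matrix.mul_vecMulVec, Matrix.vecMulVec_mul, ← Matrix.mulVec_transpose, hN'symm.eq,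
      hN'y, ← hv, Matrix.vecMulVec_smul]
  set B := N - r⁻¹ • Matrix.vecMulVec v v with hB
  have hNB : N = B + r⁻¹ • Matrix.vecMulVec v v := by rw [hB, sub_add_cancel]
  have hN'B : N' = B + (κ * r⁻¹) • Matrix.vecMulVec v v := by
    have h1 : N' = N - κ • Matrix.vecMulVec v v := by rw [← hdiff, sub_sub_cancel]
    have h2 : κ * r⁻¹ = r⁻¹ - κ := by rw [hκ]; field_simp; ring
    rw [h1, hB, h2, sub_smul]
    abel
  have hBpsd : B.PosSemidef := by
    refine Matrix.PosSemidef.of_dotProduct_mulVec_nonneg ?_ fun x => ?_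
    · exact hNpd.isHermitian.sub
        ((posSemidef_vecMulVec v).smul (inv_nonneg.2 hrpos.le)).isHermitian
    · have hcs := sq_dotProduct_mulVec_le hNsymm hNpos x y
      rw [← hv, ← hr] at hcs
      rw [hB, Matrix.sub_mulVec, dotProduct_sub, Matrix.smul_mulVec, dotProduct_smul,
        Matrix.vecMulVec_mulVec, dotProduct_smul]
      simp only [star_trivial, smul_eq_mul, MulOpposite.smul_eq_mul_unop, MulOpposite.unop_op]
      rw [dotProduct_comm v x, sub_nonneg, inv_mul_le_iff₀ hrpos]
      nlinarith
  -- the cone of the vectors that pair nonnegatively with all `B ^ j v`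
  let P : (ι → ℝ) → Prop := fun x => ∀ j, 0 ≤ v ⬝ᵥ (B ^ j) *ᵥ x
  have hPv : P v := fun j => by simpa using (hBpsd.pow j).dotProduct_mulVec_nonneg v
  have hPadd : ∀ {x z}, P x → P z → P (x + z) := fun hx hz j => by
    rw [Matrix.mulVec_add, dotProduct_add]
    exact add_nonneg (hx j) (hz j)
  have hPsmul : ∀ {x} {t : ℝ}, 0 ≤ t → P x → P (t • x) := fun ht hx j => by
    rw [Matrix.mulVec_smul, dotProduct_smul, smul_eq_mul]
    exact mul_nonneg ht (hx j)
  have hPB : ∀ {x}, P x → P (B *ᵥ x) := fun hx j => by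
    rw [Matrix.mulVec_mulVec, ← pow_succ]
    exact hx (j + 1)
  have hP0 : ∀ {x}, P x → 0 ≤ v ⬝ᵥ x := fun hx => by simpa using hx 0
  have hPupd : ∀ {x} {t : ℝ}, 0 ≤ t → P x → P ((B + t • Matrix.vecMulVec v v) *ᵥ x) := by
    intro x t ht hx
    rw [Matrix.add_mulVec, Matrix.smul_mulVec, Matrix.vecMulVec_mulVec]
    refine hPadd (hPB hx) (hPsmul ht ?_)
    have : MulOpposite.op (v ⬝ᵥ x) • v = (v ⬝ᵥ x) • v := by ext i; simp [mul_comm]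
    rw [this]
    exact hPsmul (hP0 hx) hPv
  have hPN : ∀ {x}, P x → P (N *ᵥ x) := fun hx => by
    rw [hNB]
    exact hPupd (inv_nonneg.2 hrpos.le) hx
  have hPN' : ∀ {x}, P x → P (N' *ᵥ x) := fun hx => by
    rw [hN'B]
    exact hPupd (by positivity) hx
  have hPNpow : ∀ (a : ℕ) {x}, P x → P ((N ^ a) *ᵥ x) := by
    intro a
    induction a with
    | zero => intro x hx; simpa using hx
    | succ a ih =>
      intro x hx
      rw [pow_succ', ← Matrix.mulVec_mulVec]
      exact hPN (ih hx)
  have hcmp : ∀ b, P ((N' ^ b) *ᵥ v - κ ^ b • (N ^ b) *ᵥ v) := by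
    intro b
    induction b with
    | zero => simp [P]
    | succ b ih =>
      have hsplit : (N' ^ (b + 1)) *ᵥ v - κ ^ (b + 1) • (N ^ (b + 1)) *ᵥ v =
          N' *ᵥ ((N' ^ b) *ᵥ v - κ ^ b • (N ^ b) *ᵥ v) +
            κ ^ b • ((1 - κ) • (B *ᵥ ((N ^ b) *ᵥ v))) := by
        have h1 : N' - κ • N = (1 - κ) • B := by
          rw [hN'B, hNB, smul_add, smul_smul, sub_smul, one_smul]
          abel
        rw [← Matrix.smul_mulVec (1 - κ) B, ← h1, Matrix.sub_mulVec, Matrix.mulVec_sub,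
          Matrix.mulVec_smul, Matrix.smul_mulVec, smul_sub, Matrix.mulVec_mulVec, ← pow_succ',
          Matrix.mulVec_mulVec v N, ← pow_succ', smul_smul, ← pow_succ]
        abel
      rw [hsplit]
      exact hPadd (hPN' ih) (hPsmul (by positivity) (hPsmul (by linarith) (hPB (hPNpow b hPv))))
  have hterm : ∀ a b, κ ^ b * (v ⬝ᵥ (N ^ (a + b)) *ᵥ v) ≤ v ⬝ᵥ (N ^ a * N' ^ b) *ᵥ v := by
    intro a b
    have := hP0 (hPNpow a (hcmp b))
    rw [Matrix.mulVec_sub, dotProduct_sub, Matrix.mulVec_smul, dotProduct_smul,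
      Matrix.mulVec_mulVec, Matrix.mulVec_mulVec, ← pow_add, smul_eq_mul] at this
    linarith
  have hvv : ∀ c, v ⬝ᵥ (N ^ c) *ᵥ v = y ⬝ᵥ (N ^ (c + 2)) *ᵥ y := by
    intro c
    have : ∀ u : ι → ℝ, v ⬝ᵥ u = y ⬝ᵥ N *ᵥ u := fun u => by
      rw [hv, Matrix.dotProduct_mulVec, ← Matrix.mulVec_transpose, hNsymm.eq]
    rw [this, hv, Matrix.mulVec_mulVec, Matrix.mulVec_mulVec, ← pow_succ', ← pow_succ]
  have hdt : (N ^ q).trace - (N' ^ q).trace =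
      ∑ j ∈ Finset.range q, κ * (v ⬝ᵥ (N ^ j * N' ^ (q - 1 - j)) *ᵥ v) := by
    rw [← Matrix.trace_sub, pow_sub_pow_eq_sum, Matrix.trace_sum]
    refine Finset.sum_congr rfl fun j _ => ?_
    rw [hdiff, mul_smul_comm, smul_mul_assoc, Matrix.trace_smul, trace_mul_vecMulVec_mul,
      smul_eq_mul, Matrix.dotProduct_mulVec, ← Matrix.mulVec_transpose, Matrix.transpose_mul,
      Matrix.transpose_pow, Matrix.transpose_pow, hNsymm.eq, hN'symm.eq, dotProduct_comm]
  have hsum : ∑ _j ∈ Finset.range q, κ ^ q * (y ⬝ᵥ (N ^ (q + 1)) *ᵥ y) ≤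
      ∑ j ∈ Finset.range q, κ * (v ⬝ᵥ (N ^ j * N' ^ (q - 1 - j)) *ᵥ v) := by
    refine Finset.sum_le_sum fun j hj => ?_
    have hjq := Finset.mem_range.1 hj
    have h1 := hterm j (q - 1 - j)
    have h2 : y ⬝ᵥ (N ^ (q + 1)) *ᵥ y = v ⬝ᵥ (N ^ (j + (q - 1 - j))) *ᵥ v := by
      rw [hvv]
      congr 3
      lia
    have h3 : 0 ≤ v ⬝ᵥ (N ^ (j + (q - 1 - j))) *ᵥ v := hP0 (hPNpow _ hPv)
    rw [h2]
    have h4 : κ ^ q ≤ κ * κ ^ (q - 1 - j) := by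
      rw [← pow_succ']
      exact pow_le_pow_of_le_one hκ0.le hκ1 (by lia)
    calc κ ^ q * (v ⬝ᵥ (N ^ (j + (q - 1 - j))) *ᵥ v)
        ≤ κ * κ ^ (q - 1 - j) * (v ⬝ᵥ (N ^ (j + (q - 1 - j))) *ᵥ v) :=
          mul_le_mul_of_nonneg_right h4 h3
      _ ≤ _ := by rw [mul_assoc]; exact mul_le_mul_of_nonneg_left h1 hκ0.le
  rw [Finset.sum_const, Finset.card_range, nsmul_eq_mul, ← mul_assoc] at hsum
  linarith

end RankOne

/-! ### Extreme eigenvalues of sums of independent rank-one matrices -/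

section Chernoff

variable {ι : Type*} {ρ : Measure (ι → ℝ)} {Λ : ι → ℝ}

/-- The sum of the rank-one matrices of a sample. -/
def gramSum {n : ℕ} (Y : Fin n → ι → ℝ) : Matrix ι ι ℝ := ∑ i, Matrix.vecMulVec (Y i) (Y i)

theorem gramSum_posSemidef [Fintype ι] {n : ℕ} (Y : Fin n → ι → ℝ) : (gramSum Y).PosSemidef :=
  Matrix.posSemidef_sum _ fun i _ => posSemidef_vecMulVec (Y i)

theorem continuous_gramSum {n : ℕ} : Continuous fun Y : Fin n → ι → ℝ => gramSum Y :=
  continuous_finsetSum _ fun i _ => (continuous_apply i).matrix_vecMulVec (continuous_apply i)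

theorem dotProduct_gramSum [Fintype ι] {n : ℕ} (Y : Fin n → ι → ℝ) (x : ι → ℝ) :
    x ⬝ᵥ gramSum Y *ᵥ x = ∑ i, (∑ l, Y i l * x l) ^ 2 := by
  simp only [gramSum, Matrix.sum_mulVec, dotProduct_sum, Matrix.vecMulVec_mulVec]
  refine Finset.sum_congr rfl fun i _ => ?_
  rw [dotProduct_smul, dotProduct_comm x]
  simp [dotProduct, sq]

theorem posDef_smul_one_add [DecidableEq ι] {δ : ℝ} (hδ : 0 < δ) {W : Matrix ι ι ℝ}
    (hW : W.PosSemidef) :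
    (δ • (1 : Matrix ι ι ℝ) + W).PosDef :=
  (Matrix.PosDef.one.smul hδ).add_posSemidef hW

theorem integrable_form [Fintype ι] (hmem : ∀ i, MemLp (fun y : ι → ℝ => y i) 2 ρ)
    (A : Matrix ι ι ℝ) :
    Integrable (fun y : ι → ℝ => y ⬝ᵥ A *ᵥ y) ρ := by
  have : (fun y : ι → ℝ => y ⬝ᵥ A *ᵥ y) = fun y => ∑ i, ∑ j, A i j * (y i * y j) := by
    ext y
    simp only [dotProduct, Matrix.mulVec, Finset.mul_sum]
    exact Finset.sum_congr rfl fun i _ => Finset.sum_congr rfl fun j _ => by ring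
  rw [this]
  exact integrable_finsetSum _ fun i _ => integrable_finsetSum _ fun j _ =>
    ((hmem i).integrable_mul (hmem j)).const_mul _

variable [Fintype ι]

/-- Conditioning on all but the first of the independent vectors. -/
theorem lintegral_gramSum_succ_le [IsProbabilityMeasure ρ] {F G : Matrix ι ι ℝ → ℝ≥0∞} (n : ℕ)
    (hF : Measurable fun Y : Fin (n + 1) → ι → ℝ => F (gramSum Y))
    (h : ∀ W : Matrix ι ι ℝ, W.PosSemidef →
      ∫⁻ y, F (W + Matrix.vecMulVec y y) ∂ρ ≤ G W) :
    ∫⁻ Y, F (gramSum Y) ∂(Measure.pi fun _ : Fin (n + 1) => ρ) ≤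
      ∫⁻ Y, G (gramSum Y) ∂(Measure.pi fun _ : Fin n => ρ) := by
  have hmp := measurePreserving_piFinSuccAbove (fun _ : Fin (n + 1) => ρ) 0
  set e := MeasurableEquiv.piFinSuccAbove (fun _ : Fin (n + 1) => ι → ℝ) 0
  have hsplit : ∀ Y : Fin (n + 1) → ι → ℝ, F (gramSum Y) =
      F (gramSum (e Y).2 + Matrix.vecMulVec (e Y).1 (e Y).1) := by
    intro Y
    congr 1
    rw [gramSum, Fin.sum_univ_succ, add_comm]
    rfl
  have hmeas : Measurable fun z : (ι → ℝ) × (Fin n → ι → ℝ) =>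
      F (gramSum z.2 + Matrix.vecMulVec z.1 z.1) := by
    have h1 : (fun z : (ι → ℝ) × (Fin n → ι → ℝ) =>
        F (gramSum z.2 + Matrix.vecMulVec z.1 z.1)) = fun z => F (gramSum (e.symm z)) := by
      ext z
      rw [hsplit, MeasurableEquiv.apply_symm_apply]
    rw [h1]
    exact hF.comp e.symm.measurable
  calc ∫⁻ Y, F (gramSum Y) ∂(Measure.pi fun _ : Fin (n + 1) => ρ)
      = ∫⁻ z, F (gramSum z.2 + Matrix.vecMulVec z.1 z.1)
          ∂(ρ.prod (Measure.pi fun _ : Fin n => ρ)) := by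
        rw [← hmp.lintegral_comp hmeas]
        exact lintegral_congr hsplit
    _ = ∫⁻ Y, ∫⁻ y, F (gramSum Y + Matrix.vecMulVec y y) ∂ρ ∂(Measure.pi fun _ : Fin n => ρ) :=
        lintegral_prod_symm _ hmeas.aemeasurable
    _ ≤ _ := lintegral_mono fun Y => h _ (gramSum_posSemidef Y)

variable [DecidableEq ι]

theorem form_single (A : Matrix ι ι ℝ) (i : ι) :
    (Pi.single i 1 : ι → ℝ) ⬝ᵥ A *ᵥ Pi.single i 1 = A i i := by simp

theorem diag_nonneg {A : Matrix ι ι ℝ} (hA : A.PosSemidef) (i : ι) : 0 ≤ A i i := by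
  have := hA.dotProduct_mulVec_nonneg (Pi.single i 1)
  simpa using this

theorem integral_form (hmem : ∀ i, MemLp (fun y : ι → ℝ => y i) 2 ρ)
    (hΛ : ∀ i j, ∫ y, y i * y j ∂ρ = if i = j then Λ i else 0) (A : Matrix ι ι ℝ) :
    ∫ y, y ⬝ᵥ A *ᵥ y ∂ρ = ∑ i, Λ i * A i i := by
  have hint : ∀ i j, Integrable (fun y : ι → ℝ => A i j * (y i * y j)) ρ := fun i j =>
    ((hmem i).integrable_mul (hmem j)).const_mul _
  have : (fun y : ι → ℝ => y ⬝ᵥ A *ᵥ y) = fun y => ∑ i, ∑ j, A i j * (y i * y j) := by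
    ext y
    simp only [dotProduct, Matrix.mulVec, Finset.mul_sum]
    exact Finset.sum_congr rfl fun i _ => Finset.sum_congr rfl fun j _ => by ring
  rw [this, integral_finsetSum _ fun i _ => integrable_finsetSum _ fun j _ => hint i j]
  refine Finset.sum_congr rfl fun i _ => ?_
  rw [integral_finsetSum _ fun j _ => hint i j]
  simp_rw [integral_const_mul, hΛ]
  simp [mul_comm]

theorem lintegral_trace_pow_le [IsProbabilityMeasure ρ]
    (hmem : ∀ i, MemLp (fun y : ι → ℝ => y i) 2 ρ)
    (hΛ : ∀ i j, ∫ y, y i * y j ∂ρ = if i = j then Λ i else 0) {L R : ℝ} (hL0 : 0 ≤ L)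
    (hL : ∀ i, Λ i ≤ L) (hR0 : 0 ≤ R) (hR : ∀ᵐ y ∂ρ, y ⬝ᵥ y ≤ R) {q : ℕ} (hq : 1 ≤ q) (n : ℕ) :
    ∫⁻ Y, ENNReal.ofReal (((1 + gramSum Y) ^ q).trace) ∂(Measure.pi fun _ : Fin n => ρ) ≤
      ENNReal.ofReal (Fintype.card ι * (1 + q * (1 + R) ^ q * L) ^ n) := by
  have hb : 0 ≤ q * (1 + R) ^ q * L := by positivity
  induction n with
  | zero => simp [gramSum, Matrix.trace_one]
  | succ n ih =>
    have hstep : ∀ W : Matrix ι ι ℝ, W.PosSemidef →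
        ∫⁻ y, ENNReal.ofReal (((1 + (W + Matrix.vecMulVec y y)) ^ q).trace) ∂ρ ≤
          ENNReal.ofReal (1 + q * (1 + R) ^ q * L) * ENNReal.ofReal (((1 + W) ^ q).trace) := by
      intro W hW
      have hM : (1 + W).PosSemidef := Matrix.PosSemidef.one.add hW
      set A := (1 + W) ^ (q - 1) with hA
      have hApsd : A.PosSemidef := hM.pow _
      have htr0 : 0 ≤ ((1 + W) ^ q).trace := (hM.pow q).trace_nonneg
      have htrA : A.trace ≤ ((1 + W) ^ q).trace := by
        refine Finset.sum_le_sum fun i _ => ?_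
        have := form_pow_le_form_pow_succ hW (Pi.single i 1) (q - 1)
        rwa [Nat.sub_add_cancel hq, form_single, form_single] at this
      calc ∫⁻ y, ENNReal.ofReal (((1 + (W + Matrix.vecMulVec y y)) ^ q).trace) ∂ρ
          ≤ ∫⁻ y, ENNReal.ofReal (((1 + W) ^ q).trace + q * (1 + R) ^ q * (y ⬝ᵥ A *ᵥ y)) ∂ρ := by
            refine lintegral_mono_ae ?_
            filter_upwards [hR] with y hy
            refine ENNReal.ofReal_le_ofReal ?_
            rw [← add_assoc]
            exact trace_pow_update_le hW hy q
        _ = ENNReal.ofReal (((1 + W) ^ q).trace + q * (1 + R) ^ q * ∑ i, Λ i * A i i) := by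
            rw [← ofReal_integral_eq_lintegral_ofReal]
            · rw [integral_add (integrable_const _) ((integrable_form hmem A).const_mul _),
                integral_const_mul, integral_form hmem hΛ]
              simp
            · exact (integrable_const _).add ((integrable_form hmem A).const_mul _)
            · refine Eventually.of_forall fun y => ?_
              have : 0 ≤ y ⬝ᵥ A *ᵥ y := by simpa using hApsd.dotProduct_mulVec_nonneg y
              simp only [Pi.zero_apply]
              positivity
        _ ≤ ENNReal.ofReal ((1 + q * (1 + R) ^ q * L) * ((1 + W) ^ q).trace) := by
            refine ENNReal.ofReal_le_ofReal ?_
            have h1 : ∑ i, Λ i * A i i ≤ L * A.trace := by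
              rw [Matrix.trace, Finset.mul_sum]
              exact Finset.sum_le_sum fun i _ =>
                mul_le_mul_of_nonneg_right (hL i) (diag_nonneg hApsd i)
            have h2 : q * (1 + R) ^ q * (∑ i, Λ i * A i i) ≤
                q * (1 + R) ^ q * (L * ((1 + W) ^ q).trace) :=
              mul_le_mul_of_nonneg_left (h1.trans (mul_le_mul_of_nonneg_left htrA hL0))
                (by positivity)
            linarith
        _ = _ := ENNReal.ofReal_mul (by positivity)
    have hcont : Continuous fun Y : Fin (n + 1) → ι → ℝ => ((1 + gramSum Y) ^ q).trace :=
      ((continuous_const.add continuous_gramSum).pow q).matrix_trace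
    refine (lintegral_gramSum_succ_le
      (F := fun W : Matrix ι ι ℝ => ENNReal.ofReal (((1 + W) ^ q).trace)) n
      (ENNReal.measurable_ofReal.comp hcont.measurable) hstep).trans ?_
    have hmeas : Measurable fun Y : Fin n → ι → ℝ =>
        ENNReal.ofReal (((1 + gramSum Y) ^ q).trace) :=
      ENNReal.measurable_ofReal.comp
        ((continuous_const.add continuous_gramSum).pow q).matrix_trace.measurable
    rw [lintegral_const_mul _ hmeas]
    refine (mul_le_mul_right ih _).trans ?_
    rw [← ENNReal.ofReal_mul (by positivity)]
    refine ENNReal.ofReal_le_ofReal (le_of_eq ?_)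
    ring

/-- Upper matrix Chernoff bound at constant level. -/
theorem measure_gramSum_gt_le [IsProbabilityMeasure ρ]
    (hmem : ∀ i, MemLp (fun y : ι → ℝ => y i) 2 ρ)
    (hΛ : ∀ i j, ∫ y, y i * y j ∂ρ = if i = j then Λ i else 0) {L R : ℝ} (hL0 : 0 ≤ L)
    (hL : ∀ i, Λ i ≤ L) (hR0 : 0 ≤ R) (hR : ∀ᵐ y ∂ρ, y ⬝ᵥ y ≤ R) {q : ℕ} (hq : 1 ≤ q) {n : ℕ}
    (hqR : q * R ≤ 1) (hnL : n * L ≤ 1) :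
    (Measure.pi fun _ : Fin n => ρ)
        {Y | ∃ x : ι → ℝ, Real.exp 4 * (x ⬝ᵥ x) < x ⬝ᵥ gramSum Y *ᵥ x} ≤
      ENNReal.ofReal (Fintype.card ι * Real.exp (-q)) := by
  have hsub : {Y : Fin n → ι → ℝ | ∃ x : ι → ℝ, Real.exp 4 * (x ⬝ᵥ x) < x ⬝ᵥ gramSum Y *ᵥ x} ⊆
      {Y | ENNReal.ofReal (Real.exp 4 ^ q) ≤ ENNReal.ofReal (((1 + gramSum Y) ^ q).trace)} := by
    rintro Y ⟨x, hx⟩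
    refine ENNReal.ofReal_le_ofReal ?_
    by_contra hc
    have := form_le_of_trace_pow_le (Matrix.PosSemidef.one.add (gramSum_posSemidef Y))
      (by lia) (Real.exp_pos 4).le (not_le.1 hc).le x
    rw [Matrix.add_mulVec, dotProduct_add, Matrix.one_mulVec] at this
    have h0 : 0 ≤ x ⬝ᵥ x := Finset.sum_nonneg fun i _ => mul_self_nonneg (x i)
    linarith
  have hcont : Continuous fun Y : Fin n → ι → ℝ => ((1 + gramSum Y) ^ q).trace :=
    ((continuous_const.add continuous_gramSum).pow q).matrix_trace
  refine (measure_mono hsub).trans ((meas_ge_le_lintegral_div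
    (ENNReal.measurable_ofReal.comp hcont.measurable).aemeasurable
    (by simp [Real.exp_pos]) ENNReal.ofReal_ne_top).trans ?_)
  have h1 : (1 + R) ^ q ≤ Real.exp 1 := by
    calc (1 + R) ^ q ≤ Real.exp R ^ q :=
          pow_le_pow_left₀ (by positivity) (by linarith [Real.add_one_le_exp R]) q
      _ = Real.exp (q * R) := by rw [← Real.exp_nat_mul]
      _ ≤ Real.exp 1 := Real.exp_le_exp.2 hqR
  have h2 : (1 + q * (1 + R) ^ q * L) ^ n ≤ Real.exp (3 * q) := by
    have h3 : q * (1 + R) ^ q * L ≤ q * 3 * L := by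
      have := Real.exp_one_lt_three
      gcongr
      linarith
    calc (1 + q * (1 + R) ^ q * L) ^ n ≤ Real.exp (q * 3 * L) ^ n :=
          pow_le_pow_left₀ (by positivity) (by linarith [Real.add_one_le_exp (q * 3 * L)]) n
      _ = Real.exp (3 * q * (n * L)) := by rw [← Real.exp_nat_mul]; congr 1; ring
      _ ≤ Real.exp (3 * q) := by
          refine Real.exp_le_exp.2 ?_
          have : (0 : ℝ) ≤ 3 * q := by positivity
          nlinarith
  refine (ENNReal.div_le_div_right (lintegral_trace_pow_le hmem hΛ hL0 hL hR0 hR hq n) _).trans ?_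
  rw [← ENNReal.ofReal_div_of_pos (by positivity)]
  refine ENNReal.ofReal_le_ofReal ?_
  rw [← Real.exp_nat_mul, div_le_iff₀ (Real.exp_pos _),
    mul_assoc _ (Real.exp (-q)), ← Real.exp_add]
  refine mul_le_mul_of_nonneg_left (h2.trans (Real.exp_le_exp.2 (le_of_eq ?_))) (Nat.cast_nonneg _)
  ring

theorem continuous_trace_inv_pow {δ : ℝ} (hδ : 0 < δ) (q n : ℕ) :
    Continuous fun Y : Fin n → ι → ℝ => (((δ • (1 : Matrix ι ι ℝ) + gramSum Y)⁻¹) ^ q).trace := by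
  have h1 : Continuous fun Y : Fin n → ι → ℝ => δ • (1 : Matrix ι ι ℝ) + gramSum Y :=
    continuous_const.add continuous_gramSum
  have h2 : Continuous fun Y : Fin n → ι → ℝ => (δ • (1 : Matrix ι ι ℝ) + gramSum Y)⁻¹ := by
    simp only [Matrix.inv_def, Ring.inverse_eq_inv']
    exact (h1.matrix_det.inv₀ fun Y =>
      (posDef_smul_one_add hδ (gramSum_posSemidef Y)).det_pos.ne').smul h1.matrix_adjugate
  exact (h2.pow q).matrix_trace

theorem form_inv_le {δ : ℝ} (hδ : 0 < δ) {W : Matrix ι ι ℝ} (hW : W.PosSemidef) (y : ι → ℝ) :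
    y ⬝ᵥ (δ • (1 : Matrix ι ι ℝ) + W)⁻¹ *ᵥ y ≤ (y ⬝ᵥ y) / δ := by
  set M := δ • (1 : Matrix ι ι ℝ) + W with hM
  have hMpd := posDef_smul_one_add hδ hW
  rw [← hM] at hMpd
  have hMN : M * M⁻¹ = 1 :=
    Matrix.mul_nonsing_inv M ((Matrix.isUnit_iff_isUnit_det M).1 hMpd.isUnit)
  set u := M⁻¹ *ᵥ y with hu
  have hMu : M *ᵥ u = y := by rw [hu, Matrix.mulVec_mulVec, hMN, Matrix.one_mulVec]
  have h1 : δ * (u ⬝ᵥ u) ≤ y ⬝ᵥ u := by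
    have h2 : u ⬝ᵥ M *ᵥ u = δ * (u ⬝ᵥ u) + u ⬝ᵥ W *ᵥ u := by
      rw [hM, Matrix.add_mulVec, dotProduct_add, Matrix.smul_mulVec, Matrix.one_mulVec,
        dotProduct_smul, smul_eq_mul]
    have h3 : 0 ≤ u ⬝ᵥ W *ᵥ u := by simpa using hW.dotProduct_mulVec_nonneg u
    rw [hMu, dotProduct_comm] at h2
    linarith
  have h4 : (y ⬝ᵥ u) ^ 2 ≤ (y ⬝ᵥ y) * (u ⬝ᵥ u) := by
    have := Finset.sum_mul_sq_le_sq_mul_sq Finset.univ y u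
    simpa [dotProduct, sq] using this
  have hyy : 0 ≤ y ⬝ᵥ y := Finset.sum_nonneg fun i _ => mul_self_nonneg (y i)
  have huu : 0 ≤ u ⬝ᵥ u := Finset.sum_nonneg fun i _ => mul_self_nonneg (u i)
  have hyu : 0 ≤ y ⬝ᵥ u := le_trans (by positivity) h1
  rw [le_div_iff₀ hδ]
  rcases hyu.eq_or_lt with h0 | h0
  · rw [← h0, zero_mul]
    exact hyy
  · have h5 : (y ⬝ᵥ u) * ((y ⬝ᵥ u) * δ) ≤ (y ⬝ᵥ u) * (y ⬝ᵥ y) := by nlinarith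
    exact le_of_mul_le_mul_left h5 h0

theorem lintegral_trace_inv_pow_le [IsProbabilityMeasure ρ]
    (hmem : ∀ i, MemLp (fun y : ι → ℝ => y i) 2 ρ)
    (hone : ∀ i j, ∫ y, y i * y j ∂ρ = if i = j then 1 else 0) {R δ θ : ℝ}
    (hR : ∀ᵐ y ∂ρ, y ⬝ᵥ y ≤ R) (hδ : 0 < δ) (hθ : 0 ≤ θ) {q : ℕ} (hqR : q * R ≤ δ)
    (hqθ : q * Real.exp (-1) * θ ≤ 1) (n : ℕ) :
    ∫⁻ Y, ENNReal.ofReal ((((δ • (1 : Matrix ι ι ℝ) + gramSum Y)⁻¹) ^ q).trace)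
        ∂(Measure.pi fun _ : Fin n => ρ) ≤
      ENNReal.ofReal (Fintype.card ι *
        ((1 - q * Real.exp (-1) * θ) ^ n * δ⁻¹ ^ q + θ ^ q)) := by
  set ζ := q * Real.exp (-1) * θ with hζ
  have hζ0 : 0 ≤ ζ := by positivity
  induction n with
  | zero =>
    have h1 : (δ • (1 : Matrix ι ι ℝ) + gramSum (Fin.elim0 : Fin 0 → ι → ℝ))⁻¹ =
        δ⁻¹ • (1 : Matrix ι ι ℝ) := by
      simp only [gramSum, Finset.univ_eq_empty, Finset.sum_empty, add_zero]
      refine Matrix.inv_eq_right_inv ?_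
      rw [smul_mul_smul_comm, mul_one, mul_inv_cancel₀ hδ.ne', one_smul]
    have h2 : ∀ Y : Fin 0 → ι → ℝ,
        (((δ • (1 : Matrix ι ι ℝ) + gramSum Y)⁻¹) ^ q).trace = Fintype.card ι * δ⁻¹ ^ q := by
      intro Y
      rw [Subsingleton.elim Y Fin.elim0, h1, smul_pow, one_pow, Matrix.trace_smul,
        Matrix.trace_one, smul_eq_mul, mul_comm]
    simp_rw [h2]
    rw [lintegral_const, measure_univ, mul_one]
    refine ENNReal.ofReal_le_ofReal (mul_le_mul_of_nonneg_left ?_ (Nat.cast_nonneg _))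
    rw [pow_zero, one_mul]
    exact le_add_of_nonneg_right (by positivity)
  | succ n ih =>
    have hstep : ∀ W : Matrix ι ι ℝ, W.PosSemidef →
        ∫⁻ y, ENNReal.ofReal
          ((((δ • (1 : Matrix ι ι ℝ) + (W + Matrix.vecMulVec y y))⁻¹) ^ q).trace) ∂ρ ≤
        ENNReal.ofReal (1 - ζ) *
          ENNReal.ofReal ((((δ • (1 : Matrix ι ι ℝ) + W)⁻¹) ^ q).trace) +
          ENNReal.ofReal (ζ * (Fintype.card ι * θ ^ q)) := by
      intro W hW
      set M := δ • (1 : Matrix ι ι ℝ) + W with hM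
      have hMpd : M.PosDef := posDef_smul_one_add hδ hW
      set A := M⁻¹ ^ (q + 1) with hA
      have hApsd : A.PosSemidef := hMpd.inv.posSemidef.pow _
      have htr0 : 0 ≤ (M⁻¹ ^ q).trace := (hMpd.inv.posSemidef.pow q).trace_nonneg
      have hpt : ∀ y : ι → ℝ, y ⬝ᵥ y ≤ R →
          (((δ • (1 : Matrix ι ι ℝ) + (W + Matrix.vecMulVec y y))⁻¹) ^ q).trace ≤
          (M⁻¹ ^ q).trace - q * Real.exp (-1) * (y ⬝ᵥ A *ᵥ y) := by
        intro y hy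
        have h1 := trace_inv_pow_update_le hMpd y rfl q
        rw [← hA, hM, add_assoc] at h1
        have hyA : 0 ≤ y ⬝ᵥ A *ᵥ y := by simpa using hApsd.dotProduct_mulVec_nonneg y
        have hr0 : 0 ≤ y ⬝ᵥ M⁻¹ *ᵥ y := by
          simpa using hMpd.inv.posSemidef.dotProduct_mulVec_nonneg y
        have h2 : y ⬝ᵥ M⁻¹ *ᵥ y ≤ R / δ :=
          (form_inv_le hδ hW y).trans (div_le_div_of_nonneg_right hy hδ.le)
        have h3 : Real.exp (-1) ≤ ((1 + y ⬝ᵥ M⁻¹ *ᵥ y)⁻¹) ^ q := by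
          rw [Real.exp_neg, inv_pow]
          refine inv_anti₀ (by positivity) ?_
          calc (1 + y ⬝ᵥ M⁻¹ *ᵥ y) ^ q ≤ Real.exp (R / δ) ^ q :=
                pow_le_pow_left₀ (by positivity)
                  (by linarith [Real.add_one_le_exp (R / δ)]) q
            _ = Real.exp (q * R / δ) := by rw [← Real.exp_nat_mul, mul_div_assoc]
            _ ≤ Real.exp 1 := Real.exp_le_exp.2 ((div_le_one hδ).2 hqR)
        have h4 : q * Real.exp (-1) * (y ⬝ᵥ A *ᵥ y) ≤
            q * ((1 + y ⬝ᵥ M⁻¹ *ᵥ y)⁻¹) ^ q * (y ⬝ᵥ A *ᵥ y) := by gcongr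
        rw [hM] at h4 ⊢
        linarith
      have hint : Integrable
          (fun y : ι → ℝ => (M⁻¹ ^ q).trace - q * Real.exp (-1) * (y ⬝ᵥ A *ᵥ y)) ρ :=
        (integrable_const _).sub ((integrable_form hmem A).const_mul _)
      calc _ ≤ ∫⁻ y, ENNReal.ofReal
              ((M⁻¹ ^ q).trace - q * Real.exp (-1) * (y ⬝ᵥ A *ᵥ y)) ∂ρ := by
            refine lintegral_mono_ae ?_
            filter_upwards [hR] with y hy
            exact ENNReal.ofReal_le_ofReal (hpt y hy)
        _ = ENNReal.ofReal ((M⁻¹ ^ q).trace - q * Real.exp (-1) * A.trace) := by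
            rw [← ofReal_integral_eq_lintegral_ofReal hint]
            · rw [integral_sub (integrable_const _) ((integrable_form hmem A).const_mul _),
                integral_const_mul, integral_form hmem hone]
              simp [Matrix.trace]
            · filter_upwards [hR] with y hy
              refine le_trans ?_ (hpt y hy)
              have : δ • (1 : Matrix ι ι ℝ) + (W + Matrix.vecMulVec y y) =
                  δ • (1 : Matrix ι ι ℝ) + (W + Matrix.vecMulVec y y) := rfl
              exact ((posDef_smul_one_add hδ
                (hW.add (posSemidef_vecMulVec y))).inv.posSemidef.pow q).trace_nonneg
        _ ≤ ENNReal.ofReal ((1 - ζ) * (M⁻¹ ^ q).trace + ζ * (Fintype.card ι * θ ^ q)) := by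
            refine ENNReal.ofReal_le_ofReal ?_
            have h5 := mul_trace_pow_le hMpd.inv.posSemidef q hθ
            rw [← hA] at h5
            have h6 : q * Real.exp (-1) * (θ * (M⁻¹ ^ q).trace) ≤
                q * Real.exp (-1) * (A.trace + Fintype.card ι * θ ^ (q + 1)) :=
              mul_le_mul_of_nonneg_left h5 (by positivity)
            rw [hζ]
            rw [pow_succ] at h6
            nlinarith
        _ = _ := by
            rw [ENNReal.ofReal_add (mul_nonneg (by linarith) htr0) (by positivity),
              ENNReal.ofReal_mul (by linarith)]
    have hm : ∀ m, Measurable fun Y : Fin m → ι → ℝ =>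
        ENNReal.ofReal ((((δ • (1 : Matrix ι ι ℝ) + gramSum Y)⁻¹) ^ q).trace) := fun m =>
      ENNReal.measurable_ofReal.comp (continuous_trace_inv_pow hδ q m).measurable
    refine (lintegral_gramSum_succ_le
      (F := fun W : Matrix ι ι ℝ => ENNReal.ofReal ((((δ • (1 : Matrix ι ι ℝ) + W)⁻¹) ^ q).trace)) n
      (hm (n + 1)) hstep).trans ?_
    rw [lintegral_add_right _ measurable_const, lintegral_const_mul _ (hm n), lintegral_const,
      measure_univ, mul_one]
    refine (add_le_add_left (mul_le_mul_right ih _) _).trans ?_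
    have hζ1 : 0 ≤ 1 - ζ := by linarith
    rw [← ENNReal.ofReal_mul hζ1, ← ENNReal.ofReal_add (by positivity) (by positivity)]
    refine ENNReal.ofReal_le_ofReal (le_of_eq ?_)
    ring

/-- Lower matrix Chernoff bound for isotropic vectors. The resolvent is taken at the level
`δ = n / (4 e²)`, where `(2 δ) ^ q` times the bound for the mean of the trace of its `q`-th power,
with `θ = 2 e / n`, is `card ι ((2 / e²) ^ q + e ^ (-q))`. -/
theorem measure_gramSum_lt_le [IsProbabilityMeasure ρ]
    (hmem : ∀ i, MemLp (fun y : ι → ℝ => y i) 2 ρ)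
    (hone : ∀ i j, ∫ y, y i * y j ∂ρ = if i = j then 1 else 0) {R : ℝ}
    (hR : ∀ᵐ y ∂ρ, y ⬝ᵥ y ≤ R) {q n : ℕ} (hq : 1 ≤ q) (hqn : 2 * q ≤ n)
    (hqR : q * R ≤ n / (4 * Real.exp 2)) :
    (Measure.pi fun _ : Fin n => ρ)
        {Y | ∃ x : ι → ℝ, x ⬝ᵥ gramSum Y *ᵥ x < n / (4 * Real.exp 2) * (x ⬝ᵥ x)} ≤
      ENNReal.ofReal (2 * Fintype.card ι * Real.exp (-q)) := by
  have hn : (0 : ℝ) < n := by exact_mod_cast (by lia : 0 < n)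
  set δ : ℝ := n / (4 * Real.exp 2) with hδdef
  have hδ : 0 < δ := by positivity
  set θ : ℝ := 2 * Real.exp 1 / n with hθdef
  have hθ : 0 ≤ θ := by positivity
  have hee : Real.exp (-1) * Real.exp 1 = 1 := by rw [← Real.exp_add]; simp
  have hζ : q * Real.exp (-1) * θ = 2 * q / n := by
    rw [hθdef]
    calc q * Real.exp (-1) * (2 * Real.exp 1 / n) = 2 * q / n * (Real.exp (-1) * Real.exp 1) := by
          ring
      _ = _ := by rw [hee, mul_one]
  have hζ1 : q * Real.exp (-1) * θ ≤ 1 := by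
    rw [hζ, div_le_one hn]
    exact_mod_cast hqn
  have hsub : {Y : Fin n → ι → ℝ | ∃ x : ι → ℝ, x ⬝ᵥ gramSum Y *ᵥ x < δ * (x ⬝ᵥ x)} ⊆
      {Y | ENNReal.ofReal ((2 * δ)⁻¹ ^ q) ≤
        ENNReal.ofReal ((((δ • (1 : Matrix ι ι ℝ) + gramSum Y)⁻¹) ^ q).trace)} := by
    rintro Y ⟨x, hx⟩
    refine ENNReal.ofReal_le_ofReal ?_
    by_contra hc
    set M := δ • (1 : Matrix ι ι ℝ) + gramSum Y with hM
    have hMpd : M.PosDef := posDef_smul_one_add hδ (gramSum_posSemidef Y)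
    have hMN : M⁻¹ * M = 1 :=
      Matrix.nonsing_inv_mul M ((Matrix.isUnit_iff_isUnit_det M).1 hMpd.isUnit)
    have hNsymm : M⁻¹.IsSymm := by
      simpa [Matrix.IsHermitian, Matrix.IsSymm] using hMpd.inv.isHermitian
    have hNle := form_le_of_trace_pow_le hMpd.inv.posSemidef (by lia) (by positivity)
      (not_le.1 hc).le
    have hcs := sq_dotProduct_mulVec_le hNsymm
      (fun z => by simpa using hMpd.inv.posSemidef.dotProduct_mulVec_nonneg z) x (M *ᵥ x)
    rw [Matrix.mulVec_mulVec, hMN, Matrix.one_mulVec] at hcs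
    have h0 : 0 ≤ x ⬝ᵥ x := Finset.sum_nonneg fun i _ => mul_self_nonneg (x i)
    have hMx : x ⬝ᵥ M *ᵥ x = δ * (x ⬝ᵥ x) + x ⬝ᵥ gramSum Y *ᵥ x := by
      rw [hM, Matrix.add_mulVec, dotProduct_add, Matrix.smul_mulVec, Matrix.one_mulVec,
        dotProduct_smul, smul_eq_mul]
    have hG : 0 ≤ x ⬝ᵥ gramSum Y *ᵥ x := by
      simpa using (gramSum_posSemidef Y).dotProduct_mulVec_nonneg x
    have hlt : x ⬝ᵥ M *ᵥ x < 2 * δ * (x ⬝ᵥ x) := by rw [hMx]; linarith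
    have hM0 : 0 ≤ x ⬝ᵥ M *ᵥ x := by rw [hMx]; positivity
    have hx0 : 0 < x ⬝ᵥ x := by
      rcases h0.eq_or_lt with h | h
      · rw [← h, mul_zero] at hx; linarith
      · exact h
    rw [dotProduct_comm (M *ᵥ x) x] at hcs
    have h1 := hcs.trans (mul_le_mul_of_nonneg_right (hNle x) hM0)
    have h2 : (2 * δ)⁻¹ * (x ⬝ᵥ x) * (x ⬝ᵥ M *ᵥ x) < (x ⬝ᵥ x) ^ 2 := by
      rw [mul_assoc, inv_mul_lt_iff₀ (by positivity)]
      nlinarith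
    linarith
  refine (measure_mono hsub).trans ((meas_ge_le_lintegral_div
    (ENNReal.measurable_ofReal.comp (continuous_trace_inv_pow hδ q n).measurable).aemeasurable
    (ENNReal.ofReal_pos.2 (by positivity)).ne' ENNReal.ofReal_ne_top).trans ?_)
  refine (ENNReal.div_le_div_right
    (lintegral_trace_inv_pow_le hmem hone hR hδ hθ hqR hζ1 n) _).trans ?_
  rw [← ENNReal.ofReal_div_of_pos (by positivity)]
  refine ENNReal.ofReal_le_ofReal ?_
  rw [div_le_iff₀ (by positivity)]
  suffices h : (1 - q * Real.exp (-1) * θ) ^ n * δ⁻¹ ^ q + θ ^ q ≤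
      2 * (Real.exp (-q) * (2 * δ)⁻¹ ^ q) by
    refine (mul_le_mul_of_nonneg_left h (Fintype.card ι).cast_nonneg).trans (le_of_eq ?_)
    ring
  have h1 : (1 - q * Real.exp (-1) * θ) ^ n ≤ Real.exp (-2) ^ q := by
    rw [hζ]
    have hle : (1 - 2 * q / n : ℝ) ≤ Real.exp (-(2 * q / n)) := by
      have := Real.add_one_le_exp (-(2 * (q : ℝ) / n))
      linarith
    calc (1 - 2 * q / n : ℝ) ^ n ≤ Real.exp (-(2 * q / n)) ^ n := by
          refine pow_le_pow_left₀ ?_ hle n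
          rw [hζ] at hζ1
          linarith
      _ = Real.exp (-2) ^ q := by
          rw [← Real.exp_nat_mul, ← Real.exp_nat_mul]
          congr 1
          field_simp
  have h2 : Real.exp (-(q : ℝ)) = Real.exp (-1) ^ q := by
    rw [← Real.exp_nat_mul]; congr 1; ring
  have hpos : 0 < (2 * δ)⁻¹ ^ q := by positivity
  have h3 : δ⁻¹ = 2 * (2 * δ)⁻¹ := by field_simp
  have h4 : θ = Real.exp (-1) * (2 * δ)⁻¹ := by
    rw [hθdef, hδdef]
    have : Real.exp 2 = Real.exp 1 * Real.exp 1 := by rw [← Real.exp_add]; norm_num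
    rw [this]
    have hx := Real.exp_pos 1
    have hx' : Real.exp (-1) = (Real.exp 1)⁻¹ := Real.exp_neg 1
    rw [hx']
    field_simp
    norm_num
  have h5 : Real.exp (-2) * 2 ≤ Real.exp (-1) := by
    have h6 : Real.exp (-2) = Real.exp (-1) * Real.exp (-1) := by rw [← Real.exp_add]; norm_num
    have h7 : Real.exp (-1) ≤ 1 / 2 := by
      rw [Real.exp_neg, one_div]
      exact inv_anti₀ (by norm_num) (by linarith [Real.add_one_le_exp (1 : ℝ)])
    nlinarith [Real.exp_pos (-1)]
  have h6 : Real.exp (-2) ^ q * 2 ^ q ≤ Real.exp (-1) ^ q := by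
    rw [← mul_pow]
    exact pow_le_pow_left₀ (by positivity) h5 q
  calc (1 - q * Real.exp (-1) * θ) ^ n * δ⁻¹ ^ q + θ ^ q
      ≤ Real.exp (-2) ^ q * δ⁻¹ ^ q + θ ^ q := by gcongr
    _ = (Real.exp (-2) ^ q * 2 ^ q + Real.exp (-1) ^ q) * (2 * δ)⁻¹ ^ q := by
        rw [h3, h4, mul_pow, mul_pow]; ring
    _ ≤ (Real.exp (-1) ^ q + Real.exp (-1) ^ q) * (2 * δ)⁻¹ ^ q := by gcongr
    _ = 2 * (Real.exp (-q) * (2 * δ)⁻¹ ^ q) := by rw [h2]; ring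

end Chernoff

/-! ### Generic features: the bound at fixed parameters -/

theorem sum_sq_transpose_le {α β : Type*} [Fintype α] [Fintype β] {Z : α → β → ℝ} {c : ℝ}
    (hc : 0 ≤ c) (h : ∀ v : β → ℝ, ∑ i, (∑ l, Z i l * v l) ^ 2 ≤ c * ∑ l, v l ^ 2) (w : α → ℝ) :
    ∑ l, (∑ i, Z i l * w i) ^ 2 ≤ c * ∑ i, w i ^ 2 := by
  set v : β → ℝ := fun l => ∑ i, Z i l * w i with hv
  have h1 : ∑ l, v l ^ 2 = ∑ i, (∑ l, Z i l * v l) * w i := by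
    simp only [sq, Finset.sum_mul]
    rw [Finset.sum_comm]
    refine Finset.sum_congr rfl fun l _ => ?_
    nth_rw 1 [hv]
    rw [Finset.sum_mul]
    exact Finset.sum_congr rfl fun i _ => by ring
  have h2 := Finset.sum_mul_sq_le_sq_mul_sq Finset.univ (fun i => ∑ l, Z i l * v l) w
  rw [← h1] at h2
  have hw : 0 ≤ ∑ i, w i ^ 2 := Finset.sum_nonneg fun i _ => sq_nonneg _
  have hv0 : 0 ≤ ∑ l, v l ^ 2 := Finset.sum_nonneg fun i _ => sq_nonneg _
  have h3 := h2.trans (mul_le_mul_of_nonneg_right (h v) hw)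
  rcases hv0.eq_or_lt with h0 | h0
  · rw [← h0]
    positivity
  · have : (∑ l, v l ^ 2) * ∑ l, v l ^ 2 ≤ (∑ l, v l ^ 2) * (c * ∑ i, w i ^ 2) := by nlinarith
    exact le_of_mul_le_mul_left this h0

theorem measure_pi_preimage_le {E F : Type*} [MeasurableSpace E] [MeasurableSpace F]
    {μ : Measure E} [IsProbabilityMeasure μ] {f : E → F} (hf : Measurable f) (n : ℕ)
    (s : Set (Fin n → F)) :
    (Measure.pi fun _ : Fin n => μ) {X | (fun i => f (X i)) ∈ s} ≤
      (Measure.pi fun _ : Fin n => μ.map f) s := by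
  have : IsProbabilityMeasure (μ.map f) := Measure.isProbabilityMeasure_map hf.aemeasurable
  rw [← Measure.pi_map_pi fun _ => hf.aemeasurable]
  exact Measure.le_map_apply (measurable_pi_lambda _ fun i =>
    hf.comp (measurable_pi_apply i)).aemeasurable s

section GenericBound

variable {p : ℕ∞} {eig : Idx p → ℝ} {μ : Measure (Idx p → ℝ)} {n : ℕ}

theorem tailForm_le_tailNormSq {X : Fin n → Idx p → ℝ} (hX : ∀ i, Summable fun l => X i l ^ 2)
    (D : ℕ) (w : Fin n → ℝ) :
    tailForm D X w ≤ (∑ i, tailNormSq D (X i)) * ∑ i, w i ^ 2 := by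
  have hs : ∀ i, Summable fun l : Idx p => if D ≤ l.1 then X i l ^ 2 else 0 := fun i =>
    Summable.ite_tail (hX i) D
  simp only [tailNormSq]
  rw [← Summable.tsum_finsetSum fun i _ => hs i, ← tsum_mul_right]
  refine (summable_tailForm hX D w).tsum_le_tsum (fun l => ?_)
    ((summable_sum fun i _ => hs i).mul_right _)
  split_ifs
  · exact Finset.sum_mul_sq_le_sq_mul_sq _ _ _
  · simp

theorem tailForm_eq_sum_add {X : Fin n → Idx p → ℝ} (hX : ∀ i, Summable fun l => X i l ^ 2)
    {k D : ℕ} (hkD : k ≤ D) (w : Fin n → ℝ) :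
    tailForm k X w = ∑ l ∈ (headSet p D).filter (fun l => k ≤ l.1), colDot X w l ^ 2 +
      tailForm D X w := by
  have h1 : ∑ l ∈ (headSet p D).filter (fun l => k ≤ l.1), colDot X w l ^ 2 =
      ∑' l : Idx p, if k ≤ l.1 ∧ l.1 < D then colDot X w l ^ 2 else 0 := by
    rw [tsum_eq_sum (s := (headSet p D).filter (fun l => k ≤ l.1)) fun l hl => if_neg ?_]
    · exact Finset.sum_congr rfl fun l hl => by
        rw [Finset.mem_filter, mem_headSet] at hl
        rw [if_pos ⟨hl.2, hl.1⟩]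
    · rw [Finset.mem_filter, mem_headSet] at hl
      tauto
  rw [h1, tailForm, tailForm, ← Summable.tsum_add _ (summable_tailForm hX D w)]
  · refine tsum_congr fun l => ?_
    by_cases h2 : k ≤ l.1
    · by_cases h3 : l.1 < D
      · simp [h2, h3]
      · simp [h2, not_lt.1 h3]
    · simp [h2, show ¬ D ≤ l.1 by lia]
  · exact ((summable_colDot_sq hX w).indicator {l : Idx p | k ≤ l.1 ∧ l.1 < D}).congr
      fun l => by simp [Set.indicator_apply]

theorem measurable_whiten (l : Idx p) : Measurable fun x : Idx p → ℝ => whiten eig x l := by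
  unfold whiten
  fun_prop

theorem IsFeatureLaw.memLp_whiten (hμ : IsFeatureLaw eig μ) (l : Idx p) :
    MemLp (fun x => whiten eig x l) 2 μ := by
  simpa [whiten, div_eq_mul_inv] using (hμ.memLp l).mul_const (√(eig l))⁻¹

theorem IsFeatureLaw.integral_whiten_mul (hμ : IsFeatureLaw eig μ) (l l' : Idx p) :
    ∫ x, whiten eig x l * whiten eig x l' ∂μ = if l = l' then 1 else 0 := by
  have h1 : ∀ x : Idx p → ℝ, whiten eig x l * whiten eig x l' =
      (√(eig l))⁻¹ * (√(eig l'))⁻¹ * (x l * x l') := fun x => by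
    simp only [whiten, div_eq_mul_inv]
    ring
  simp_rw [h1]
  rw [integral_const_mul, hμ.second_moment]
  split_ifs with h
  · subst h
    rw [← mul_inv, Real.mul_self_sqrt (hμ.eig_pos l).le, inv_mul_cancel₀ (hμ.eig_pos l).ne']
  · simp

/-- Smallest singular value of the whitened sample on the first `k` coordinates. -/
theorem measure_head_lt_le [IsProbabilityMeasure μ] (hμ : IsFeatureLaw eig μ) {k q : ℕ} {R : ℝ}
    (hR : ∀ᵐ x ∂μ, ∑ l ∈ headSet p k, whiten eig x l ^ 2 ≤ R) (hq : 1 ≤ q) (hqn : 2 * q ≤ n)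
    (hqR : q * R ≤ n / (4 * Real.exp 2)) :
    (Measure.pi fun _ : Fin n => μ) {X | ∃ h : Idx p → ℝ,
      ∑ i, (∑ l ∈ headSet p k, whiten eig (X i) l * h l) ^ 2 <
        n / (4 * Real.exp 2) * ∑ l ∈ headSet p k, h l ^ 2} ≤
      ENNReal.ofReal (2 * k * Real.exp (-q)) := by
  classical
  let f : (Idx p → ℝ) → (headSet p k → ℝ) := fun x l => whiten eig x l
  have hf : Measurable f := measurable_pi_lambda _ fun l => measurable_whiten l.1
  have : IsProbabilityMeasure (μ.map f) := Measure.isProbabilityMeasure_map hf.aemeasurable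
  have hmem : ∀ l, MemLp (fun y : headSet p k → ℝ => y l) 2 (μ.map f) := fun l => by
    rw [memLp_map_measure_iff (measurable_pi_apply l).aestronglyMeasurable hf.aemeasurable]
    exact hμ.memLp_whiten l.1
  have hone : ∀ l l', ∫ y, y l * y l' ∂(μ.map f) = if l = l' then 1 else 0 := fun l l' => by
    rw [integral_map hf.aemeasurable (by fun_prop)]
    simp only [f, hμ.integral_whiten_mul, Subtype.ext_iff]
  have hR' : ∀ᵐ y ∂(μ.map f), y ⬝ᵥ y ≤ R := by
    rw [ae_map_iff hf.aemeasurable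
      (measurableSet_le (by unfold dotProduct; fun_prop) (by fun_prop))]
    filter_upwards [hR] with x hx
    rw [← Finset.sum_coe_sort] at hx
    simpa [dotProduct, f, sq] using hx
  refine le_trans (measure_mono ?_) ((measure_pi_preimage_le hf n _).trans
    ((measure_gramSum_lt_le hmem hone hR' hq hqn hqR).trans (ENNReal.ofReal_le_ofReal ?_)))
  · rintro X ⟨h, hh⟩
    refine ⟨fun l => h l, ?_⟩
    rw [dotProduct_gramSum]
    simp only [← Finset.sum_coe_sort (headSet p k)] at hh
    simpa [dotProduct, f, sq] using hh
  · have : (Fintype.card (headSet p k) : ℝ) ≤ k := by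
      rw [Fintype.card_coe]
      exact_mod_cast card_headSet_le p k
    gcongr

/-- Largest singular value of the sample on finitely many coordinates beyond the first `k`. -/
theorem measure_tail_gt_le [IsProbabilityMeasure μ] (hμ : IsFeatureLaw eig μ) {k D q : ℕ}
    {L R : ℝ} (hL0 : 0 ≤ L) (hL : ∀ l : Idx p, k ≤ l.1 → eig l ≤ L) (hR0 : 0 ≤ R)
    (hR : ∀ᵐ x ∂μ, tailNormSq k x ≤ R) (hq : 1 ≤ q) (hqR : q * R ≤ 1) (hnL : n * L ≤ 1) :
    (Measure.pi fun _ : Fin n => μ) {X | ∃ w : Fin n → ℝ, Real.exp 4 * ∑ i, w i ^ 2 <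
      ∑ l ∈ (headSet p D).filter (fun l => k ≤ l.1), colDot X w l ^ 2} ≤
      ENNReal.ofReal (D * Real.exp (-q)) := by
  classical
  set t := (headSet p D).filter (fun l => k ≤ l.1) with ht
  let f : (Idx p → ℝ) → (t → ℝ) := fun x l => x l
  have hf : Measurable f := measurable_pi_lambda _ fun l => measurable_pi_apply l.1
  have : IsProbabilityMeasure (μ.map f) := Measure.isProbabilityMeasure_map hf.aemeasurable
  have hmem : ∀ l, MemLp (fun y : t → ℝ => y l) 2 (μ.map f) := fun l => by
    rw [memLp_map_measure_iff (measurable_pi_apply l).aestronglyMeasurable hf.aemeasurable]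
    exact hμ.memLp l.1
  have hΛ : ∀ l l', ∫ y, y l * y l' ∂(μ.map f) = if l = l' then eig l.1 else 0 := fun l l' => by
    rw [integral_map hf.aemeasurable (by fun_prop)]
    simp only [f, hμ.second_moment, Subtype.ext_iff]
  have hR' : ∀ᵐ y ∂(μ.map f), y ⬝ᵥ y ≤ R := by
    rw [ae_map_iff hf.aemeasurable
      (measurableSet_le (by unfold dotProduct; fun_prop) (by fun_prop))]
    filter_upwards [hR, hμ.ae_summable_sq] with x hx hxs
    refine le_trans ?_ hx
    have h1 := (Summable.ite_tail hxs k).sum_le_tsum t fun l _ => by split_ifs <;> positivity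
    refine le_trans (le_of_eq ?_) h1
    rw [← Finset.sum_coe_sort]
    refine Finset.sum_congr rfl fun l _ => ?_
    rw [if_pos (Finset.mem_filter.1 l.2).2, sq]
  have hLt : ∀ l : t, eig l.1 ≤ L := fun l => hL l.1 (Finset.mem_filter.1 l.2).2
  refine le_trans (measure_mono ?_) ((measure_pi_preimage_le hf n _).trans
    ((measure_gramSum_gt_le hmem hΛ hL0 hLt hR0 hR' hq hqR hnL).trans
      (ENNReal.ofReal_le_ofReal ?_)))
  · rintro X ⟨w, hw⟩
    by_contra hc
    have hc' : ∀ v : t → ℝ, ∑ i, (∑ l, X i l.1 * v l) ^ 2 ≤ Real.exp 4 * ∑ l, v l ^ 2 := by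
      intro v
      by_contra h
      refine hc ⟨v, ?_⟩
      rw [dotProduct_gramSum]
      simpa [dotProduct, f, sq] using h
    have := sum_sq_transpose_le (Real.exp_pos 4).le hc' w
    rw [← Finset.sum_coe_sort t] at hw
    exact absurd this (not_le.2 hw)
  · have : (Fintype.card t : ℝ) ≤ D := by
      rw [Fintype.card_coe]
      exact_mod_cast (Finset.card_filter_le _ _).trans (card_headSet_le p D)
    gcongr

/-- The variance bound under generic features, with all truncation levels left free: `k` separates
the coordinates that are learned from the rest, `m` is the level beyond which the rows are nearly
orthogonal, and the coordinates from `D` on are negligible. -/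
theorem GenericFeatures.measure_not_varianceBound_le [IsProbabilityMeasure μ] {ν : Measure ℝ}
    [IsProbabilityMeasure ν] {σ lam α β : ℝ} (hμ : IsFeatureLaw eig μ) (hν : IsNoiseLaw σ ν)
    (hG : GenericFeatures α β eig μ) (hα : 0 < α) (hβ : 0 ≤ β) (hlam : 0 ≤ lam) {k m D q : ℕ}
    (hk : 1 ≤ k) (hkm : k ≤ m) (hmp : (m : ℕ∞) < p) (hkD : k ≤ D) (hq : 1 ≤ q) (hqn : 2 * q ≤ n)
    (hqk : q * (β * k) ≤ n / (4 * Real.exp 2)) {L L' r : ℝ} (hL0 : 0 ≤ L) (hL0' : 0 ≤ L')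
    (hL : ∀ l : Idx p, k ≤ l.1 → eig l ≤ L) (hL' : ∀ l : Idx p, m ≤ l.1 → eig l ≤ L')
    (hnL : n * L ≤ 1) (hqR : q * (β * tailTr eig k) ≤ 1) (hr : 0 ≤ r)
    (hrem : n * (β * tailTr eig D) + n * lam ≤ r) {s B : ℝ} (hs : s = α * tailTr eig m / 2)
    (hB : n * (4 * (Real.exp 4 + r) / (s * (n / (4 * Real.exp 2))) + L / s) * σ ^ 2 ≤ B) :
    (Measure.pi fun _ : Fin n => μ) {X | ¬ VarianceBound μ ν lam B X} ≤
      ENNReal.ofReal (n ^ 2 * (L' * tailTr eig m) / s ^ 2) +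
      ENNReal.ofReal (2 * k * Real.exp (-q)) + ENNReal.ofReal (D * Real.exp (-q)) := by
  have hkp : (k : ℕ∞) < p := lt_of_le_of_lt (by exact_mod_cast hkm) hmp
  have htr : 0 < tailTr eig m := tailTr_pos hμ.eig_pos hμ.trace_class hmp
  have hs0 : 0 < s := by rw [hs]; positivity
  have hn : (0 : ℝ) < n := by exact_mod_cast (by lia : 0 < n)
  have hDbound : ∀ᵐ x ∂μ, tailNormSq D x ≤ β * tailTr eig D := by
    by_cases hD : (D : ℕ∞) < p
    · filter_upwards [hG.ae_bounds hβ hμ hD] with x hx using hx.2.1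
    · refine Eventually.of_forall fun x => le_trans (le_of_eq ?_)
        (mul_nonneg hβ (tailTr_nonneg hμ.eig_pos D))
      refine (tsum_congr fun l => if_neg fun hl => hD (lt_of_le_of_lt ?_ l.2)).trans tsum_zero
      exact_mod_cast hl
  have hhead : ∀ᵐ x ∂μ, ∑ l ∈ headSet p k, whiten eig x l ^ 2 ≤ β * k := by
    filter_upwards [hG.ae_bounds hβ hμ hkp] with x hx using hx.2.2 hk
  have htail : ∀ᵐ x ∂μ, tailNormSq k x ≤ β * tailTr eig k := by
    filter_upwards [hG.ae_bounds hβ hμ hkp] with x hx using hx.2.1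
  have hdiag : ∀ᵐ x ∂μ, α * tailTr eig m ≤ tailNormSq m x := by
    filter_upwards [hG.ae_bounds hβ hμ hmp] with x hx using hx.1
  have hae := (hμ.ae_rows_summable n).and ((ae_rows n hDbound).and (ae_rows n hdiag))
  refine le_trans (measure_mono_ae (t := ({X | s ^ 2 ≤ offDiagSq m X} ∪
      {X | ∃ h : Idx p → ℝ, ∑ i, (∑ l ∈ headSet p k, whiten eig (X i) l * h l) ^ 2 <
        n / (4 * Real.exp 2) * ∑ l ∈ headSet p k, h l ^ 2}) ∪
      {X | ∃ w : Fin n → ℝ, Real.exp 4 * ∑ i, w i ^ 2 <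
        ∑ l ∈ (headSet p D).filter (fun l => k ≤ l.1), colDot X w l ^ 2}) ?_) ?_
  · filter_upwards [hae] with X ⟨hX, hXD, hXd⟩ hbad
    by_contra hc
    have hc : X ∉ ({X | s ^ 2 ≤ offDiagSq m X} ∪
      {X | ∃ h : Idx p → ℝ, ∑ i, (∑ l ∈ headSet p k, whiten eig (X i) l * h l) ^ 2 <
        n / (4 * Real.exp 2) * ∑ l ∈ headSet p k, h l ^ 2}) ∪
      {X | ∃ w : Fin n → ℝ, Real.exp 4 * ∑ i, w i ^ 2 <
        ∑ l ∈ (headSet p D).filter (fun l => k ≤ l.1), colDot X w l ^ 2} := hc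
    simp only [Set.mem_union, Set.mem_ofPred_eq, not_or, not_exists, not_lt, not_le] at hc
    obtain ⟨⟨hc1, hc2⟩, hc3⟩ := hc
    refine hbad (varianceBound_of_forms hμ hν hX k hs0 (S := Real.exp 4 + r) (by positivity)
      (τ := n / (4 * Real.exp 2)) (by positivity) hL0 hlam hL ?_ ?_ hc2 hB)
    · intro w
      refine le_trans ?_ (tailForm_anti hX hkm w)
      have := tailForm_ge_of_offDiagSq hX hs0.le hXd hc1.le w
      refine le_trans (le_of_eq ?_) this
      rw [hs]
      ring
    · intro w
      have hw : 0 ≤ ∑ i, w i ^ 2 := Finset.sum_nonneg fun i _ => sq_nonneg _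
      have h1 : ∑ i, tailNormSq D (X i) ≤ n * (β * tailTr eig D) := by
        refine (Finset.sum_le_sum fun i _ => hXD i).trans (le_of_eq ?_)
        simp
      have h2 := (tailForm_le_tailNormSq hX D w).trans (mul_le_mul_of_nonneg_right h1 hw)
      have h3 := hc3 w
      have h4 := mul_le_mul_of_nonneg_right hrem hw
      rw [tailForm_eq_sum_add hX hkD w]
      nlinarith
  · refine (measure_union_le _ _).trans (add_le_add
      ((measure_union_le _ _).trans (add_le_add ?_ ?_)) ?_)
    · exact measure_offDiagSq_ge_le hμ hL0' hL' (by positivity)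
    · exact measure_head_lt_le hμ hhead hq hqn hqk
    · exact measure_tail_gt_le hμ hL0 hL (mul_nonneg hβ (tailTr_nonneg hμ.eig_pos k)) htail hq hqR
        hnL

end GenericBound

/-! ### Generic features: choice of the truncation levels -/

theorem RidgeOrder.bounds {a : ℝ} {b : WithTop ℝ}
    (hb : ((1 + a : ℝ) : WithTop ℝ) ≤ b) {cR CR lam : ℝ} (hcR : 0 < cR) {n : ℕ} (hn : 1 ≤ n)
    (h : RidgeOrder b cR CR n lam) : 0 ≤ lam ∧ n * lam ≤ |CR| * (n : ℝ) ^ (-a) := by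
  have hn0 : (0 : ℝ) < n := by exact_mod_cast hn
  have hn1 : (1 : ℝ) ≤ n := by exact_mod_cast hn
  induction b with
  | top =>
    rw [h.1 rfl]
    exact ⟨le_rfl, by rw [mul_zero]; positivity⟩
  | coe β =>
    obtain ⟨h1, h2⟩ := h.2 β rfl
    have hβ : 1 + a ≤ β := by exact_mod_cast hb
    refine ⟨le_trans (by positivity) h1, ?_⟩
    calc n * lam ≤ n * (|CR| * (n : ℝ) ^ (-β)) := by
          refine mul_le_mul_of_nonneg_left (h2.trans ?_) hn0.le
          exact mul_le_mul_of_nonneg_right (le_abs_self CR) (by positivity)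
      _ = |CR| * (n : ℝ) ^ (1 - β) := by
          rw [sub_eq_add_neg, Real.rpow_add hn0, Real.rpow_one]
          ring
      _ ≤ |CR| * (n : ℝ) ^ (-a) := by
          refine mul_le_mul_of_nonneg_left ?_ (abs_nonneg _)
          exact Real.rpow_le_rpow_of_exponent_le hn1 (by linarith)

section Levels

variable {p : ℕ∞} {eig : Idx p → ℝ} {μ : Measure (Idx p → ℝ)} {n : ℕ}

theorem half_le_floor {x : ℝ} (hx : 1 ≤ x) : x / 2 ≤ (⌊x⌋₊ : ℝ) := by
  have h1 := Nat.lt_floor_add_one x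
  have h2 : (1 : ℝ) ≤ ⌊x⌋₊ := by exact_mod_cast (Nat.one_le_floor_iff x).2 hx
  linarith

theorem natCast_le_of_ofReal_le {N : ℕ} {y : ℝ} (hN : (N : ℝ) ≤ y)
    (h : ENNReal.ofReal y ≤ (p : ℝ≥0∞)) : (N : ℕ∞) ≤ p := by
  have h1 : (N : ℝ≥0∞) ≤ (p : ℝ≥0∞) := by
    refine le_trans ?_ h
    rw [← ENNReal.ofReal_natCast]
    exact ENNReal.ofReal_le_ofReal hN
  rw [← ENat.toENNReal_le, ENat.toENNReal_coe]
  exact h1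

set_option maxHeartbeats 1000000 in
/-- The variance bound under generic features for one large sample size, with `k ≈ c₀ n / log n`,
`m ≈ n² g log n`, `D = n ^ M` and matrix moments of order `q ≈ A log n`. -/
theorem GenericFeatures.measure_not_varianceBound_le_of_large [IsProbabilityMeasure μ]
    {ν : Measure ℝ} [IsProbabilityMeasure ν] {a b' cE CE α β σ lam rR : ℝ}
    (hμ : IsFeatureLaw eig μ) (hν : IsNoiseLaw σ ν) (ha : 0 < a) (hcE : 0 < cE) (hCE : 0 < CE)
    (hdec : PolyDecay a cE CE eig) (hG : GenericFeatures α β eig μ) (hα : 0 < α) (hβ : 1 ≤ β)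
    (hlam : 0 ≤ lam) (hnlam : n * lam ≤ rR) (hrR : 0 ≤ rR) {M : ℕ} (hM1 : 1 ≤ M) (hM : 1 ≤ M * a)
    {ℓ g A c₀ : ℝ} (hℓ : ℓ = Real.log n) (hℓ1 : 1 ≤ ℓ) (hA : A = M + 2)
    (hc₀ : c₀ = 1 / (4 * Real.exp 2 * ((A + 1) * β))) (hn1 : 2 ≤ c₀ * n / ℓ)
    (hn2 : 2 * ((A + 1) * ℓ) ≤ n)
    (hn3 : CE * (c₀ / 2) ^ (-1 - a) * ((n : ℝ) ^ (-a) * ℓ ^ (1 + a)) ≤ 1)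
    (hn4 : (A + 1) * β * (CE / a * (c₀ / 2) ^ (-a)) * ((n : ℝ) ^ (-a) * ℓ ^ (1 + a)) ≤ 1)
    (hg : 2 ≤ g) (hgℓ : g ≤ ℓ) (hgp : ENNReal.ofReal (4 * (n ^ 2 * ℓ * g)) ≤ (p : ℝ≥0∞))
    (hb' : b' = (16 * Real.exp 2 * (Real.exp 4 + (β * (CE / a) + rR)) + 1) /
      (α / 2 * (cE * 2 ^ (-1 - a)))) :
    (Measure.pi fun _ : Fin n => μ) {X | ¬ VarianceBound μ ν lam
      (b' * σ ^ 2 * (n : ℝ) ^ (2 * a) * ℓ ^ (2 * a)) X} ≤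
      ENNReal.ofReal (8 * CE / (α ^ 2 * (cE * 2 ^ (-1 - a))) / (ℓ * g) + 3 / n) := by
  have hβ0 : 0 < β := by linarith
  have hℓ0 : 0 < ℓ := by linarith
  have hMr : (1 : ℝ) ≤ M := by exact_mod_cast hM1
  have hA3 : 3 ≤ A := by rw [hA]; linarith
  have hc₀0 : 0 < c₀ := by rw [hc₀]; positivity
  have hn : (1 : ℝ) ≤ n := by nlinarith
  have hn0 : (0 : ℝ) < n := by linarith
  have hnN : 1 ≤ n := by exact_mod_cast hn
  have hc₀1 : c₀ ≤ 1 := by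
    rw [hc₀, div_le_one (by positivity)]
    have h1 : 1 ≤ Real.exp 2 := Real.one_le_exp (by norm_num)
    have h2 : 1 ≤ (A + 1) * β := by nlinarith
    nlinarith
  -- the order of the matrix moments
  obtain ⟨q, hqlow, hqup⟩ : ∃ q : ℕ, A * ℓ ≤ q ∧ (q : ℝ) ≤ (A + 1) * ℓ := by
    refine ⟨⌈A * ℓ⌉₊, Nat.le_ceil _, ?_⟩
    have := Nat.ceil_lt_add_one (a := A * ℓ) (by positivity)
    linarith
  have hq1 : 1 ≤ q := by
    have : (1 : ℝ) ≤ q := by nlinarith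
    exact_mod_cast this
  have hqn : 2 * q ≤ n := by
    have : (2 * q : ℝ) ≤ n := by linarith
    exact_mod_cast this
  -- the level below which the coordinates are well-conditioned
  obtain ⟨k, hkup, hklow'⟩ : ∃ k : ℕ, (k : ℝ) ≤ c₀ * n / ℓ ∧ c₀ * n / ℓ / 2 ≤ k :=
    ⟨⌊c₀ * n / ℓ⌋₊, Nat.floor_le (by positivity), half_le_floor (by linarith)⟩
  have hklow : c₀ / 2 * (n / ℓ) ≤ k := by
    refine le_trans (le_of_eq ?_) hklow'
    ring
  have hk1 : 1 ≤ k := by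
    have : (1 : ℝ) ≤ k := by linarith
    exact_mod_cast this
  have hk0 : (0 : ℝ) < k := by exact_mod_cast hk1
  have hkn : (k : ℝ) ≤ n := by
    refine hkup.trans ?_
    rw [div_le_iff₀ hℓ0]
    nlinarith
  have hqk : q * (β * k) ≤ n / (4 * Real.exp 2) := by
    calc q * (β * k) ≤ (A + 1) * ℓ * (β * (c₀ * n / ℓ)) := by gcongr
      _ = c₀ * ((A + 1) * β) * n := by field_simp
      _ = n / (4 * Real.exp 2) := by
          have : (A + 1) * β ≠ 0 := by positivity
          rw [hc₀]
          field_simp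
  -- the level beyond which the rows are nearly orthogonal
  obtain ⟨x, hx⟩ : ∃ x : ℝ, x = (n : ℝ) ^ 2 * ℓ * g := ⟨_, rfl⟩
  have hx0 : 0 < x := by rw [hx]; positivity
  have hxn : 2 * n ≤ x := by
    have h1 : (n : ℝ) ≤ n ^ 2 * ℓ := by nlinarith
    rw [hx]
    nlinarith
  obtain ⟨m, hmup, hmlow⟩ : ∃ m : ℕ, (m : ℝ) ≤ x ∧ x / 2 ≤ m :=
    ⟨⌊x⌋₊, Nat.floor_le hx0.le, half_le_floor (by linarith)⟩
  have hkm : k ≤ m := by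
    have : (k : ℝ) ≤ m := by linarith
    exact_mod_cast this
  have hm1 : 1 ≤ m := hk1.trans hkm
  have hm0 : (0 : ℝ) < m := by exact_mod_cast hm1
  have h2mp : ((2 * m + 1 : ℕ) : ℕ∞) ≤ p := by
    refine natCast_le_of_ofReal_le ?_ hgp
    rw [← hx]
    push_cast
    linarith
  have hmp : (m : ℕ∞) < p := lt_of_lt_of_le (Nat.cast_lt.2 (by lia : m < 2 * m + 1)) h2mp
  have h2mp' : ((2 * m : ℕ) : ℕ∞) ≤ p :=
    le_trans (Nat.cast_le.2 (by lia : 2 * m ≤ 2 * m + 1)) h2mp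
  have hpos := hμ.eig_pos
  obtain ⟨tr, htrdef⟩ : ∃ tr, tr = tailTr eig m := ⟨_, rfl⟩
  obtain ⟨cs, hcs⟩ : ∃ cs, cs = cE * 2 ^ (-1 - a) := ⟨_, rfl⟩
  have hcs0 : 0 < cs := by rw [hcs]; positivity
  have htrlow : cs * (m : ℝ) ^ (-a) ≤ tr := by
    rw [hcs, htrdef]
    exact hdec.le_tailTr hpos hμ.trace_class ha hcE.le hm1 h2mp'
  have hma : 0 < (m : ℝ) ^ (-a) := by positivity
  have htr0 : 0 < tr := lt_of_lt_of_le (by positivity) htrlow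
  have hpow : ∀ e : ℝ, e ≤ 0 → (k : ℝ) ^ e ≤ (c₀ / 2) ^ e * ((n : ℝ) ^ e * ℓ ^ (-e)) := by
    intro e he
    refine (Real.rpow_le_rpow_of_nonpos (by positivity) hklow he).trans (le_of_eq ?_)
    rw [Real.mul_rpow (by positivity) (by positivity), Real.div_rpow hn0.le hℓ0.le,
      Real.rpow_neg hℓ0.le, div_eq_mul_inv ((n : ℝ) ^ e)]
  obtain ⟨L, hL⟩ : ∃ L, L = CE * (k : ℝ) ^ (-1 - a) := ⟨_, rfl⟩
  have hnL : n * L ≤ 1 := by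
    refine le_trans ?_ hn3
    calc n * L ≤ n * (CE * ((c₀ / 2) ^ (-1 - a) * ((n : ℝ) ^ (-1 - a) * ℓ ^ (-(-1 - a))))) := by
          rw [hL]
          gcongr
          exact hpow _ (by linarith)
      _ = CE * (c₀ / 2) ^ (-1 - a) * ((n : ℝ) ^ (-a) * ℓ ^ (1 + a)) := by
          rw [show -(-1 - a) = 1 + a by ring, show -a = 1 + (-1 - a) by ring, Real.rpow_add hn0,
            Real.rpow_one]
          ring
  have hqR : q * (β * tailTr eig k) ≤ 1 := by
    refine le_trans ?_ hn4
    calc q * (β * tailTr eig k) ≤ (A + 1) * ℓ * (β * (CE / a * ((c₀ / 2) ^ (-a) *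
            ((n : ℝ) ^ (-a) * ℓ ^ (-(-a)))))) := by
          have h1 := (hdec.tailTr_le hpos ha hCE.le hk1).trans
            (mul_le_mul_of_nonneg_left (hpow (-a) (by linarith)) (by positivity))
          have h0 := tailTr_nonneg hpos k
          gcongr
      _ = _ := by
          rw [neg_neg, Real.rpow_add hℓ0, Real.rpow_one]
          ring
  obtain ⟨D, hD⟩ : ∃ D, D = n ^ M := ⟨_, rfl⟩
  have hDn : (n : ℝ) ≤ D := by
    rw [hD, Nat.cast_pow]
    exact le_self_pow₀ hn (by lia)
  have hkD : k ≤ D := by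
    have : (k : ℝ) ≤ D := hkn.trans hDn
    exact_mod_cast this
  have hDpow : (D : ℝ) ^ (-a) ≤ (n : ℝ)⁻¹ := by
    rw [hD, Nat.cast_pow, ← Real.rpow_natCast, ← Real.rpow_mul hn0.le, ← Real.rpow_neg_one]
    exact Real.rpow_le_rpow_of_exponent_le hn (by linarith)
  have hrem : n * (β * tailTr eig D) + n * lam ≤ β * (CE / a) + rR := by
    have h1 : tailTr eig D ≤ CE / a * (n : ℝ)⁻¹ :=
      (hdec.tailTr_le hpos ha hCE.le (hk1.trans hkD)).trans
        (mul_le_mul_of_nonneg_left hDpow (by positivity))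
    have h2 : n * (β * tailTr eig D) ≤ n * (β * (CE / a * (n : ℝ)⁻¹)) := by gcongr
    have h3 : n * (β * (CE / a * (n : ℝ)⁻¹)) = β * (CE / a) := by field_simp
    linarith
  obtain ⟨s, hs⟩ : ∃ s, s = α * tr / 2 := ⟨_, rfl⟩
  have hs0 : 0 < s := by rw [hs]; positivity
  have hslow : α / 2 * cs * ((n : ℝ) ^ (-(2 * a)) * ℓ ^ (-(2 * a))) ≤ s := by
    have h1 : (n : ℝ) ^ (-(2 * a)) * ℓ ^ (-(2 * a)) = ((n : ℝ) ^ 2 * ℓ ^ 2) ^ (-a) := by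
      rw [Real.mul_rpow (by positivity) (by positivity), ← Real.rpow_natCast, ← Real.rpow_natCast,
        ← Real.rpow_mul hn0.le, ← Real.rpow_mul hℓ0.le]
      push_cast
      congr 2 <;> ring
    have h2 : ((n : ℝ) ^ 2 * ℓ ^ 2) ^ (-a) ≤ (m : ℝ) ^ (-a) := by
      refine Real.rpow_le_rpow_of_nonpos hm0 (hmup.trans ?_) (by linarith)
      rw [hx, sq ℓ, ← mul_assoc]
      gcongr
    rw [h1, hs]
    calc α / 2 * cs * ((n : ℝ) ^ 2 * ℓ ^ 2) ^ (-a) ≤ α / 2 * (cs * (m : ℝ) ^ (-a)) := by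
          rw [mul_assoc]
          gcongr
      _ ≤ α / 2 * tr := by gcongr
      _ = α * tr / 2 := by ring
  obtain ⟨r, hr⟩ : ∃ r, r = β * (CE / a) + rR := ⟨_, rfl⟩
  have hr0 : 0 ≤ r := by rw [hr]; positivity
  have hB : n * (4 * (Real.exp 4 + r) / (s * (n / (4 * Real.exp 2))) + L / s) * σ ^ 2 ≤
      b' * σ ^ 2 * (n : ℝ) ^ (2 * a) * ℓ ^ (2 * a) := by
    have h1 : n * (4 * (Real.exp 4 + r) / (s * (n / (4 * Real.exp 2))) + L / s) =
        (16 * Real.exp 2 * (Real.exp 4 + r) + n * L) / s := by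
      field_simp
      ring
    have h2 : (16 * Real.exp 2 * (Real.exp 4 + r) + n * L) / s ≤
        (16 * Real.exp 2 * (Real.exp 4 + r) + 1) /
          (α / 2 * cs * ((n : ℝ) ^ (-(2 * a)) * ℓ ^ (-(2 * a)))) := by
      gcongr
    have h3 : (16 * Real.exp 2 * (Real.exp 4 + r) + 1) /
          (α / 2 * cs * ((n : ℝ) ^ (-(2 * a)) * ℓ ^ (-(2 * a)))) =
        b' * ((n : ℝ) ^ (2 * a) * ℓ ^ (2 * a)) := by
      rw [hb', ← hcs, ← hr, Real.rpow_neg hn0.le, Real.rpow_neg hℓ0.le]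
      field_simp
    rw [h1]
    calc (16 * Real.exp 2 * (Real.exp 4 + r) + n * L) / s * σ ^ 2
        ≤ b' * ((n : ℝ) ^ (2 * a) * ℓ ^ (2 * a)) * σ ^ 2 :=
          mul_le_mul_of_nonneg_right (h2.trans h3.le) (sq_nonneg σ)
      _ = _ := by ring
  have hL0 : 0 ≤ L := by rw [hL]; positivity
  rw [← hcs]
  refine (hG.measure_not_varianceBound_le hμ hν hα hβ0.le hlam hk1 hkm hmp hkD hq1 hqn hqk hL0
    (L' := CE * (m : ℝ) ^ (-1 - a)) (by positivity)
    (fun l hl => hL ▸ hdec.le_of_le ha hCE.le hk1 hl)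
    (fun l hl => hdec.le_of_le ha hCE.le hm1 hl) hnL hqR hr0 (hr ▸ hrem) (htrdef ▸ hs) hB).trans ?_
  rw [← htrdef]
  rw [← ENNReal.ofReal_add (by positivity) (by positivity),
    ← ENNReal.ofReal_add (by positivity) (by positivity)]
  refine ENNReal.ofReal_le_ofReal ?_
  have hexpq : Real.exp (-q) ≤ (n : ℝ)⁻¹ ^ (M + 2) := by
    have h1 : (n : ℝ)⁻¹ ^ (M + 2) = Real.exp (-(A * ℓ)) := by
      rw [Real.exp_neg, hA, hℓ, inv_pow, ← Real.exp_log hn0, ← Real.exp_nat_mul, Real.log_exp]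
      push_cast
      rfl
    rw [h1]
    exact Real.exp_le_exp.2 (by linarith)
  have hinv : (n : ℝ)⁻¹ ≤ 1 := inv_le_one_of_one_le₀ hn
  have hinv0 : 0 ≤ (n : ℝ)⁻¹ := by positivity
  have e2 : 2 * k * Real.exp (-q) ≤ 2 / n := by
    have h1 : (n : ℝ)⁻¹ ^ (M + 2) ≤ (n : ℝ)⁻¹ ^ 2 := pow_le_pow_of_le_one hinv0 hinv (by lia)
    calc 2 * k * Real.exp (-q) ≤ 2 * n * (n : ℝ)⁻¹ ^ 2 := by
          have := hexpq.trans h1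
          gcongr
      _ = 2 / n := by field_simp
  have e3 : D * Real.exp (-q) ≤ 1 / n := by
    calc D * Real.exp (-q) ≤ D * (n : ℝ)⁻¹ ^ (M + 2) := by gcongr
      _ = (n : ℝ)⁻¹ ^ 2 := by
          rw [hD, Nat.cast_pow, pow_add, ← mul_assoc, ← mul_pow, mul_inv_cancel₀ hn0.ne', one_pow,
            one_mul]
      _ ≤ (n : ℝ)⁻¹ ^ 1 := pow_le_pow_of_le_one hinv0 hinv (by norm_num)
      _ = 1 / n := by rw [pow_one, one_div]
  have e1 : n ^ 2 * (CE * (m : ℝ) ^ (-1 - a) * tr) / s ^ 2 ≤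
      8 * CE / (α ^ 2 * cs) / (ℓ * g) := by
    have h1 : (m : ℝ) ^ (-1 - a) = (m : ℝ)⁻¹ * (m : ℝ) ^ (-a) := by
      rw [show -1 - a = -1 + -a by ring, Real.rpow_add hm0, Real.rpow_neg_one]
    calc n ^ 2 * (CE * (m : ℝ) ^ (-1 - a) * tr) / s ^ 2
        = 4 * CE / α ^ 2 * (n ^ 2 / m) * ((m : ℝ) ^ (-a) / tr) := by
          rw [h1, hs]
          field_simp
          ring
      _ ≤ 4 * CE / α ^ 2 * (n ^ 2 / (x / 2)) * ((m : ℝ) ^ (-a) / (cs * (m : ℝ) ^ (-a))) := by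
          gcongr
      _ = 8 * CE / (α ^ 2 * cs) / (ℓ * g) := by
          rw [hx]
          have hg0 : g ≠ 0 := by positivity
          field_simp
          ring
  have : (3 : ℝ) / n = 2 / n + 1 / n := by ring
  linarith

end Levels

theorem tendsto_rpow_neg_mul_log_rpow {a : ℝ} (ha : 0 < a) :
    Tendsto (fun n : ℕ => (n : ℝ) ^ (-a) * Real.log n ^ (1 + a)) atTop (𝓝 0) := by
  have h := (isLittleO_log_rpow_rpow_atTop (1 + a) ha).tendsto_div_nhds_zero
  refine (h.comp tendsto_natCast_atTop_atTop).congr fun n => ?_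
  simp only [Function.comp_apply]
  rw [Real.rpow_neg n.cast_nonneg, div_eq_mul_inv, mul_comm]

theorem tendsto_log_div_nat : Tendsto (fun n : ℕ => Real.log n / n) atTop (𝓝 0) := by
  have h := Real.isLittleO_log_id_atTop.tendsto_div_nhds_zero
  exact (h.comp tendsto_natCast_atTop_atTop).congr fun n => rfl

theorem PolyDecay.mono {p : ℕ∞} {eig : Idx p → ℝ} {a c C C' : ℝ} (h : PolyDecay a c C eig)
    (hC : C ≤ C') : PolyDecay a c C' eig := fun k =>
  ⟨(h k).1, (h k).2.trans (mul_le_mul_of_nonneg_right hC (by positivity))⟩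

theorem GenericFeatures.mono {p : ℕ∞} {eig : Idx p → ℝ} {μ : Measure (Idx p → ℝ)} {α β β' : ℝ}
    (h : GenericFeatures α β eig μ) (hβ : β ≤ β') : GenericFeatures α β' eig μ := fun k hk =>
  ⟨(h k hk).1, (h k hk).2.trans (ENNReal.ofReal_le_ofReal hβ)⟩

theorem genericFeatures_variance (a : ℝ) (ha : 0 < a) (b : WithTop ℝ)
    (hb : ((1 + a : ℝ) : WithTop ℝ) ≤ b) (cE CE : ℝ) (hcE : 0 < cE) (cR CR : ℝ) (hcR : 0 < cR)
    (α β : ℝ) (hα : 0 < α) (p : ℕ → ℕ∞)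
    (hp : Tendsto (fun n : ℕ => (p n : ℝ≥0∞) / ENNReal.ofReal ((n : ℝ) ^ 2 * Real.log n))
      atTop (𝓝 ⊤)) :
    ∃ C q : ℝ, 0 < C ∧ 0 ≤ q ∧ ∃ φ : ℕ → ℝ,
      φ =o[atTop] (fun n : ℕ => 1 / Real.log n) ∧
      ∀ n : ℕ, 1 ≤ n →
      ∀ (eig : Idx (p n) → ℝ) (μ : Measure (Idx (p n) → ℝ))
        [IsProbabilityMeasure μ] (ν : Measure ℝ) [IsProbabilityMeasure ν] (σ lam : ℝ),
        IsFeatureLaw eig μ → PolyDecay a cE CE eig → GenericFeatures α β eig μ →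
        IsNoiseLaw σ ν → RidgeOrder b cR CR n lam →
        (Measure.pi fun _ : Fin n => μ) {X | ¬ VarianceBound μ ν lam
          (C * σ ^ 2 * (n : ℝ) ^ (2 * a) * Real.log n ^ q) X} ≤ ENNReal.ofReal (φ n) := by
  classical
  set CE' := max CE 1
  set β' := max β 1
  have hCE' : 0 < CE' := lt_of_lt_of_le one_pos (le_max_right _ _)
  have hβ' : 1 ≤ β' := le_max_right _ _
  obtain ⟨M₀, hM₀⟩ := exists_nat_ge (1 / a)
  set M := M₀ + 1
  have hM : (1 : ℝ) ≤ M * a := by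
    have h1 : 1 / a ≤ (M : ℝ) := by simp only [M]; push_cast; linarith
    calc (1 : ℝ) = 1 / a * a := by field_simp
      _ ≤ M * a := mul_le_mul_of_nonneg_right h1 ha.le
  set A : ℝ := M + 2 with hA
  set c₀ := 1 / (4 * Real.exp 2 * ((A + 1) * β')) with hc₀
  have hA0 : 0 < A + 1 := by positivity
  have hc₀0 : 0 < c₀ := by positivity
  -- a slowly growing factor that fits under the dimension
  let u : ℕ → ℝ≥0∞ := fun n => (p n : ℝ≥0∞) / ENNReal.ofReal ((n : ℝ) ^ 2 * Real.log n)
  let g : ℕ → ℝ := fun n => (min (ENNReal.ofReal (Real.log n)) (u n / 4)).toReal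
  have hlog : Tendsto (fun n : ℕ => Real.log n) atTop atTop :=
    Real.tendsto_log_atTop.comp tendsto_natCast_atTop_atTop
  have hglog : ∀ n, g n ≤ max (Real.log n) 0 := fun n => by
    refine (ENNReal.toReal_mono ENNReal.ofReal_ne_top (min_le_left _ _)).trans (le_of_eq ?_)
    rw [ENNReal.toReal_ofReal']
  have hg4 : ∀ n, ENNReal.ofReal (g n) ≤ u n / 4 := fun n =>
    ENNReal.ofReal_toReal_le.trans (min_le_right _ _)
  have hgtop : Tendsto g atTop atTop := by
    have h1 : Tendsto (fun n : ℕ => min (ENNReal.ofReal (Real.log n)) (u n / 4)) atTop (𝓝 ⊤) := by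
      have h2 : Tendsto (fun n : ℕ => ENNReal.ofReal (Real.log n)) atTop (𝓝 ⊤) :=
        ENNReal.tendsto_ofReal_atTop.comp hlog
      have h3 : Tendsto (fun n : ℕ => u n / 4) atTop (𝓝 ⊤) := by
        have := ENNReal.Tendsto.div_const (b := 4) hp (Or.inl ENNReal.top_ne_zero)
        rwa [ENNReal.top_div_of_ne_top (by norm_num)] at this
      simpa using h2.min h3
    refine tendsto_atTop.2 fun B => ?_
    filter_upwards [h1.eventually (lt_mem_nhds (ENNReal.ofReal_lt_top (r := B)))] with n hn
    have hne : min (ENNReal.ofReal (Real.log n)) (u n / 4) ≠ ⊤ :=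
      ne_top_of_le_ne_top ENNReal.ofReal_ne_top (min_le_left _ _)
    exact (ENNReal.ofReal_le_iff_le_toReal hne).1 hn.le
  set b' := (16 * Real.exp 2 * (Real.exp 4 + (β' * (CE' / a) + |CR|)) + 1) /
      (α / 2 * (cE * 2 ^ (-1 - a))) with hb'
  set K₁ := 8 * CE' / (α ^ 2 * (cE * 2 ^ (-1 - a))) with hK₁
  let Good : ℕ → Prop := fun n => 1 ≤ Real.log n ∧ 2 ≤ c₀ * n / Real.log n ∧
    2 * ((A + 1) * Real.log n) ≤ n ∧
    CE' * (c₀ / 2) ^ (-1 - a) * ((n : ℝ) ^ (-a) * Real.log n ^ (1 + a)) ≤ 1 ∧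
    (A + 1) * β' * (CE' / a * (c₀ / 2) ^ (-a)) * ((n : ℝ) ^ (-a) * Real.log n ^ (1 + a)) ≤ 1 ∧
    2 ≤ g n
  have hGood : ∀ᶠ n in atTop, Good n := by
    have h0 : ∀ᶠ n : ℕ in atTop, 1 ≤ Real.log n := hlog.eventually_ge_atTop 1
    have hdiv : ∀ ε : ℝ, 0 < ε → ∀ᶠ n : ℕ in atTop, Real.log n / n ≤ ε := fun ε hε =>
      tendsto_log_div_nat.eventually (ge_mem_nhds hε)
    have hh : ∀ K : ℝ, ∀ᶠ n : ℕ in atTop, K * ((n : ℝ) ^ (-a) * Real.log n ^ (1 + a)) ≤ 1 :=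
      fun K => by
        have := (tendsto_rpow_neg_mul_log_rpow ha).const_mul K
        rw [mul_zero] at this
        exact this.eventually (ge_mem_nhds one_pos)
    filter_upwards [h0, hdiv (c₀ / 2) (by positivity), hdiv (1 / (2 * (A + 1))) (by positivity),
      hh (CE' * (c₀ / 2) ^ (-1 - a)), hh ((A + 1) * β' * (CE' / a * (c₀ / 2) ^ (-a))),
      hgtop.eventually_ge_atTop 2, eventually_gt_atTop 0] with n hn0 hn1 hn2 hn3 hn4 hn5 hn6
    have hn : (0 : ℝ) < n := by exact_mod_cast hn6
    have hl : 0 < Real.log n := by linarith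
    refine ⟨hn0, ?_, ?_, hn3, hn4, hn5⟩
    · rw [div_le_iff₀ hn] at hn1
      rw [le_div_iff₀ hl]
      linarith
    · rw [div_le_iff₀ hn, one_div, ← div_eq_inv_mul, le_div_iff₀ (by positivity)] at hn2
      linarith
  refine ⟨b', 2 * a, by positivity, by positivity,
    fun n => if Good n then K₁ / (Real.log n * g n) + 3 / n else 1, ?_, ?_⟩
  · refine (Asymptotics.isLittleO_iff_tendsto' ?_).2 ?_
    · filter_upwards [hGood] with n hn h
      have : Real.log n ≠ 0 := by linarith [hn.1]
      rw [one_div, inv_eq_zero] at h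
      exact absurd h this
    · have h1 : Tendsto (fun n : ℕ => K₁ / g n + 3 * (Real.log n / n)) atTop (𝓝 0) := by
        simpa using (hgtop.const_div_atTop K₁).add (tendsto_log_div_nat.const_mul 3)
      refine h1.congr' ?_
      filter_upwards [hGood] with n hn
      have h2 : 0 < Real.log n := by linarith [hn.1]
      have h3 : g n ≠ 0 := by linarith [hn.2.2.2.2.2]
      rw [if_pos hn]
      field_simp
  · intro n hn eig μ _ ν _ σ lam hμ hdec hG hν hR
    by_cases hgood : Good n
    · obtain ⟨h1, h2, h3, h4, h5, h6⟩ := id hgood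
      obtain ⟨hlam, hnlam⟩ := hR.bounds hb hcR hn
      have hnpos : (0 : ℝ) < n := by exact_mod_cast hn
      have hna : (n : ℝ) ^ (-a) ≤ 1 :=
        Real.rpow_le_one_of_one_le_of_nonpos (by exact_mod_cast hn) (by linarith)
      simp only [if_pos hgood]
      refine (hG.mono (le_max_left β 1)).measure_not_varianceBound_le_of_large hμ hν ha hcE hCE'
        (hdec.mono (le_max_left CE 1)) hα hβ' hlam
        (hnlam.trans (mul_le_of_le_one_right (abs_nonneg _) hna)) (abs_nonneg _)
        (M := M) (by lia) hM rfl h1 hA hc₀ h2 h3 h4 h5 h6 ?_ ?_ hb'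
      · exact (hglog n).trans (by rw [max_eq_left (by linarith)])
      · have h7 : 0 < (n : ℝ) ^ 2 * Real.log n := by positivity
        have h8 : ENNReal.ofReal ((n : ℝ) ^ 2 * Real.log n) ≠ 0 := by
          rw [Ne, ENNReal.ofReal_eq_zero, not_le]; exact h7
        rw [show 4 * ((n : ℝ) ^ 2 * Real.log n * g n) = 4 * g n * (n ^ 2 * Real.log n) by ring,
          ENNReal.ofReal_mul (by linarith), ← ENNReal.le_div_iff_mul_le (Or.inl h8)
            (Or.inl ENNReal.ofReal_ne_top), ENNReal.ofReal_mul (by norm_num)]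
        calc ENNReal.ofReal 4 * ENNReal.ofReal (g n) ≤ 4 * (u n / 4) := by
              gcongr
              · simp
              · exact hg4 n
          _ = u n := ENNReal.mul_div_cancel (by norm_num) (by norm_num)
    · simp only [if_neg hgood, ENNReal.ofReal_one]
      exact prob_le_one

/-! ### Nets and quadratic forms of independent vectors -/

section Nets

variable {E : Type*} [NormedAddCommGroup E] [NormedSpace ℝ E] [FiniteDimensional ℝ E]

theorem exists_half_net (E : Type*) [NormedAddCommGroup E] [NormedSpace ℝ E]
    [FiniteDimensional ℝ E] : ∃ T : Finset E, T.card ≤ 5 ^ Module.finrank ℝ E ∧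
      ∀ v : E, ‖v‖ ≤ 1 → ∃ t ∈ T, ‖v - t‖ ≤ 1 / 2 := by
  classical
  -- a maximal `1`-separated subset of the ball of radius `2`, scaled down
  let P : Finset E → Prop := fun s => (∀ c ∈ s, ‖c‖ ≤ 2) ∧ ∀ c ∈ s, ∀ d ∈ s, c ≠ d → 1 ≤ ‖c - d‖
  let K : Set ℕ := {m | ∃ s, P s ∧ s.card = m}
  have hne : K.Nonempty := ⟨0, ∅, ⟨by simp, by simp⟩, rfl⟩
  have hb : BddAbove K := ⟨5 ^ Module.finrank ℝ E, by
    rintro _ ⟨s, hs, rfl⟩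
    exact Besicovitch.card_le_of_separated s hs.1 hs.2⟩
  obtain ⟨s, hs, hcard⟩ := Nat.sSup_mem hne hb
  refine ⟨s.image fun c => (1 / 2 : ℝ) • c,
    Finset.card_image_le.trans (Besicovitch.card_le_of_separated s hs.1 hs.2), fun v hv => ?_⟩
  by_contra! hcon
  have hfar : ∀ c ∈ s, 1 < ‖(2 : ℝ) • v - c‖ := fun c hc => by
    have h1 := hcon _ (Finset.mem_image_of_mem _ hc)
    have h2 : (2 : ℝ) • v - c = (2 : ℝ) • (v - (1 / 2 : ℝ) • c) := by
      rw [smul_sub, smul_smul]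
      norm_num
    rw [h2, norm_smul, Real.norm_ofNat]
    linarith
  have hmem : (2 : ℝ) • v ∉ s := fun h => by
    have := hfar _ h
    rw [sub_self, norm_zero] at this
    linarith
  have hP : P (insert ((2 : ℝ) • v) s) := by
    refine ⟨fun c hc => ?_, fun c hc d hd hcd => ?_⟩
    · rcases Finset.mem_insert.1 hc with rfl | hc
      · rw [norm_smul, Real.norm_ofNat]
        linarith
      · exact hs.1 c hc
    · rcases Finset.mem_insert.1 hc with rfl | hc' <;> rcases Finset.mem_insert.1 hd with rfl | hd'
      · exact absurd rfl hcd
      · exact (hfar d hd').le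
      · rw [norm_sub_rev]
        exact (hfar c hc').le
      · exact hs.2 c hc' d hd' hcd
  have := le_csSup hb ⟨_, hP, rfl⟩
  rw [Finset.card_insert_of_notMem hmem] at this
  lia

theorem exists_net (E : Type*) [NormedAddCommGroup E] [NormedSpace ℝ E]
    [FiniteDimensional ℝ E] (j : ℕ) : ∃ T : Finset E, T.card ≤ 5 ^ (j * Module.finrank ℝ E) ∧
      ∀ v : E, ‖v‖ ≤ 1 → ∃ t ∈ T, ‖v - t‖ ≤ (1 / 2) ^ j := by
  classical
  induction j with
  | zero => exact ⟨{0}, by simp, fun v hv => ⟨0, by simp, by simpa using hv⟩⟩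
  | succ j ih =>
    obtain ⟨T, hT, hcov⟩ := ih
    obtain ⟨T₁, hT₁, hcov₁⟩ := exists_half_net E
    refine ⟨(T ×ˢ T₁).image fun x => x.1 + ((1 / 2 : ℝ) ^ j) • x.2, ?_, fun v hv => ?_⟩
    · refine Finset.card_image_le.trans ?_
      rw [Finset.card_product, add_mul, one_mul, pow_add]
      exact Nat.mul_le_mul hT hT₁
    · obtain ⟨t, ht, htv⟩ := hcov v hv
      obtain ⟨t₁, ht₁, htv₁⟩ := hcov₁ ((2 : ℝ) ^ j • (v - t)) (by
        rw [norm_smul, norm_pow, Real.norm_ofNat]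
        calc (2 : ℝ) ^ j * ‖v - t‖ ≤ 2 ^ j * (1 / 2) ^ j := by gcongr
          _ = 1 := by rw [← mul_pow]; norm_num)
      refine ⟨_, Finset.mem_image_of_mem _ (Finset.mk_mem_product ht ht₁), ?_⟩
      have h : v - (t + ((1 / 2 : ℝ) ^ j) • t₁) =
          ((1 / 2 : ℝ) ^ j) • ((2 : ℝ) ^ j • (v - t) - t₁) := by
        rw [smul_sub, smul_smul, ← mul_pow]
        norm_num
        abel
      rw [h, norm_smul, norm_pow, pow_succ]
      refine mul_le_mul (le_of_eq ?_) htv₁ (norm_nonneg _) (by positivity)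
      norm_num

theorem exists_net_pi (ι : Type*) [Fintype ι] (j : ℕ) :
    ∃ T : Finset (ι → ℝ), T.card ≤ 5 ^ (j * Fintype.card ι) ∧
      ∀ v : ι → ℝ, ∑ i, v i ^ 2 ≤ 1 → ∃ t ∈ T, ∑ i, (v i - t i) ^ 2 ≤ (1 / 4) ^ j := by
  classical
  obtain ⟨T, hT, hcov⟩ := exists_net (EuclideanSpace ℝ ι) j
  rw [finrank_euclideanSpace] at hT
  refine ⟨T.image fun t => t.ofLp, Finset.card_image_le.trans hT, fun v hv => ?_⟩
  obtain ⟨t, ht, htv⟩ := hcov (WithLp.toLp 2 v) (by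
    rw [EuclideanSpace.norm_eq]
    exact Real.sqrt_le_one.2 (by simpa using hv))
  refine ⟨_, Finset.mem_image_of_mem _ ht, ?_⟩
  have h2 := pow_le_pow_left₀ (norm_nonneg _) htv 2
  rw [EuclideanSpace.norm_sq_eq] at h2
  calc ∑ i, (v i - t i) ^ 2 ≤ ((1 / 2) ^ j) ^ 2 := by simpa using h2
    _ = (1 / 4) ^ j := by rw [← pow_mul, mul_comm, pow_mul]; norm_num

end Nets

section Forms

variable {κ ι : Type*} [Fintype κ] [Fintype ι]

/-- The quadratic form `v ↦ ∑ₗ ⟨aₗ, v⟩²` of a family of vectors. -/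
def sqForm (a : κ → ι → ℝ) (v : ι → ℝ) : ℝ := ∑ l, (∑ i, a l i * v i) ^ 2

theorem sqForm_nonneg (a : κ → ι → ℝ) (v : ι → ℝ) : 0 ≤ sqForm a v :=
  Finset.sum_nonneg fun _ _ => sq_nonneg _

theorem sqForm_zero (a : κ → ι → ℝ) : sqForm a 0 = 0 := by simp [sqForm]

theorem sqForm_smul (a : κ → ι → ℝ) (c : ℝ) (v : ι → ℝ) :
    sqForm a (fun i => c * v i) = c ^ 2 * sqForm a v := by
  rw [sqForm, sqForm, Finset.mul_sum]
  refine Finset.sum_congr rfl fun l _ => ?_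
  rw [← mul_pow, Finset.mul_sum]
  congr 1
  exact Finset.sum_congr rfl fun i _ => by ring

theorem sqForm_le_add (a : κ → ι → ℝ) (v t : ι → ℝ) :
    sqForm a v ≤ 2 * sqForm a t + 2 * sqForm a (fun i => v i - t i) := by
  simp only [sqForm, Finset.mul_sum, ← Finset.sum_add_distrib]
  refine Finset.sum_le_sum fun l _ => ?_
  have h : ∑ i, a l i * v i = ∑ i, a l i * t i + ∑ i, a l i * (v i - t i) := by
    rw [← Finset.sum_add_distrib]
    exact Finset.sum_congr rfl fun i _ => by ring
  rw [h]
  nlinarith [sq_nonneg (∑ i, a l i * t i - ∑ i, a l i * (v i - t i))]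

theorem sum_sq_le_add (v t : ι → ℝ) :
    ∑ i, v i ^ 2 ≤ 2 * ∑ i, t i ^ 2 + 2 * ∑ i, (v i - t i) ^ 2 := by
  simp only [Finset.mul_sum, ← Finset.sum_add_distrib]
  exact Finset.sum_le_sum fun i _ => by nlinarith [sq_nonneg (t i - (v i - t i))]

theorem continuous_sqForm (a : κ → ι → ℝ) : Continuous (sqForm a) := by
  unfold sqForm
  fun_prop

theorem sum_sq_eq_zero_iff {v : ι → ℝ} : ∑ i, v i ^ 2 = 0 ↔ v = 0 := by
  rw [Finset.sum_eq_zero_iff_of_nonneg fun i _ => sq_nonneg _]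
  simp [funext_iff]

/-- A quadratic inequality can be checked on unit vectors. -/
theorem exists_unit_smul {v : ι → ℝ} (hv : v ≠ 0) :
    ∃ c : ℝ, 0 < c ∧ ∑ i, (c * v i) ^ 2 = 1 ∧ c ^ 2 * ∑ i, v i ^ 2 = 1 := by
  have h0 : 0 < ∑ i, v i ^ 2 :=
    lt_of_le_of_ne (Finset.sum_nonneg fun i _ => sq_nonneg _)
      fun h => hv (sum_sq_eq_zero_iff.1 h.symm)
  have h1 : (√(∑ i, v i ^ 2))⁻¹ ^ 2 * ∑ i, v i ^ 2 = 1 := by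
    rw [inv_pow, Real.sq_sqrt h0.le, inv_mul_cancel₀ h0.ne']
  refine ⟨(√(∑ i, v i ^ 2))⁻¹, by positivity, ?_, h1⟩
  simp only [mul_pow]
  rw [← Finset.mul_sum, h1]

theorem sqForm_le_of_unit {a : κ → ι → ℝ} {B : ℝ}
    (h : ∀ v : ι → ℝ, ∑ i, v i ^ 2 = 1 → sqForm a v ≤ B) (v : ι → ℝ) :
    sqForm a v ≤ B * ∑ i, v i ^ 2 := by
  rcases eq_or_ne v 0 with rfl | hv
  · simp [sqForm_zero]
  obtain ⟨c, hc, h1, h2⟩ := exists_unit_smul hv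
  have h3 := h _ h1
  rw [sqForm_smul] at h3
  have h4 : c ^ 2 * sqForm a v ≤ c ^ 2 * (B * ∑ i, v i ^ 2) := by linarith [congrArg (B * ·) h2]
  exact le_of_mul_le_mul_left h4 (by positivity)

theorem le_sqForm_of_unit {a : κ → ι → ℝ} {B : ℝ}
    (h : ∀ v : ι → ℝ, ∑ i, v i ^ 2 = 1 → B ≤ sqForm a v) (v : ι → ℝ) :
    B * ∑ i, v i ^ 2 ≤ sqForm a v := by
  rcases eq_or_ne v 0 with rfl | hv
  · simp [sqForm_zero]
  obtain ⟨c, hc, h1, h2⟩ := exists_unit_smul hv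
  have h3 := h _ h1
  rw [sqForm_smul] at h3
  have h4 : c ^ 2 * (B * ∑ i, v i ^ 2) ≤ c ^ 2 * sqForm a v := by linarith [congrArg (B * ·) h2]
  exact le_of_mul_le_mul_left h4 (by positivity)

/-- An upper bound for the form on a `1/2`-net bounds it everywhere: at a maximizer `v` on the
unit sphere, half of the value is lost to the distance from the net. -/
theorem sqForm_le_of_net {a : κ → ι → ℝ} {B : ℝ} (hB : 0 ≤ B) {T : Finset (ι → ℝ)}
    (hT : ∀ v : ι → ℝ, ∑ i, v i ^ 2 ≤ 1 → ∃ t ∈ T, ∑ i, (v i - t i) ^ 2 ≤ 1 / 4)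
    (h : ∀ t ∈ T, sqForm a t ≤ B * ∑ i, t i ^ 2) (v : ι → ℝ) :
    sqForm a v ≤ 10 * B * ∑ i, v i ^ 2 := by
  rcases isEmpty_or_nonempty ι with hι | hι
  · have : v = 0 := Subsingleton.elim _ _
    simp [this, sqForm_zero]
  classical
  let S : Set (ι → ℝ) := {v | ∑ i, v i ^ 2 = 1}
  have hS : IsCompact S := by
    refine (isCompact_univ_pi fun _ : ι =>
      isCompact_Icc (a := (-1 : ℝ)) (b := 1)).of_isClosed_subset
      (isClosed_eq (by fun_prop) continuous_const) fun v hv i _ => ?_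
    have h1 : v i ^ 2 ≤ 1 := (Finset.single_le_sum (fun i _ => sq_nonneg (v i))
      (Finset.mem_univ i)).trans (le_of_eq hv)
    exact abs_le.1 ((sq_le_one_iff_abs_le_one _).1 h1)
  have hne : S.Nonempty := by
    obtain ⟨i₀⟩ := hι
    refine ⟨fun i => if i = i₀ then 1 else 0, ?_⟩
    simp [S]
  obtain ⟨x, hx, hmax⟩ := hS.exists_isMaxOn hne (continuous_sqForm a).continuousOn
  have hall := sqForm_le_of_unit (a := a) (B := sqForm a x) fun v hv => hmax hv
  refine (hall v).trans (mul_le_mul_of_nonneg_right ?_ (Finset.sum_nonneg fun i _ => sq_nonneg _))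
  have hx1 : ∑ i, x i ^ 2 = 1 := hx
  obtain ⟨t, ht, htx⟩ := hT x hx1.le
  have h1 := sqForm_le_add a x t
  have h2 := hall fun i => x i - t i
  have h3 := h t ht
  have h4 : ∑ i, t i ^ 2 ≤ 5 / 2 := by
    have h5 := sum_sq_le_add t x
    have h6 : ∑ i, (t i - x i) ^ 2 = ∑ i, (x i - t i) ^ 2 :=
      Finset.sum_congr rfl fun i _ => by ring
    rw [h6, hx1] at h5
    linarith
  have h7 : B * ∑ i, t i ^ 2 ≤ B * (5 / 2) := mul_le_mul_of_nonneg_left h4 hB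
  have h8 : sqForm a x * ∑ i, (x i - t i) ^ 2 ≤ sqForm a x * (1 / 4) :=
    mul_le_mul_of_nonneg_left htx (sqForm_nonneg a x)
  linarith

/-- A lower bound for the form on a fine net, together with an upper bound everywhere, gives a
lower bound everywhere. -/
theorem le_sqForm_of_net {a : κ → ι → ℝ} {m B : ℝ} (hm : 0 ≤ m) {j : ℕ} (hj : 1 ≤ j)
    (hBj : B * (1 / 4) ^ j ≤ m / 64) (hB : 0 ≤ B) {T : Finset (ι → ℝ)}
    (hT : ∀ v : ι → ℝ, ∑ i, v i ^ 2 ≤ 1 → ∃ t ∈ T, ∑ i, (v i - t i) ^ 2 ≤ (1 / 4) ^ j)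
    (hup : ∀ v, sqForm a v ≤ B * ∑ i, v i ^ 2)
    (h : ∀ t ∈ T, m / 4 * ∑ i, t i ^ 2 ≤ sqForm a t) (v : ι → ℝ) :
    m / 64 * ∑ i, v i ^ 2 ≤ sqForm a v := by
  refine le_sqForm_of_unit (fun v hv => ?_) v
  obtain ⟨t, ht, htv⟩ := hT v hv.le
  have h1 := sqForm_le_add a t v
  have h2 := hup fun i => t i - v i
  have h6 : ∑ i, (t i - v i) ^ 2 = ∑ i, (v i - t i) ^ 2 :=
    Finset.sum_congr rfl fun i _ => by ring
  have h3 := h t ht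
  have h4 := sum_sq_le_add v t
  have h5 : ((1 : ℝ) / 4) ^ j ≤ 1 / 4 := by
    simpa using pow_le_pow_of_le_one (by norm_num : (0 : ℝ) ≤ 1 / 4) (by norm_num) hj
  rw [h6] at h2
  have h7 : B * ∑ i, (v i - t i) ^ 2 ≤ m / 64 := (mul_le_mul_of_nonneg_left htv hB).trans hBj
  have h8 : (1 : ℝ) / 4 ≤ ∑ i, t i ^ 2 := by linarith
  have h9 : m / 4 * (1 / 4) ≤ m / 4 * ∑ i, t i ^ 2 := mul_le_mul_of_nonneg_left h8 (by linarith)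
  linarith

theorem measurable_inner_sq {E : Type*} [MeasurableSpace E] {y : E → ι → ℝ}
    (hy : ∀ i, Measurable fun x => y x i) (u : ι → ℝ) :
    Measurable fun x => (∑ i, y x i * u i) ^ 2 :=
  (Finset.measurable_sum _ fun i _ => (hy i).mul_const _).pow_const 2

theorem lintegral_pi_prod {E : Type*} [MeasurableSpace E] (P : κ → Measure E)
    [∀ l, IsProbabilityMeasure (P l)] {f : κ → E → ℝ≥0∞} (hf : ∀ l, Measurable (f l)) :
    ∫⁻ x, ∏ l, f l (x l) ∂(Measure.pi P) = ∏ l, ∫⁻ y, f l y ∂(P l) := by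
  have hind : iIndepFun (fun l (x : κ → E) => f l (x l)) (Measure.pi P) :=
    iIndepFun_pi (X := f) fun l => (hf l).aemeasurable
  have h := lintegral_prod_eq_prod_lintegral_of_indepFun Finset.univ
    (fun l (x : κ → E) => f l (x l)) hind fun l => (hf l).comp (measurable_pi_apply l)
  rw [h]
  refine Finset.prod_congr rfl fun l _ => ?_
  exact (measurePreserving_eval P l).lintegral_comp (hf l)

variable {E : Type*} [MeasurableSpace E] {P : κ → Measure E} [∀ l, IsProbabilityMeasure (P l)]
  {Y : κ → E → ι → ℝ}

/-- Exponential Markov inequality for the form of independent vectors at a fixed unit vector. -/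
theorem measure_exp_sqForm_le (hY : ∀ l i, Measurable fun x => Y l x i) {w : κ → ℝ} (s b : ℝ)
    {u : ι → ℝ}
    (hexp : ∀ l, ∫⁻ x, ENNReal.ofReal (Real.exp (s * (∑ i, Y l x i * u i) ^ 2)) ∂(P l) ≤
      ENNReal.ofReal (Real.exp (w l))) :
    (Measure.pi P) {x | b ≤ s * sqForm (fun l => Y l (x l)) u} ≤
      ENNReal.ofReal (Real.exp (∑ l, w l - b)) := by
  have hmeas : ∀ l, Measurable fun x => ENNReal.ofReal (Real.exp (s * (∑ i, Y l x i * u i) ^ 2)) :=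
    fun l => ((measurable_inner_sq (hY l) u).const_mul s).exp.ennreal_ofReal
  have hprod : ∀ x : κ → E, ENNReal.ofReal (Real.exp (s * sqForm (fun l => Y l (x l)) u)) =
      ∏ l, ENNReal.ofReal (Real.exp (s * (∑ i, Y l (x l) i * u i) ^ 2)) := fun x => by
    rw [← ENNReal.ofReal_prod_of_nonneg fun l _ => (Real.exp_pos _).le, ← Real.exp_sum, sqForm,
      Finset.mul_sum]
  have h1 : ∫⁻ x, ENNReal.ofReal (Real.exp (s * sqForm (fun l => Y l (x l)) u)) ∂(Measure.pi P) ≤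
      ENNReal.ofReal (Real.exp (∑ l, w l)) := by
    simp only [hprod]
    rw [lintegral_pi_prod P hmeas, Real.exp_sum,
      ENNReal.ofReal_prod_of_nonneg fun l _ => (Real.exp_pos _).le]
    exact Finset.prod_le_prod' fun l _ => hexp l
  have h2 := meas_ge_le_lintegral_div (μ := Measure.pi P)
    (f := fun x => ENNReal.ofReal (Real.exp (s * sqForm (fun l => Y l (x l)) u)))
    (ε := ENNReal.ofReal (Real.exp b)) (by
      simp only [hprod]
      exact (Finset.measurable_prod _ fun l _ =>
        (hmeas l).comp (measurable_pi_apply l)).aemeasurable)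
    (by simp [Real.exp_pos]) ENNReal.ofReal_ne_top
  calc (Measure.pi P) {x | b ≤ s * sqForm (fun l => Y l (x l)) u}
      ≤ (Measure.pi P) {x | ENNReal.ofReal (Real.exp b) ≤
          ENNReal.ofReal (Real.exp (s * sqForm (fun l => Y l (x l)) u))} :=
        measure_mono fun x hx => ENNReal.ofReal_le_ofReal (Real.exp_le_exp.2 hx)
    _ ≤ _ := h2
    _ ≤ ENNReal.ofReal (Real.exp (∑ l, w l)) / ENNReal.ofReal (Real.exp b) := by gcongr
    _ = _ := by rw [← ENNReal.ofReal_div_of_pos (Real.exp_pos _), Real.exp_sub]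

theorem measure_biUnion_finset_le_card {α β : Type*} [MeasurableSpace α] (μ : Measure α)
    (T : Finset β) (A : β → Set α) {ε : ℝ≥0∞} (h : ∀ t ∈ T, μ (A t) ≤ ε) :
    μ (⋃ t ∈ T, A t) ≤ T.card * ε := by
  refine (measure_biUnion_finset_le T A).trans ((Finset.sum_le_sum h).trans ?_)
  rw [Finset.sum_const, nsmul_eq_mul]

theorem five_le_exp_two : (5 : ℝ) ≤ Real.exp 2 := by
  have := Real.quadratic_le_exp_of_nonneg (x := 2) (by norm_num)
  linarith

/-- The form of independent vectors with square-exponential moments is bounded above on all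
directions simultaneously. -/
theorem measure_sqForm_gt_le (hY : ∀ l i, Measurable fun x => Y l x i) {w : κ → ℝ} {h : ℝ}
    (hh : 0 < h) (hw : 0 ≤ ∑ l, w l)
    (hexp : ∀ l (u : ι → ℝ), ∑ i, u i ^ 2 = 1 →
      ∫⁻ x, ENNReal.ofReal (Real.exp (h⁻¹ * (∑ i, Y l x i * u i) ^ 2)) ∂(P l) ≤
        ENNReal.ofReal (Real.exp (w l))) {N : ℝ} (hN : Fintype.card ι ≤ N) :
    (Measure.pi P) {x | ∃ u, 10 * (h * (∑ l, w l + 3 * N)) * ∑ i, u i ^ 2 <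
      sqForm (fun l => Y l (x l)) u} ≤ ENNReal.ofReal (Real.exp (-N)) := by
  classical
  obtain ⟨T, hT, hcov⟩ := exists_net_pi ι 1
  simp only [pow_one] at hcov
  have hN0 : 0 ≤ N := le_trans (Nat.cast_nonneg _) hN
  set B := h * (∑ l, w l + 3 * N) with hB
  have hB0 : 0 ≤ B := by positivity
  have hsub : {x : κ → E | ∃ u, 10 * B * ∑ i, u i ^ 2 < sqForm (fun l => Y l (x l)) u} ⊆
      ⋃ t ∈ T, {x | B * ∑ i, t i ^ 2 < sqForm (fun l => Y l (x l)) t} := by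
    rintro x ⟨u, hu⟩
    by_contra hcon
    simp only [Set.mem_iUnion, Set.mem_ofPred_eq, not_exists, not_lt] at hcon
    exact absurd (sqForm_le_of_net hB0 hcov (fun t ht => hcon t ht) u) (not_le.2 hu)
  have hpt : ∀ t ∈ T, (Measure.pi P) {x | B * ∑ i, t i ^ 2 < sqForm (fun l => Y l (x l)) t} ≤
      ENNReal.ofReal (Real.exp (-(3 * N))) := by
    intro t _
    rcases eq_or_ne t 0 with rfl | ht
    · simp [sqForm_zero]
    obtain ⟨c, hc, h1, h2⟩ := exists_unit_smul ht
    refine (measure_mono ?_).trans ((measure_exp_sqForm_le hY (w := w) h⁻¹ (∑ l, w l + 3 * N)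
      (u := fun i => c * t i) fun l => hexp l _ h1).trans (le_of_eq ?_))
    · intro x hx
      have h3 : c ^ 2 * (B * ∑ i, t i ^ 2) ≤ c ^ 2 * sqForm (fun l => Y l (x l)) t :=
        mul_le_mul_of_nonneg_left (le_of_lt hx) (by positivity)
      have h4 : c ^ 2 * (B * ∑ i, t i ^ 2) = B := by
        rw [mul_left_comm, h2, mul_one]
      rw [Set.mem_ofPred_eq, sqForm_smul, ← div_eq_inv_mul, le_div_iff₀ hh]
      linarith
    · congr 2
      ring
  refine (measure_mono hsub).trans ((measure_biUnion_finset_le_card _ T _ hpt).trans ?_)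
  rw [← ENNReal.ofReal_natCast, ← ENNReal.ofReal_mul (Nat.cast_nonneg _)]
  refine ENNReal.ofReal_le_ofReal ?_
  have h5 : (T.card : ℝ) ≤ Real.exp (2 * N) := by
    calc (T.card : ℝ) ≤ 5 ^ Fintype.card ι := by
          rw [one_mul] at hT
          exact_mod_cast hT
      _ ≤ Real.exp 2 ^ Fintype.card ι := pow_le_pow_left₀ (by norm_num) five_le_exp_two _
      _ = Real.exp (2 * Fintype.card ι) := by rw [← Real.exp_nat_mul, mul_comm]
      _ ≤ Real.exp (2 * N) := Real.exp_le_exp.2 (by linarith)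
  calc (T.card : ℝ) * Real.exp (-(3 * N)) ≤ Real.exp (2 * N) * Real.exp (-(3 * N)) := by gcongr
    _ = Real.exp (-N) := by rw [← Real.exp_add]; ring_nf

/-- The form of independent isotropic vectors is bounded below on all directions simultaneously
when the dimension is small compared with the number of vectors. -/
theorem measure_sqForm_lt_le (hY : ∀ l i, Measurable fun x => Y l x i) {K B : ℝ} (hK : 0 < K)
    (hexp : ∀ l (u : ι → ℝ), ∑ i, u i ^ 2 = 1 →
      ∫⁻ x, ENNReal.ofReal (Real.exp (-K⁻¹ * (∑ i, Y l x i * u i) ^ 2)) ∂(P l) ≤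
        ENNReal.ofReal (Real.exp (-(2 * K)⁻¹))) {j : ℕ} (hj : 1 ≤ j) (hB : 0 ≤ B)
    (hBj : B * (1 / 4) ^ j ≤ (Fintype.card κ : ℝ) / 64) :
    (Measure.pi P) {x | (∀ v, sqForm (fun l => Y l (x l)) v ≤ B * ∑ i, v i ^ 2) ∧
      ∃ v, sqForm (fun l => Y l (x l)) v < (Fintype.card κ : ℝ) / 64 * ∑ i, v i ^ 2} ≤
      ENNReal.ofReal (Real.exp (2 * (j * Fintype.card ι) - Fintype.card κ / (4 * K))) := by
  classical
  obtain ⟨T, hT, hcov⟩ := exists_net_pi ι j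
  set m : ℝ := (Fintype.card κ : ℝ) with hm
  have hm0 : 0 ≤ m := Nat.cast_nonneg _
  have hsub : {x : κ → E | (∀ v, sqForm (fun l => Y l (x l)) v ≤ B * ∑ i, v i ^ 2) ∧
      ∃ v, sqForm (fun l => Y l (x l)) v < m / 64 * ∑ i, v i ^ 2} ⊆
      ⋃ t ∈ T, {x | sqForm (fun l => Y l (x l)) t < m / 4 * ∑ i, t i ^ 2} := by
    rintro x ⟨hup, v, hv⟩
    by_contra hcon
    simp only [Set.mem_iUnion, Set.mem_ofPred_eq, not_exists, not_lt] at hcon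
    exact absurd (le_sqForm_of_net hm0 hj hBj hB hcov hup (fun t ht => hcon t ht) v) (not_le.2 hv)
  have hpt : ∀ t ∈ T, (Measure.pi P) {x | sqForm (fun l => Y l (x l)) t < m / 4 * ∑ i, t i ^ 2} ≤
      ENNReal.ofReal (Real.exp (-(m / (4 * K)))) := by
    intro t _
    rcases eq_or_ne t 0 with rfl | ht
    · simp [sqForm_zero]
    obtain ⟨c, hc, h1, h2⟩ := exists_unit_smul ht
    refine (measure_mono ?_).trans ((measure_exp_sqForm_le hY (w := fun _ => -(2 * K)⁻¹) (-K⁻¹)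
      (-(m / (4 * K))) (u := fun i => c * t i) fun l => hexp l _ h1).trans (le_of_eq ?_))
    · intro x hx
      have h3 : c ^ 2 * sqForm (fun l => Y l (x l)) t ≤ c ^ 2 * (m / 4 * ∑ i, t i ^ 2) :=
        mul_le_mul_of_nonneg_left (le_of_lt hx) (by positivity)
      have h4 : c ^ 2 * (m / 4 * ∑ i, t i ^ 2) = m / 4 := by
        rw [mul_left_comm, h2, mul_one]
      have h6 : m / (4 * K) = K⁻¹ * (m / 4) := by field_simp
      rw [Set.mem_ofPred_eq, sqForm_smul, h6, neg_mul, neg_le_neg_iff]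
      exact mul_le_mul_of_nonneg_left (by linarith) (by positivity)
    · rw [Finset.sum_const, Finset.card_univ, nsmul_eq_mul, ← hm]
      congr 2
      field_simp
      ring
  refine (measure_mono hsub).trans ((measure_biUnion_finset_le_card _ T _ hpt).trans ?_)
  rw [← ENNReal.ofReal_natCast, ← ENNReal.ofReal_mul (Nat.cast_nonneg _)]
  refine ENNReal.ofReal_le_ofReal ?_
  have h5 : (T.card : ℝ) ≤ Real.exp (2 * (j * Fintype.card ι)) := by
    calc (T.card : ℝ) ≤ 5 ^ (j * Fintype.card ι) := by exact_mod_cast hT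
      _ ≤ Real.exp 2 ^ (j * Fintype.card ι) := pow_le_pow_left₀ (by norm_num) five_le_exp_two _
      _ = Real.exp (2 * (j * Fintype.card ι)) := by
          rw [← Real.exp_nat_mul]
          push_cast
          ring_nf
  calc (T.card : ℝ) * Real.exp (-(m / (4 * K))) ≤
        Real.exp (2 * (j * Fintype.card ι)) * Real.exp (-(m / (4 * K))) := by gcongr
    _ = _ := by rw [← Real.exp_add]; ring_nf

end Forms

/-! ### Sub-Gaussian variables -/

theorem exp_le_self_add_exp_sq (x : ℝ) : Real.exp x ≤ x + Real.exp (x ^ 2) := by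
  have h1 := Real.add_one_le_exp (x ^ 2)
  rcases le_or_gt |x| 1 with h | h
  · have := (abs_le.1 (Real.abs_exp_sub_one_sub_id_le h)).2
    linarith
  · rcases le_total 0 x with h0 | h0
    · rw [abs_of_nonneg h0] at h
      have : Real.exp x ≤ Real.exp (x ^ 2) := Real.exp_le_exp.2 (by nlinarith)
      linarith
    · rw [abs_of_nonpos h0] at h
      have : Real.exp x ≤ 1 := Real.exp_le_one_iff.2 h0
      nlinarith

theorem exp_mul_le_of_mem_Icc {θ : ℝ} (h0 : 0 ≤ θ) (h1 : θ ≤ 1) (y : ℝ) :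
    Real.exp (θ * y) ≤ 1 - θ + θ * Real.exp y := by
  have h := convexOn_exp.2 (Set.mem_univ (0 : ℝ)) (Set.mem_univ y) (by linarith : 0 ≤ 1 - θ) h0
    (by ring)
  simpa using h

theorem exp_neg_le_quadratic {x : ℝ} (hx : 0 ≤ x) : Real.exp (-x) ≤ 1 - x + x ^ 2 / 2 := by
  have h1 := Real.quadratic_le_exp_of_nonneg hx
  have h2 : Real.exp (-x) * Real.exp x = 1 := by rw [← Real.exp_add]; simp
  have h3 : 0 < 1 + x + x ^ 2 / 2 := by positivity
  have h4 : Real.exp (-x) * (1 + x + x ^ 2 / 2) ≤ 1 :=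
    (mul_le_mul_of_nonneg_left h1 (Real.exp_pos _).le).trans h2.le
  have h5 : 1 ≤ (1 - x + x ^ 2 / 2) * (1 + x + x ^ 2 / 2) := by nlinarith [sq_nonneg (x ^ 2)]
  exact le_of_mul_le_mul_right (h4.trans h5) h3

theorem integrable_of_lintegral_ofReal_le {Ω : Type*} [MeasurableSpace Ω] {μ : Measure Ω}
    {f : Ω → ℝ} (hf : Measurable f) (h0 : ∀ ω, 0 ≤ f ω) {c : ℝ≥0∞} (hc : c ≠ ⊤)
    (h : ∫⁻ ω, ENNReal.ofReal (f ω) ∂μ ≤ c) : Integrable f μ := by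
  refine ⟨hf.aestronglyMeasurable, ?_⟩
  rw [hasFiniteIntegral_iff_ofReal (Eventually.of_forall h0)]
  exact lt_of_le_of_lt h hc.lt_top

theorem integral_le_of_lintegral_ofReal_le {Ω : Type*} [MeasurableSpace Ω] {μ : Measure Ω}
    {f : Ω → ℝ} (hf : Measurable f) (h0 : ∀ ω, 0 ≤ f ω) {c : ℝ} (hc : 0 ≤ c)
    (h : ∫⁻ ω, ENNReal.ofReal (f ω) ∂μ ≤ ENNReal.ofReal c) : ∫ ω, f ω ∂μ ≤ c := by
  rw [integral_eq_lintegral_of_nonneg_ae (Eventually.of_forall h0) hf.aestronglyMeasurable]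
  exact ENNReal.toReal_le_of_le_ofReal hc h

theorem lintegral_ofReal_le_of_integral_le {Ω : Type*} [MeasurableSpace Ω] {μ : Measure Ω}
    {f g : Ω → ℝ} (hg : Integrable g μ) (h0 : ∀ ω, 0 ≤ f ω) (hfg : ∀ ω, f ω ≤ g ω) {c : ℝ}
    (h : ∫ ω, g ω ∂μ ≤ c) : ∫⁻ ω, ENNReal.ofReal (f ω) ∂μ ≤ ENNReal.ofReal c := by
  calc ∫⁻ ω, ENNReal.ofReal (f ω) ∂μ ≤ ∫⁻ ω, ENNReal.ofReal (g ω) ∂μ :=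
        lintegral_mono fun ω => ENNReal.ofReal_le_ofReal (hfg ω)
    _ = ENNReal.ofReal (∫ ω, g ω ∂μ) :=
        (ofReal_integral_eq_lintegral_ofReal hg
          (Eventually.of_forall fun ω => (h0 ω).trans (hfg ω))).symm
    _ ≤ _ := ENNReal.ofReal_le_ofReal h

/-- A law on the line with unit second moment and `𝔼 exp(x² / H²) ≤ 2`. -/
structure IsUnitSubGaussian (H : ℝ) (ρ : Measure ℝ) : Prop where
  pos : 0 < H
  exp_sq : ∫⁻ x, ENNReal.ofReal (Real.exp (x ^ 2 / H ^ 2)) ∂ρ ≤ 2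
  second_moment : ∫ x, x ^ 2 ∂ρ = 1

namespace IsUnitSubGaussian

variable {H : ℝ} {ρ : Measure ℝ}

theorem integrable_exp_sq (h : IsUnitSubGaussian H ρ) :
    Integrable (fun x => Real.exp (x ^ 2 / H ^ 2)) ρ :=
  integrable_of_lintegral_ofReal_le (by fun_prop) (fun _ => (Real.exp_pos _).le)
    ENNReal.ofNat_ne_top h.exp_sq

theorem integral_exp_sq_le (h : IsUnitSubGaussian H ρ) :
    ∫ x, Real.exp (x ^ 2 / H ^ 2) ∂ρ ≤ 2 :=
  integral_le_of_lintegral_ofReal_le (by fun_prop) (fun _ => (Real.exp_pos _).le) two_pos.le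
    (by simpa using h.exp_sq)

theorem pow_four_le (h : IsUnitSubGaussian H ρ) (x : ℝ) :
    x ^ 4 ≤ 2 * H ^ 4 * Real.exp (x ^ 2 / H ^ 2) := by
  have hH := h.pos
  have h1 := Real.quadratic_le_exp_of_nonneg (x := x ^ 2 / H ^ 2) (by positivity)
  have h2 : (x ^ 2 / H ^ 2) ^ 2 / 2 ≤ Real.exp (x ^ 2 / H ^ 2) := by
    have : 0 ≤ x ^ 2 / H ^ 2 := by positivity
    linarith
  calc x ^ 4 = 2 * H ^ 4 * ((x ^ 2 / H ^ 2) ^ 2 / 2) := by field_simp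
    _ ≤ _ := by gcongr

theorem integrable_pow_four (h : IsUnitSubGaussian H ρ) : Integrable (fun x : ℝ => x ^ 4) ρ := by
  refine (h.integrable_exp_sq.const_mul (2 * H ^ 4)).mono' (by fun_prop)
    (Eventually.of_forall fun x => ?_)
  rw [Real.norm_of_nonneg (by positivity)]
  exact h.pow_four_le x

theorem integral_pow_four_le (h : IsUnitSubGaussian H ρ) : ∫ x, x ^ 4 ∂ρ ≤ 4 * H ^ 4 := by
  have h1 : ∫ x, x ^ 4 ∂ρ ≤ ∫ x, 2 * H ^ 4 * Real.exp (x ^ 2 / H ^ 2) ∂ρ :=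
    integral_mono h.integrable_pow_four (h.integrable_exp_sq.const_mul _) h.pow_four_le
  rw [integral_const_mul] at h1
  have h2 : 2 * H ^ 4 * ∫ x, Real.exp (x ^ 2 / H ^ 2) ∂ρ ≤ 2 * H ^ 4 * 2 :=
    mul_le_mul_of_nonneg_left h.integral_exp_sq_le (by positivity)
  linarith

/-- The Laplace transform, without centring. -/
theorem lintegral_exp_mul_le (h : IsUnitSubGaussian H ρ) (s : ℝ) :
    ∫⁻ x, ENNReal.ofReal (Real.exp (s * x)) ∂ρ ≤
      ENNReal.ofReal (2 * Real.exp (s ^ 2 * H ^ 2 / 4)) := by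
  have hH := h.pos
  refine lintegral_ofReal_le_of_integral_le
    (g := fun x => Real.exp (s ^ 2 * H ^ 2 / 4) * Real.exp (x ^ 2 / H ^ 2))
    (h.integrable_exp_sq.const_mul _) (fun _ => (Real.exp_pos _).le) (fun x => ?_) ?_
  · rw [← Real.exp_add, Real.exp_le_exp]
    have h1 : s ^ 2 * H ^ 2 / 4 + x ^ 2 / H ^ 2 - s * x = (s * H / 2 - x / H) ^ 2 := by
      field_simp
      ring
    linarith [sq_nonneg (s * H / 2 - x / H)]
  · rw [integral_const_mul, mul_comm]
    exact mul_le_mul_of_nonneg_right h.integral_exp_sq_le (Real.exp_pos _).le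

variable [IsProbabilityMeasure ρ]

theorem integrable_pow (h : IsUnitSubGaussian H ρ) {c : ℕ} (hc : c ≤ 4) :
    Integrable (fun x : ℝ => x ^ c) ρ := by
  refine (h.integrable_pow_four.add (integrable_const (1 : ℝ))).mono' (by fun_prop)
    (Eventually.of_forall fun x => ?_)
  rw [norm_pow, Real.norm_eq_abs]
  have h4 : x ^ 4 = |x| ^ 4 := by rw [← abs_pow, abs_of_nonneg (by positivity)]
  simp only [Pi.add_apply, h4]
  rcases le_total |x| 1 with h1 | h1
  · have := pow_le_one₀ (abs_nonneg x) h1 (n := c)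
    have := pow_nonneg (abs_nonneg x) 4
    linarith
  · have := pow_le_pow_right₀ h1 hc
    linarith

theorem integrable_id (h : IsUnitSubGaussian H ρ) : Integrable (fun x : ℝ => x) ρ := by
  simpa using h.integrable_pow (c := 1) (by norm_num)

/-- The Laplace transform of a centred variable. For small `s` the bound `eʸ ≤ y + exp(y²)` makes
the linear term disappear. -/
theorem lintegral_exp_mul_le_of_centered (h : IsUnitSubGaussian H ρ) (hc : ∫ x, x ∂ρ = 0) (s : ℝ) :
    ∫⁻ x, ENNReal.ofReal (Real.exp (s * x)) ∂ρ ≤ ENNReal.ofReal (Real.exp (s ^ 2 * H ^ 2)) := by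
  have hH := h.pos
  set θ := s ^ 2 * H ^ 2 with hθ
  have hθ0 : 0 ≤ θ := by positivity
  rcases le_or_gt θ 1 with h1 | h1
  · have hi : Integrable (fun x => 1 - θ + θ * Real.exp (x ^ 2 / H ^ 2)) ρ :=
      (integrable_const _).add (h.integrable_exp_sq.const_mul θ)
    refine lintegral_ofReal_le_of_integral_le ((h.integrable_id.const_mul s).add hi)
      (fun _ => (Real.exp_pos _).le) (fun x => ?_) ?_
    · have h2 := exp_le_self_add_exp_sq (s * x)
      have h3 := exp_mul_le_of_mem_Icc hθ0 h1 (x ^ 2 / H ^ 2)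
      have h4 : (s * x) ^ 2 = θ * (x ^ 2 / H ^ 2) := by rw [hθ]; field_simp
      rw [h4] at h2
      simp only [Pi.add_apply]
      linarith
    · rw [integral_add' (h.integrable_id.const_mul s) hi, integral_const_mul, hc,
        integral_add (integrable_const _) (h.integrable_exp_sq.const_mul θ), integral_const_mul]
      have h2 := mul_le_mul_of_nonneg_left h.integral_exp_sq_le hθ0
      have h3 := Real.add_one_le_exp θ
      simp only [integral_const, probReal_univ, smul_eq_mul]
      linarith
  · refine (h.lintegral_exp_mul_le s).trans (ENNReal.ofReal_le_ofReal ?_)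
    have h2 : 2 ≤ Real.exp (3 * θ / 4) := by
      have := Real.quadratic_le_exp_of_nonneg (x := 3 * θ / 4) (by linarith)
      nlinarith
    calc 2 * Real.exp (θ / 4) ≤ Real.exp (3 * θ / 4) * Real.exp (θ / 4) := by gcongr
      _ = Real.exp θ := by rw [← Real.exp_add]; ring_nf

end IsUnitSubGaussian

theorem lintegral_exp_mul_gaussian (t : ℝ) :
    ∫⁻ g, ENNReal.ofReal (Real.exp (t * g)) ∂(gaussianReal 0 1) =
      ENNReal.ofReal (Real.exp (t ^ 2 / 2)) := by
  rw [← ofReal_integral_eq_lintegral_ofReal (integrable_exp_mul_gaussianReal t)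
    (Eventually.of_forall fun _ => (Real.exp_pos _).le)]
  have := congrFun (mgf_id_gaussianReal (μ := 0) (v := 1)) t
  simp only [mgf, id_eq] at this
  rw [this]
  simp

theorem lintegral_exp_sq_gaussian_le :
    ∫⁻ g, ENNReal.ofReal (Real.exp (g ^ 2 / 4)) ∂(gaussianReal 0 1) ≤ 2 := by
  rw [gaussianReal_of_var_ne_zero 0 one_ne_zero,
    lintegral_withDensity_eq_lintegral_mul _ (measurable_gaussianPDF 0 1) (by fun_prop)]
  have h1 : ∀ g : ℝ, (gaussianPDF 0 1 * fun g => ENNReal.ofReal (Real.exp (g ^ 2 / 4))) g =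
      ENNReal.ofReal ((√(2 * Real.pi))⁻¹ * Real.exp (-(1 / 4) * g ^ 2)) := fun g => by
    simp only [Pi.mul_apply, gaussianPDF, gaussianPDFReal]
    rw [← ENNReal.ofReal_mul (by positivity), mul_assoc, ← Real.exp_add]
    congr 2
    · simp
    · congr 1
      simp
      ring
  simp only [h1]
  rw [← ofReal_integral_eq_lintegral_ofReal
    ((integrable_exp_neg_mul_sq (by norm_num)).const_mul _)
    (Eventually.of_forall fun _ => by positivity), integral_const_mul, integral_gaussian]
  rw [show (2 : ℝ≥0∞) = ENNReal.ofReal 2 by simp]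
  refine ENNReal.ofReal_le_ofReal ?_
  have h2 : √(Real.pi / (1 / 4)) = √2 * √(2 * Real.pi) := by
    rw [← Real.sqrt_mul (by norm_num)]
    congr 1
    ring
  have h3 : √(2 * Real.pi) ≠ 0 := by positivity
  rw [h2, mul_comm (√2), ← mul_assoc, inv_mul_cancel₀ h3, one_mul]
  have : √2 ≤ √4 := Real.sqrt_le_sqrt (by norm_num)
  rwa [show (4 : ℝ) = 2 ^ 2 by norm_num, Real.sqrt_sq (by norm_num)] at this

section Laplace

variable {Ω : Type*} [MeasurableSpace Ω] {P : Measure Ω} [IsProbabilityMeasure P] {Y : Ω → ℝ}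

/-- Square-exponential moments from the Laplace transform: `exp(y² / (8H²))` is the average of
`exp(g y / (2H))` over a standard Gaussian `g`. -/
theorem lintegral_exp_sq_le_of_laplace (hY : Measurable Y) {H : ℝ} (hH : 0 < H)
    (h : ∀ s : ℝ, ∫⁻ ω, ENNReal.ofReal (Real.exp (s * Y ω)) ∂P ≤
      ENNReal.ofReal (Real.exp (s ^ 2 * H ^ 2))) :
    ∫⁻ ω, ENNReal.ofReal (Real.exp (Y ω ^ 2 / (8 * H ^ 2))) ∂P ≤ 2 := by
  calc ∫⁻ ω, ENNReal.ofReal (Real.exp (Y ω ^ 2 / (8 * H ^ 2))) ∂P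
      = ∫⁻ ω, ∫⁻ g, ENNReal.ofReal (Real.exp (Y ω / (2 * H) * g)) ∂(gaussianReal 0 1) ∂P := by
        refine lintegral_congr fun ω => ?_
        rw [lintegral_exp_mul_gaussian]
        congr 2
        field_simp
        norm_num
    _ = ∫⁻ g, ∫⁻ ω, ENNReal.ofReal (Real.exp (Y ω / (2 * H) * g)) ∂P ∂(gaussianReal 0 1) := by
        refine lintegral_lintegral_swap (Measurable.aemeasurable ?_)
        have : Measurable fun z : Ω × ℝ => Y z.1 / (2 * H) * z.2 :=
          ((hY.comp measurable_fst).div_const _).mul measurable_snd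
        exact this.exp.ennreal_ofReal
    _ ≤ ∫⁻ g, ENNReal.ofReal (Real.exp (g ^ 2 / 4)) ∂(gaussianReal 0 1) := by
        refine lintegral_mono fun g => ?_
        have h1 := h (g / (2 * H))
        have h2 : (g / (2 * H)) ^ 2 * H ^ 2 = g ^ 2 / 4 := by field_simp; norm_num
        rw [h2] at h1
        refine le_trans (le_of_eq ?_) h1
        refine lintegral_congr fun ω => ?_
        congr 2
        ring
    _ ≤ 2 := lintegral_exp_sq_gaussian_le

theorem lintegral_exp_mul_sq_le_of_laplace (hY : Measurable Y) {H : ℝ} (hH : 0 < H)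
    (h : ∀ s : ℝ, ∫⁻ ω, ENNReal.ofReal (Real.exp (s * Y ω)) ∂P ≤
      ENNReal.ofReal (Real.exp (s ^ 2 * H ^ 2))) {w : ℝ} (hw0 : 0 ≤ w) (hw1 : w ≤ 1) :
    ∫⁻ ω, ENNReal.ofReal (Real.exp (w * (Y ω ^ 2 / (8 * H ^ 2)))) ∂P ≤
      ENNReal.ofReal (Real.exp w) := by
  have h2 := lintegral_exp_sq_le_of_laplace hY hH h
  have hm : Measurable fun ω => Real.exp (Y ω ^ 2 / (8 * H ^ 2)) :=
    ((hY.pow_const 2).div_const _).exp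
  have hi : Integrable (fun ω => Real.exp (Y ω ^ 2 / (8 * H ^ 2))) P :=
    integrable_of_lintegral_ofReal_le hm (fun _ => (Real.exp_pos _).le) ENNReal.ofNat_ne_top h2
  have hle : ∫ ω, Real.exp (Y ω ^ 2 / (8 * H ^ 2)) ∂P ≤ 2 :=
    integral_le_of_lintegral_ofReal_le hm (fun _ => (Real.exp_pos _).le) two_pos.le
      (by simpa using h2)
  refine lintegral_ofReal_le_of_integral_le
    (g := fun ω => 1 - w + w * Real.exp (Y ω ^ 2 / (8 * H ^ 2)))
    ((integrable_const _).add (hi.const_mul w)) (fun _ => (Real.exp_pos _).le)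
    (fun ω => exp_mul_le_of_mem_Icc hw0 hw1 _) ?_
  rw [integral_add (integrable_const _) (hi.const_mul w), integral_const_mul]
  simp only [integral_const, probReal_univ, smul_eq_mul]
  have h3 := mul_le_mul_of_nonneg_left hle hw0
  have h4 := Real.add_one_le_exp w
  linarith

theorem pow_four_le_exp_add (y : ℝ) : y ^ 4 ≤ 24 * (Real.exp y + Real.exp (-y)) := by
  have h1 := Real.pow_div_factorial_le_exp |y| (abs_nonneg y) 4
  have h2 : |y| ^ 4 = y ^ 4 := by rw [← abs_pow, abs_of_nonneg (by positivity)]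
  have h3 : Real.exp |y| ≤ Real.exp y + Real.exp (-y) := by
    rcases abs_choice y with h | h <;> rw [h]
    · linarith [Real.exp_pos (-y)]
    · linarith [Real.exp_pos y]
  rw [h2, show (Nat.factorial 4 : ℝ) = 24 by norm_num [Nat.factorial]] at h1
  linarith

/-- A variable with unit second moment and Gaussian Laplace transform is not concentrated near
zero, as its fourth moment is bounded. -/
theorem lintegral_exp_neg_sq_le_of_laplace (hY : Measurable Y) {H : ℝ} (hH : 0 < H)
    (hY2 : Integrable (fun ω => Y ω ^ 2) P) (hY1 : ∫ ω, Y ω ^ 2 ∂P = 1)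
    (h : ∀ s : ℝ, ∫⁻ ω, ENNReal.ofReal (Real.exp (s * Y ω)) ∂P ≤
      ENNReal.ofReal (2 * Real.exp (s ^ 2 * H ^ 2))) :
    ∫⁻ ω, ENNReal.ofReal (Real.exp (-(288 * H ^ 4)⁻¹ * Y ω ^ 2)) ∂P ≤
      ENNReal.ofReal (Real.exp (-(2 * (288 * H ^ 4))⁻¹)) := by
  obtain ⟨K, hK⟩ : ∃ K, K = 288 * H ^ 4 := ⟨_, rfl⟩
  have hK0 : 0 < K := by rw [hK]; positivity
  have he : ∀ s : ℝ, s ^ 2 * H ^ 2 = 1 → Integrable (fun ω => Real.exp (s * Y ω)) P ∧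
      ∫ ω, Real.exp (s * Y ω) ∂P ≤ 6 := fun s hs => by
    have h1 := h s
    rw [hs] at h1
    have hm : Measurable fun ω => Real.exp (s * Y ω) := (hY.const_mul s).exp
    refine ⟨integrable_of_lintegral_ofReal_le hm (fun _ => (Real.exp_pos _).le)
      ENNReal.ofReal_ne_top h1, (integral_le_of_lintegral_ofReal_le hm
        (fun _ => (Real.exp_pos _).le) (by positivity) h1).trans ?_⟩
    have := Real.exp_one_lt_d9
    linarith
  obtain ⟨i1, b1⟩ := he H⁻¹ (by field_simp)
  obtain ⟨i2, b2⟩ := he (-H⁻¹) (by field_simp)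
  have hpt : ∀ ω, Y ω ^ 4 ≤
      24 * H ^ 4 * (Real.exp (H⁻¹ * Y ω) + Real.exp (-H⁻¹ * Y ω)) := fun ω => by
    have h1 := pow_four_le_exp_add (H⁻¹ * Y ω)
    calc Y ω ^ 4 = H ^ 4 * (H⁻¹ * Y ω) ^ 4 := by field_simp
      _ ≤ H ^ 4 * (24 * (Real.exp (H⁻¹ * Y ω) + Real.exp (-(H⁻¹ * Y ω)))) := by gcongr
      _ = _ := by rw [neg_mul]; ring
  have i3 := (i1.add i2).const_mul (24 * H ^ 4)
  have i4 : Integrable (fun ω => Y ω ^ 4) P := by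
    refine i3.mono' (hY.pow_const 4).aestronglyMeasurable (Eventually.of_forall fun ω => ?_)
    rw [Real.norm_of_nonneg (by positivity)]
    exact hpt ω
  have b4 : ∫ ω, Y ω ^ 4 ∂P ≤ K := by
    refine (integral_mono i4 i3 hpt).trans ?_
    simp only [Pi.add_apply]
    rw [integral_const_mul, integral_add i1 i2, hK]
    have h1 : (24 * H ^ 4) * (∫ ω, Real.exp (H⁻¹ * Y ω) ∂P + ∫ ω, Real.exp (-H⁻¹ * Y ω) ∂P) ≤
        24 * H ^ 4 * (6 + 6) := by gcongr
    linarith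
  rw [← hK]
  have i5 : Integrable (fun ω => 1 - K⁻¹ * Y ω ^ 2) P :=
    (integrable_const _).sub (hY2.const_mul _)
  refine lintegral_ofReal_le_of_integral_le (i5.add (i4.const_mul (K⁻¹ ^ 2 / 2)))
    (fun _ => (Real.exp_pos _).le) (fun ω => ?_) ?_
  · have h1 := exp_neg_le_quadratic (x := K⁻¹ * Y ω ^ 2) (by positivity)
    rw [neg_mul]
    refine h1.trans (le_of_eq ?_)
    simp only [Pi.add_apply]
    ring
  · rw [integral_add' i5 (i4.const_mul _),
      integral_sub (integrable_const _) (hY2.const_mul _), integral_const_mul, integral_const_mul,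
      hY1]
    simp only [integral_const, probReal_univ, smul_eq_mul]
    have h1 : K⁻¹ ^ 2 / 2 * ∫ ω, Y ω ^ 4 ∂P ≤ K⁻¹ ^ 2 / 2 * K := by gcongr
    have h2 : K⁻¹ ^ 2 / 2 * K = (2 * K)⁻¹ := by field_simp
    have h3 : K⁻¹ = 2 * (2 * K)⁻¹ := by field_simp
    have h4 := Real.one_sub_le_exp_neg (2 * K)⁻¹
    linarith

end Laplace

section Product

variable {ι : Type*} [Fintype ι] {ρ : ι → Measure ℝ} [∀ i, IsProbabilityMeasure (ρ i)] {H : ℝ}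

theorem measurable_inner_pi (u : ι → ℝ) : Measurable fun z : ι → ℝ => ∑ i, z i * u i :=
  Finset.measurable_sum _ fun i _ => (measurable_pi_apply i).mul_const _

theorem lintegral_exp_inner_le {c : ι → ℝ} (hc : ∀ i, 0 ≤ c i)
    (h : ∀ i (s : ℝ), ∫⁻ x, ENNReal.ofReal (Real.exp (s * x)) ∂(ρ i) ≤
      ENNReal.ofReal (c i * Real.exp (s ^ 2 * H ^ 2))) {u : ι → ℝ} (hu : ∑ i, u i ^ 2 = 1)
    (s : ℝ) :
    ∫⁻ z, ENNReal.ofReal (Real.exp (s * ∑ i, z i * u i)) ∂(Measure.pi ρ) ≤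
      ENNReal.ofReal ((∏ i, c i) * Real.exp (s ^ 2 * H ^ 2)) := by
  have h1 : ∀ z : ι → ℝ, ENNReal.ofReal (Real.exp (s * ∑ i, z i * u i)) =
      ∏ i, ENNReal.ofReal (Real.exp (s * u i * z i)) := fun z => by
    rw [← ENNReal.ofReal_prod_of_nonneg fun _ _ => (Real.exp_pos _).le, ← Real.exp_sum,
      Finset.mul_sum]
    congr 2
    exact Finset.sum_congr rfl fun i _ => by ring
  simp only [h1]
  rw [lintegral_pi_prod ρ (f := fun i x => ENNReal.ofReal (Real.exp (s * u i * x)))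
    fun i => by fun_prop]
  refine (Finset.prod_le_prod' fun i _ => h i (s * u i)).trans (le_of_eq ?_)
  rw [← ENNReal.ofReal_prod_of_nonneg fun i _ => mul_nonneg (hc i) (Real.exp_pos _).le,
    Finset.prod_mul_distrib, ← Real.exp_sum]
  congr 3
  simp only [mul_pow]
  rw [← Finset.sum_mul, ← Finset.mul_sum, hu, mul_one]

theorem lintegral_exp_inner_le_of_centered (hρ : ∀ i, IsUnitSubGaussian H (ρ i))
    (hc : ∀ i, ∫ x, x ∂(ρ i) = 0) {u : ι → ℝ} (hu : ∑ i, u i ^ 2 = 1) (s : ℝ) :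
    ∫⁻ z, ENNReal.ofReal (Real.exp (s * ∑ i, z i * u i)) ∂(Measure.pi ρ) ≤
      ENNReal.ofReal (Real.exp (s ^ 2 * H ^ 2)) := by
  have := lintegral_exp_inner_le (ρ := ρ) (c := fun _ => 1) (fun _ => one_pos.le)
    (fun i s => by simpa using (hρ i).lintegral_exp_mul_le_of_centered (hc i) s) hu s
  simpa using this

theorem lintegral_exp_inner_le_two (hρ : ∀ i, IsUnitSubGaussian H (ρ i))
    (hc : ∀ i j, i ≠ j → (∫ x, x ∂(ρ i)) * ∫ x, x ∂(ρ j) = 0) {u : ι → ℝ}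
    (hu : ∑ i, u i ^ 2 = 1) (s : ℝ) :
    ∫⁻ z, ENNReal.ofReal (Real.exp (s * ∑ i, z i * u i)) ∂(Measure.pi ρ) ≤
      ENNReal.ofReal (2 * Real.exp (s ^ 2 * H ^ 2)) := by
  classical
  let c : ι → ℝ := fun i => if ∫ x, x ∂(ρ i) = 0 then 1 else 2
  have hc0 : ∀ i, 0 ≤ c i := fun i => by simp only [c]; split_ifs <;> norm_num
  have hprod : ∏ i, c i ≤ 2 := by
    by_cases hall : ∀ i, ∫ x, x ∂(ρ i) = 0
    · simp [c, hall]
    · push Not at hall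
      obtain ⟨i₀, hi₀⟩ := hall
      rw [Finset.prod_eq_single i₀ (fun j _ hj => if_pos ?_) (by simp)]
      · simp [hi₀]
      · exact (mul_eq_zero.1 (hc j i₀ hj)).resolve_right hi₀
  refine (lintegral_exp_inner_le (ρ := ρ) (H := H) hc0 (fun i s => ?_) hu s).trans
    (ENNReal.ofReal_le_ofReal (mul_le_mul_of_nonneg_right hprod (Real.exp_pos _).le))
  by_cases hi : ∫ x, x ∂(ρ i) = 0
  · simpa [c, hi] using (hρ i).lintegral_exp_mul_le_of_centered hi s
  · simp only [c, hi, if_false]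
    refine ((hρ i).lintegral_exp_mul_le s).trans (ENNReal.ofReal_le_ofReal ?_)
    have : 0 ≤ s ^ 2 * H ^ 2 := by positivity
    gcongr
    linarith

theorem memLp_two_eval_pi (hρ : ∀ i, IsUnitSubGaussian H (ρ i)) (i : ι) :
    MemLp (fun z : ι → ℝ => z i) 2 (Measure.pi ρ) := by
  refine (memLp_two_iff_integrable_sq (measurable_pi_apply i).aestronglyMeasurable).2 ?_
  exact (measurePreserving_eval ρ i).integrable_comp_of_integrable
    ((hρ i).integrable_pow (c := 2) (by norm_num))

theorem integral_eval_mul_eval_pi [DecidableEq ι] (hρ : ∀ i, IsUnitSubGaussian H (ρ i))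
    (hc : ∀ i j, i ≠ j → (∫ x, x ∂(ρ i)) * ∫ x, x ∂(ρ j) = 0) (i j : ι) :
    ∫ z, z i * z j ∂(Measure.pi ρ) = if i = j then 1 else 0 := by
  split_ifs with hij
  · subst hij
    simp only [← sq]
    rw [← (hρ i).second_moment]
    exact integral_comp_eval (μ := ρ) (i := i) (f := fun x : ℝ => x ^ 2)
      (by fun_prop)
  · have hind : IndepFun (fun z : ι → ℝ => z i) (fun z => z j) (Measure.pi ρ) :=
      (iIndepFun_pi (X := fun _ x => x) fun i => (measurable_id).aemeasurable).indepFun hij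
    rw [hind.integral_fun_mul_eq_mul_integral (measurable_pi_apply i).aestronglyMeasurable
      (measurable_pi_apply j).aestronglyMeasurable, ← hc i j hij]
    congr 1
    · exact integral_comp_eval (μ := ρ) (i := i) (f := fun x : ℝ => x) (by fun_prop)
    · exact integral_comp_eval (μ := ρ) (i := j) (f := fun x : ℝ => x) (by fun_prop)

theorem integrable_inner_sq (hρ : ∀ i, IsUnitSubGaussian H (ρ i)) (u : ι → ℝ) :
    Integrable (fun z : ι → ℝ => (∑ i, z i * u i) ^ 2) (Measure.pi ρ) := by
  have : MemLp (fun z : ι → ℝ => ∑ i, z i * u i) 2 (Measure.pi ρ) :=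
    memLp_finsetSum _ fun i _ => (memLp_two_eval_pi hρ i).mul_const (u i)
  exact this.integrable_sq

theorem integral_inner_sq (hρ : ∀ i, IsUnitSubGaussian H (ρ i))
    (hc : ∀ i j, i ≠ j → (∫ x, x ∂(ρ i)) * ∫ x, x ∂(ρ j) = 0) (u : ι → ℝ) :
    ∫ z, (∑ i, z i * u i) ^ 2 ∂(Measure.pi ρ) = ∑ i, u i ^ 2 := by
  classical
  have hint : ∀ i j, Integrable (fun z : ι → ℝ => z i * z j) (Measure.pi ρ) := fun i j =>
    (memLp_two_eval_pi hρ i).integrable_mul (memLp_two_eval_pi hρ j)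
  have h1 : ∀ z : ι → ℝ, (∑ i, z i * u i) ^ 2 = ∑ i, ∑ j, u i * u j * (z i * z j) := fun z => by
    rw [sq, Finset.sum_mul_sum]
    exact Finset.sum_congr rfl fun i _ => Finset.sum_congr rfl fun j _ => by ring
  simp only [h1]
  rw [integral_finsetSum _ fun i _ => integrable_finsetSum _ fun j _ => (hint i j).const_mul _]
  refine Finset.sum_congr rfl fun i _ => ?_
  rw [integral_finsetSum _ fun j _ => (hint i j).const_mul _]
  simp only [integral_const_mul, integral_eval_mul_eval_pi hρ hc]
  simp [sq]

/-- Independent sub-Gaussian coordinates, at most one of them not centred, satisfy the small-ball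
condition of `measure_sqForm_lt_le`. -/
theorem lintegral_exp_neg_inner_sq_le (hρ : ∀ i, IsUnitSubGaussian H (ρ i)) (hH : 0 < H)
    (hc : ∀ i j, i ≠ j → (∫ x, x ∂(ρ i)) * ∫ x, x ∂(ρ j) = 0) {u : ι → ℝ}
    (hu : ∑ i, u i ^ 2 = 1) :
    ∫⁻ z, ENNReal.ofReal (Real.exp (-(288 * H ^ 4)⁻¹ * (∑ i, z i * u i) ^ 2)) ∂(Measure.pi ρ) ≤
      ENNReal.ofReal (Real.exp (-(2 * (288 * H ^ 4))⁻¹)) :=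
  lintegral_exp_neg_sq_le_of_laplace (measurable_inner_pi u) hH (integrable_inner_sq hρ u)
    ((integral_inner_sq hρ hc u).trans hu) (lintegral_exp_inner_le_two hρ hc hu)

end Product

/-! ### Products of quadratic forms of independent variables -/

theorem form_mul_form_eq_sum {ι : Type*} [Fintype ι] (A B : Matrix ι ι ℝ) (z : ι → ℝ) :
    (z ⬝ᵥ A *ᵥ z) * (z ⬝ᵥ B *ᵥ z) =
      ∑ i, ∑ j, ∑ k, ∑ l, A i j * B k l * (z i * z j * z k * z l) := by
  have h1 : ∀ C : Matrix ι ι ℝ, z ⬝ᵥ C *ᵥ z = ∑ i, ∑ j, C i j * (z i * z j) := fun C => by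
    simp only [dotProduct, Matrix.mulVec, Finset.mul_sum]
    exact Finset.sum_congr rfl fun i _ => Finset.sum_congr rfl fun j _ => by ring
  rw [h1 A, h1 B, Finset.sum_mul]
  refine Finset.sum_congr rfl fun i _ => ?_
  rw [Finset.sum_mul]
  refine Finset.sum_congr rfl fun j _ => ?_
  rw [Finset.mul_sum]
  refine Finset.sum_congr rfl fun k _ => ?_
  rw [Finset.mul_sum]
  exact Finset.sum_congr rfl fun l _ => by ring

section FourthMoment

variable {ι : Type*} [Fintype ι] [DecidableEq ι] {ρ : Measure ℝ} [IsProbabilityMeasure ρ] {H : ℝ}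

theorem prod_four_eq_prod_pow (z : ι → ℝ) (i j k l : ι) :
    z i * z j * z k * z l = ∏ a, z a ^ ((if a = i then 1 else 0) + (if a = j then 1 else 0) +
      (if a = k then 1 else 0) + (if a = l then 1 else 0)) := by
  simp only [pow_add, Finset.prod_mul_distrib, pow_ite, pow_one, pow_zero, Finset.prod_ite_eq',
    Finset.mem_univ, if_true]

/-- Mixed fourth moments of independent centred variables of unit variance. -/
theorem integral_four (h : IsUnitSubGaussian H ρ) (hc : ∫ x, x ∂ρ = 0) (i j k l : ι) :
    ∫ z, z i * z j * z k * z l ∂(Measure.pi fun _ : ι => ρ) =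
      (if i = j ∧ k = l then 1 else 0) + (if i = k ∧ j = l then 1 else 0) +
        (if i = l ∧ j = k then 1 else 0) +
        (if i = j ∧ j = k ∧ k = l then ∫ x, x ^ 4 ∂ρ - 3 else 0) := by
  have key : ∀ i j k l : ι, ∫ z, z i * z j * z k * z l ∂(Measure.pi fun _ : ι => ρ) =
      ∏ a, ∫ x, x ^ ((if a = i then 1 else 0) + (if a = j then 1 else 0) +
        (if a = k then 1 else 0) + (if a = l then 1 else 0)) ∂ρ := fun i j k l => by
    simp only [prod_four_eq_prod_pow]
    exact integral_fintype_prod_eq_prod (μ := fun _ : ι => ρ) fun a (x : ℝ) =>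
      x ^ ((if a = i then 1 else 0) + (if a = j then 1 else 0) +
        (if a = k then 1 else 0) + (if a = l then 1 else 0))
  -- an index that occurs only once makes the moment vanish
  have hiso : ∀ i j k l : ι, i ≠ j → i ≠ k → i ≠ l →
      ∫ z, z i * z j * z k * z l ∂(Measure.pi fun _ : ι => ρ) = 0 := fun i j k l h1 h2 h3 => by
    rw [key]
    exact Finset.prod_eq_zero (Finset.mem_univ i) (by simp [h1, h2, h3, hc])
  have hpair : ∀ i k : ι, i ≠ k →
      ∫ z, z i * z i * z k * z k ∂(Measure.pi fun _ : ι => ρ) = 1 := fun i k h1 => by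
    rw [key]
    refine Finset.prod_eq_one fun a _ => ?_
    by_cases ha : a = i
    · subst ha
      simp [h1, h.second_moment]
    · by_cases ha' : a = k
      · subst ha'
        simp [ha, h.second_moment]
      · simp [ha, ha']
  have hall : ∀ i : ι, ∫ z, z i * z i * z i * z i ∂(Measure.pi fun _ : ι => ρ) =
      ∫ x, x ^ 4 ∂ρ := fun i => by
    rw [key, Finset.prod_eq_single i (fun a _ ha => by simp [ha]) (by simp)]
    simp
  have hcomm : ∀ {f g : (ι → ℝ) → ℝ}, (∀ z, f z = g z) →
      ∫ z, f z ∂(Measure.pi fun _ : ι => ρ) = ∫ z, g z ∂(Measure.pi fun _ : ι => ρ) :=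
    fun hfg => integral_congr_ae (Eventually.of_forall hfg)
  by_cases hij : i = j
  · subst hij
    by_cases hkl : k = l
    · subst hkl
      by_cases hik : i = k
      · subst hik
        rw [hall]
        simp
        ring
      · rw [hpair i k hik]
        simp [hik]
    · by_cases hik : i = k
      · subst hik
        have := hiso l i i i (Ne.symm hkl) (Ne.symm hkl) (Ne.symm hkl)
        rw [hcomm (g := fun z => z l * z i * z i * z i) fun z => by ring, this]
        simp [hkl]
      · have := hiso k i i l (Ne.symm hik) (Ne.symm hik) hkl
        rw [hcomm (g := fun z => z k * z i * z i * z l) fun z => by ring, this]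
        simp [hkl, hik]
  · by_cases hik : i = k
    · subst hik
      by_cases hjl : j = l
      · subst hjl
        rw [hcomm (g := fun z => z i * z i * z j * z j) fun z => by ring, hpair i j hij]
        simp [hij]
      · have := hiso j i i l (Ne.symm hij) (Ne.symm hij) hjl
        rw [hcomm (g := fun z => z j * z i * z i * z l) fun z => by ring, this]
        simp [hij, hjl, Ne.symm hij]
    · by_cases hil : i = l
      · subst hil
        by_cases hjk : j = k
        · subst hjk
          rw [hcomm (g := fun z => z i * z i * z j * z j) fun z => by ring, hpair i j hij]
          simp [hij]
        · have := hiso j i i k (Ne.symm hij) (Ne.symm hij) hjk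
          rw [hcomm (g := fun z => z j * z i * z i * z k) fun z => by ring, this]
          simp [hij, hik, hjk]
      · rw [hiso i j k l hij hik hil]
        simp [hij, hik, hil]

theorem integrable_four (h : IsUnitSubGaussian H ρ) (i j k l : ι) :
    Integrable (fun z : ι → ℝ => z i * z j * z k * z l) (Measure.pi fun _ : ι => ρ) := by
  simp only [prod_four_eq_prod_pow]
  refine Integrable.fintype_prod (μ := fun _ : ι => ρ) (f := fun a (x : ℝ) =>
      x ^ ((if a = i then 1 else 0) + (if a = j then 1 else 0) +
        (if a = k then 1 else 0) + (if a = l then 1 else 0))) fun a => h.integrable_pow ?_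
  split_ifs <;> norm_num

theorem integrable_form_mul_form (h : IsUnitSubGaussian H ρ) (A B : Matrix ι ι ℝ) :
    Integrable (fun z : ι → ℝ => (z ⬝ᵥ A *ᵥ z) * (z ⬝ᵥ B *ᵥ z)) (Measure.pi fun _ : ι => ρ) := by
  simp only [form_mul_form_eq_sum]
  exact integrable_finsetSum _ fun i _ => integrable_finsetSum _ fun j _ =>
    integrable_finsetSum _ fun k _ => integrable_finsetSum _ fun l _ =>
      (integrable_four h i j k l).const_mul _

theorem integral_form_mul_form (h : IsUnitSubGaussian H ρ) (hc : ∫ x, x ∂ρ = 0)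
    (A B : Matrix ι ι ℝ) :
    ∫ z, (z ⬝ᵥ A *ᵥ z) * (z ⬝ᵥ B *ᵥ z) ∂(Measure.pi fun _ : ι => ρ) =
      A.trace * B.trace + ∑ i, ∑ j, A i j * B i j + ∑ i, ∑ j, A i j * B j i +
        (∫ x, x ^ 4 ∂ρ - 3) * ∑ i, A i i * B i i := by
  have hi := fun i j k l => (integrable_four h i j k l).const_mul (A i j * B k l)
  simp only [form_mul_form_eq_sum]
  rw [integral_finsetSum _ fun i _ => integrable_finsetSum _ fun j _ =>
    integrable_finsetSum _ fun k _ => integrable_finsetSum _ fun l _ => hi i j k l]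
  have h1 : ∀ i, ∫ z, ∑ j, ∑ k, ∑ l, A i j * B k l * (z i * z j * z k * z l)
      ∂(Measure.pi fun _ : ι => ρ) = A i i * B.trace + ∑ j, A i j * B i j + ∑ j, A i j * B j i +
        (∫ x, x ^ 4 ∂ρ - 3) * (A i i * B i i) := fun i => by
    rw [integral_finsetSum _ fun j _ => integrable_finsetSum _ fun k _ =>
      integrable_finsetSum _ fun l _ => hi i j k l]
    have h2 : ∀ j, ∫ z, ∑ k, ∑ l, A i j * B k l * (z i * z j * z k * z l)
        ∂(Measure.pi fun _ : ι => ρ) = (if i = j then A i j * B.trace else 0) + A i j * B i j +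
          A i j * B j i + (if i = j then (∫ x, x ^ 4 ∂ρ - 3) * (A i j * B j j) else 0) :=
        fun j => by
      rw [integral_finsetSum _ fun k _ => integrable_finsetSum _ fun l _ => hi i j k l]
      have h3 : ∀ k, ∫ z, ∑ l, A i j * B k l * (z i * z j * z k * z l)
          ∂(Measure.pi fun _ : ι => ρ) = (if i = j then A i j * B k k else 0) +
            (if i = k then A i j * B k j else 0) + (if j = k then A i j * B k i else 0) +
            (if i = j ∧ j = k then (∫ x, x ^ 4 ∂ρ - 3) * (A i j * B k k) else 0) := fun k => by
        rw [integral_finsetSum _ fun l _ => hi i j k l]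
        simp only [integral_const_mul, integral_four h hc, mul_add, Finset.sum_add_distrib]
        congr 1
        · congr 1
          · congr 1
            · by_cases hij : i = j <;> simp [hij]
            · by_cases hik : i = k <;> simp [hik]
          · by_cases hjk : j = k <;> simp [hjk]
        · by_cases hij : i = j
          · by_cases hjk : j = k <;> simp [hij, hjk, mul_comm]
          · simp [hij]
      simp only [h3, Finset.sum_add_distrib]
      congr 1
      · congr 1
        · congr 1
          · by_cases hij : i = j <;> simp [hij, Matrix.trace, Finset.mul_sum]
          · simp
        · simp
      · by_cases hij : i = j <;> simp [hij]
    simp only [h2, Finset.sum_add_distrib]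
    simp
  simp only [h1, Finset.sum_add_distrib]
  rw [← Finset.sum_mul, ← Finset.mul_sum]
  rfl

end FourthMoment

/-! ### The moving barrier for the trace of the resolvent -/

section Barrier

variable {ι : Type*} [Fintype ι] [DecidableEq ι]

/-- The trace of the resolvent `(W + u)⁻¹`. -/
def resolventTrace (W : Matrix ι ι ℝ) (u : ℝ) : ℝ := ((u • (1 : Matrix ι ι ℝ) + W)⁻¹).trace

theorem exists_spectral_resolvent {W : Matrix ι ι ℝ} (hW : W.PosSemidef) :
    ∃ (U : Matrix ι ι ℝ) (d : ι → ℝ), (∀ i, 0 ≤ d i) ∧ Uᵀ * U = 1 ∧ U * Uᵀ = 1 ∧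
      W = U * Matrix.diagonal d * Uᵀ ∧
      ∀ u : ℝ, 0 < u → (u • (1 : Matrix ι ι ℝ) + W)⁻¹ =
        U * Matrix.diagonal (fun i => (u + d i)⁻¹) * Uᵀ := by
  obtain ⟨U, d, hd, hU, hU', hWd⟩ := exists_spectral hW
  refine ⟨U, d, hd, hU, hU', hWd, fun u hu => Matrix.inv_eq_right_inv ?_⟩
  have h1 : u • (1 : Matrix ι ι ℝ) + W = U * Matrix.diagonal (fun i => u + d i) * Uᵀ := by
    have : Matrix.diagonal (fun i => u + d i) = u • (1 : Matrix ι ι ℝ) + Matrix.diagonal d := by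
      rw [← Matrix.diagonal_one, ← Matrix.diagonal_smul, Matrix.diagonal_add]
      simp
    rw [this, mul_add, add_mul, ← hWd, mul_smul_comm, mul_one, smul_mul_assoc, hU']
  rw [h1]
  calc U * Matrix.diagonal (fun i => u + d i) * Uᵀ *
        (U * Matrix.diagonal (fun i => (u + d i)⁻¹) * Uᵀ)
      = U * (Matrix.diagonal (fun i => u + d i) * (Uᵀ * U) *
          Matrix.diagonal (fun i => (u + d i)⁻¹)) * Uᵀ := by simp only [mul_assoc]
    _ = 1 := by
        rw [hU, mul_one, Matrix.diagonal_mul_diagonal]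
        have : (fun i => (u + d i) * (u + d i)⁻¹) = fun _ => (1 : ℝ) := by
          ext i
          exact mul_inv_cancel₀ (by linarith [hd i])
        rw [this, Matrix.diagonal_one, mul_one, hU']

/-- Moving the barrier by `s` increases the trace of the resolvent by at most `s tr N²`. -/
theorem resolventTrace_shift_le {W : Matrix ι ι ℝ} (hW : W.PosSemidef) {u s : ℝ} (hu : 0 < u)
    (hs : 0 ≤ s) :
    resolventTrace W u ≤ resolventTrace W (u + s) +
      s * (((u • (1 : Matrix ι ι ℝ) + W)⁻¹) ^ 2).trace := by
  obtain ⟨U, d, hd, hU, hU', -, hinv⟩ := exists_spectral_resolvent hW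
  rw [resolventTrace, resolventTrace, hinv u hu, hinv (u + s) (by linarith), spectral_pow hU hU',
    spectral_trace hU, spectral_trace hU, spectral_trace hU, Finset.mul_sum,
    ← Finset.sum_add_distrib]
  refine Finset.sum_le_sum fun i _ => ?_
  have h1 : 0 < u + d i := by linarith [hd i]
  have h2 : 0 < u + s + d i := by linarith
  have h3 : (u + d i)⁻¹ = (u + s + d i)⁻¹ + s * ((u + d i)⁻¹ * (u + s + d i)⁻¹) := by
    field_simp
    ring
  have h4 : (u + s + d i)⁻¹ ≤ (u + d i)⁻¹ := inv_anti₀ h1 (by linarith)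
  have h5 : s * ((u + d i)⁻¹ * (u + s + d i)⁻¹) ≤ s * (u + d i)⁻¹ ^ 2 := by
    rw [sq]
    gcongr
  linarith

theorem trace_resolvent_sq_le {W : Matrix ι ι ℝ} (hW : W.PosSemidef) {u : ℝ} (hu : 0 < u) :
    0 ≤ (((u • (1 : Matrix ι ι ℝ) + W)⁻¹) ^ 2).trace ∧
      (((u • (1 : Matrix ι ι ℝ) + W)⁻¹) ^ 2).trace ≤ Fintype.card ι * u⁻¹ ^ 2 := by
  obtain ⟨U, d, hd, hU, hU', -, hinv⟩ := exists_spectral_resolvent hW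
  rw [hinv u hu, spectral_pow hU hU', spectral_trace hU]
  refine ⟨Finset.sum_nonneg fun i _ => by positivity, ?_⟩
  rw [← nsmul_eq_mul, ← Finset.card_univ, ← Finset.sum_const]
  refine Finset.sum_le_sum fun i _ => ?_
  have h1 : (u + d i)⁻¹ ≤ u⁻¹ := inv_anti₀ hu (by linarith [hd i])
  have h2 : 0 ≤ (u + d i)⁻¹ := inv_nonneg.2 (by linarith [hd i])
  exact pow_le_pow_left₀ h2 h1 2

theorem resolventTrace_nonneg {W : Matrix ι ι ℝ} (hW : W.PosSemidef) {u : ℝ} (hu : 0 < u) :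
    0 ≤ resolventTrace W u := by
  obtain ⟨U, d, hd, hU, hU', -, hinv⟩ := exists_spectral_resolvent hW
  rw [resolventTrace, hinv u hu, spectral_trace hU]
  exact Finset.sum_nonneg fun i _ => inv_nonneg.2 (by linarith [hd i])

theorem form_resolvent_sq_le {W : Matrix ι ι ℝ} (hW : W.PosSemidef) {u : ℝ} (hu : 0 < u)
    (y : ι → ℝ) :
    0 ≤ y ⬝ᵥ (u • (1 : Matrix ι ι ℝ) + W)⁻¹ *ᵥ y ∧
    0 ≤ y ⬝ᵥ (((u • (1 : Matrix ι ι ℝ) + W)⁻¹) ^ 2) *ᵥ y ∧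
      y ⬝ᵥ (((u • (1 : Matrix ι ι ℝ) + W)⁻¹) ^ 2) *ᵥ y ≤
        u⁻¹ * (y ⬝ᵥ (u • (1 : Matrix ι ι ℝ) + W)⁻¹ *ᵥ y) := by
  obtain ⟨U, d, hd, hU, hU', -, hinv⟩ := exists_spectral_resolvent hW
  have h2 : ∀ i, 0 ≤ (u + d i)⁻¹ := fun i => inv_nonneg.2 (by linarith [hd i])
  rw [hinv u hu, spectral_pow hU hU', spectral_form, spectral_form]
  refine ⟨Finset.sum_nonneg fun i _ => mul_nonneg (h2 i) (sq_nonneg _),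
    Finset.sum_nonneg fun i _ => by positivity, ?_⟩
  rw [Finset.mul_sum]
  refine Finset.sum_le_sum fun i _ => ?_
  have h1 : (u + d i)⁻¹ ≤ u⁻¹ := inv_anti₀ hu (by linarith [hd i])
  rw [← mul_assoc, sq]
  exact mul_le_mul_of_nonneg_right (mul_le_mul_of_nonneg_right h1 (h2 i)) (sq_nonneg _)

variable {ρ : Measure ℝ} [IsProbabilityMeasure ρ] {H : ℝ}

/-- The forms of the resolvent and of its square at a random vector are almost uncorrelated. -/
theorem integral_form_resolvent_le (h : IsUnitSubGaussian H ρ) (hc : ∫ x, x ∂ρ = 0)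
    {W : Matrix ι ι ℝ} (hW : W.PosSemidef) {u : ℝ} (hu : 0 < u) {N : Matrix ι ι ℝ}
    (hN : N = (u • (1 : Matrix ι ι ℝ) + W)⁻¹) :
    ∫ z, (z ⬝ᵥ (N ^ 2) *ᵥ z) * (z ⬝ᵥ N *ᵥ z) ∂(Measure.pi fun _ : ι => ρ) ≤
      (N ^ 2).trace * N.trace + (2 + 4 * H ^ 4) * u⁻¹ * (N ^ 2).trace := by
  have hMpd := posDef_smul_one_add hu hW
  have hNpsd : N.PosSemidef := hN ▸ hMpd.inv.posSemidef
  have hN2psd : (N ^ 2).PosSemidef := hNpsd.pow 2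
  have hsym : ∀ i j, N i j = N j i := fun i j => by
    simpa using (congrFun (congrFun hNpsd.isHermitian i) j).symm
  have ht0 : 0 ≤ (N ^ 2).trace := hN ▸ (trace_resolvent_sq_le hW hu).1
  have hcube : ∑ i, ∑ j, (N ^ 2) i j * N j i ≤ u⁻¹ * (N ^ 2).trace := by
    have h1 : ∑ i, ∑ j, (N ^ 2) i j * N j i = (N ^ 3).trace := by
      rw [pow_succ N 2]
      simp [Matrix.trace, Matrix.mul_apply]
    obtain ⟨U, d, hd, hU, hU', -, hinv⟩ := exists_spectral_resolvent hW
    rw [h1, hN, hinv u hu, spectral_pow hU hU', spectral_pow hU hU', spectral_trace hU,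
      spectral_trace hU, Finset.mul_sum]
    refine Finset.sum_le_sum fun i _ => ?_
    have h2 : (u + d i)⁻¹ ≤ u⁻¹ := inv_anti₀ hu (by linarith [hd i])
    rw [pow_succ, mul_comm]
    exact mul_le_mul_of_nonneg_right h2 (sq_nonneg _)
  have hdiag : ∑ i, (N ^ 2) i i * N i i ≤ u⁻¹ * (N ^ 2).trace := by
    rw [Matrix.trace, Finset.mul_sum]
    refine Finset.sum_le_sum fun i _ => ?_
    have h1 := form_inv_le hu hW (Pi.single i 1)
    rw [form_single, ← hN] at h1
    have h2 : N i i ≤ u⁻¹ := by simpa using h1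
    rw [mul_comm]
    exact mul_le_mul_of_nonneg_right h2 (diag_nonneg hN2psd i)
  have hdiag0 : 0 ≤ ∑ i, (N ^ 2) i i * N i i :=
    Finset.sum_nonneg fun i _ => mul_nonneg (diag_nonneg hN2psd i) (diag_nonneg hNpsd i)
  have heq : ∑ i, ∑ j, (N ^ 2) i j * N i j = ∑ i, ∑ j, (N ^ 2) i j * N j i :=
    Finset.sum_congr rfl fun i _ => Finset.sum_congr rfl fun j _ => by rw [hsym i j]
  rw [integral_form_mul_form h hc, heq]
  have h3 : (∫ x, x ^ 4 ∂ρ - 3) * ∑ i, (N ^ 2) i i * N i i ≤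
      4 * H ^ 4 * (u⁻¹ * (N ^ 2).trace) := by
    calc (∫ x, x ^ 4 ∂ρ - 3) * ∑ i, (N ^ 2) i i * N i i
        ≤ 4 * H ^ 4 * ∑ i, (N ^ 2) i i * N i i :=
          mul_le_mul_of_nonneg_right (by linarith [h.integral_pow_four_le]) hdiag0
      _ ≤ _ := mul_le_mul_of_nonneg_left hdiag (by positivity)
  nlinarith

/-- One step of the barrier argument: while the trace is at most `φ`, adding a random rank-one
matrix and moving the barrier by `s` decreases the exponential moment of the trace on average, up
to a second-order term. -/
theorem lintegral_exp_resolventTrace_le (h : IsUnitSubGaussian H ρ) (hc : ∫ x, x ∂ρ = 0)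
    {W : Matrix ι ι ℝ} (hW : W.PosSemidef) {u s δ φ r R : ℝ} (hδ : 0 < δ) (hu : δ ≤ u)
    (hs : 0 ≤ s) (hr : 0 ≤ r) (hφ : resolventTrace W (u + s) ≤ φ)
    (hR : R = s * (Fintype.card ι * δ⁻¹ ^ 2) + δ⁻¹) (hrR : r * R ≤ 1)
    (hsφ : s ≤ (1 + φ + s * (Fintype.card ι * δ⁻¹ ^ 2))⁻¹ - (2 + 4 * H ^ 4) * δ⁻¹) :
    ∫⁻ z, ENNReal.ofReal (Real.exp (r * (resolventTrace (W + Matrix.vecMulVec z z) u - φ)))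
      ∂(Measure.pi fun _ : ι => ρ) ≤
      ENNReal.ofReal (Real.exp (r * (resolventTrace W (u + s) - φ) + (r * R) ^ 2)) := by
  have hu0 : 0 < u := lt_of_lt_of_le hδ hu
  obtain ⟨N, hN⟩ : ∃ N, N = (u • (1 : Matrix ι ι ℝ) + W)⁻¹ := ⟨_, rfl⟩
  have hMpd := posDef_smul_one_add hu0 hW
  obtain ⟨t, ht⟩ : ∃ t, t = (N ^ 2).trace := ⟨_, rfl⟩
  obtain ⟨T, hT⟩ : ∃ T, T = N.trace := ⟨_, rfl⟩
  obtain ⟨g, hg⟩ : ∃ g, g = resolventTrace W (u + s) := ⟨_, rfl⟩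
  have hδu : u⁻¹ ≤ δ⁻¹ := inv_anti₀ hδ hu
  have hδ0 : 0 < δ⁻¹ := inv_pos.2 hδ
  have hu1 : 0 < u⁻¹ := inv_pos.2 hu0
  obtain ⟨ht0, ht1⟩ := trace_resolvent_sq_le hW hu0
  rw [← hN, ← ht] at ht0 ht1
  have ht2 : t ≤ Fintype.card ι * δ⁻¹ ^ 2 := ht1.trans (by gcongr)
  have hTg : T ≤ g + s * t := by
    have := resolventTrace_shift_le hW hu0 hs
    rwa [resolventTrace, ← hN, ← hT, ← ht, ← hg] at this
  have hT0 : 0 ≤ T := by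
    have := resolventTrace_nonneg hW hu0
    rwa [resolventTrace, ← hN, ← hT] at this
  have hst : s * t ≤ s * (Fintype.card ι * δ⁻¹ ^ 2) := mul_le_mul_of_nonneg_left ht2 hs
  have hsT : s ≤ (1 + T)⁻¹ - (2 + 4 * H ^ 4) * δ⁻¹ := by
    have h1 : (1 + φ + s * (Fintype.card ι * δ⁻¹ ^ 2))⁻¹ ≤ (1 + T)⁻¹ :=
      inv_anti₀ (by linarith) (by linarith)
    linarith
  obtain ⟨A, hA⟩ : ∃ A : (ι → ℝ) → ℝ, A = fun z => z ⬝ᵥ N *ᵥ z := ⟨_, rfl⟩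
  obtain ⟨B, hB⟩ : ∃ B : (ι → ℝ) → ℝ, B = fun z => z ⬝ᵥ (N ^ 2) *ᵥ z := ⟨_, rfl⟩
  have hAB : ∀ z, 0 ≤ A z ∧ 0 ≤ B z ∧ B z ≤ u⁻¹ * A z := fun z => by
    rw [hA, hB, hN]
    exact form_resolvent_sq_le hW hu0 z
  -- the deterministic bound for one update
  have hupd : ∀ z, resolventTrace (W + Matrix.vecMulVec z z) u ≤ T - (1 + A z)⁻¹ * B z :=
    fun z => by
      have h1 := trace_inv_pow_update_le hMpd z (κ := (1 + A z)⁻¹) (by rw [hA, hN]) 1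
      rw [← hN] at h1
      simp only [pow_one, Nat.cast_one, one_mul, ← hT] at h1
      rw [resolventTrace, ← add_assoc]
      have h2 : B z = z ⬝ᵥ (N ^ (1 + 1)) *ᵥ z := by rw [hB]
      rw [h2]
      linarith
  obtain ⟨D, hD⟩ : ∃ D : (ι → ℝ) → ℝ, D = fun z => s * t - (1 + A z)⁻¹ * B z := ⟨_, rfl⟩
  have hDg : ∀ z, resolventTrace (W + Matrix.vecMulVec z z) u - φ ≤ (g - φ) + D z := fun z => by
    have := hupd z
    simp only [hD]
    linarith
  have hq : ∀ z, 0 ≤ (1 + A z)⁻¹ * B z ∧ (1 + A z)⁻¹ * B z ≤ δ⁻¹ := fun z => by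
    obtain ⟨h1, h2, h3⟩ := hAB z
    refine ⟨by positivity, ?_⟩
    rw [inv_mul_le_iff₀ (by linarith)]
    calc B z ≤ u⁻¹ * A z := h3
      _ ≤ δ⁻¹ * (1 + A z) := by gcongr; linarith
      _ = (1 + A z) * δ⁻¹ := mul_comm _ _
  have hDR : ∀ z, |D z| ≤ R := fun z => by
    obtain ⟨h1, h2⟩ := hq z
    have h3 : 0 ≤ s * t := by positivity
    simp only [hD]
    rw [abs_le, hR]
    constructor <;> linarith
  have hR0 : 0 ≤ R := (abs_nonneg _).trans (hDR 0)
  -- linearization of the convex function `x ↦ (1 + x)⁻¹` at the mean `T`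
  obtain ⟨τ, hτ⟩ : ∃ τ, τ = (1 + T)⁻¹ := ⟨_, rfl⟩
  have hτ0 : 0 < τ := by rw [hτ]; positivity
  have hτT : τ * (1 + T) = 1 := by rw [hτ, inv_mul_cancel₀ (by linarith)]
  have hτ1 : τ ≤ 1 := by rw [hτ]; exact inv_le_one_of_one_le₀ (by linarith)
  have htan : ∀ z, τ * (2 - τ) - τ ^ 2 * A z ≤ (1 + A z)⁻¹ := fun z => by
    obtain ⟨h1, -, -⟩ := hAB z
    rw [← one_div, le_div_iff₀ (by linarith)]
    nlinarith [sq_nonneg (1 - τ * (1 + A z))]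
  have hmem : ∀ i, MemLp (fun z : ι → ℝ => z i) 2 (Measure.pi fun _ : ι => ρ) :=
    memLp_two_eval_pi fun _ => h
  have hiB : Integrable B (Measure.pi fun _ : ι => ρ) := hB ▸ integrable_form hmem _
  have hiBA : Integrable (fun z => B z * A z) (Measure.pi fun _ : ι => ρ) := by
    rw [hA, hB]
    exact integrable_form_mul_form h _ _
  have hEB : ∫ z, B z ∂(Measure.pi fun _ : ι => ρ) = t := by
    rw [hB, integral_form (Λ := fun _ => 1) hmem
      (integral_eval_mul_eval_pi (fun _ => h) fun i j _ => by rw [hc, zero_mul]) (N ^ 2), ht]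
    simp [Matrix.trace]
  have hEBA : ∫ z, B z * A z ∂(Measure.pi fun _ : ι => ρ) ≤
      t * T + (2 + 4 * H ^ 4) * δ⁻¹ * t := by
    have h1 := integral_form_resolvent_le h hc hW hu0 hN
    rw [← ht, ← hT] at h1
    rw [hA, hB]
    refine h1.trans ?_
    have : (2 + 4 * H ^ 4) * u⁻¹ * t ≤ (2 + 4 * H ^ 4) * δ⁻¹ * t := by gcongr
    linarith
  -- a bounded majorant of the exponential, whose mean is computed exactly
  obtain ⟨F, hF⟩ : ∃ F : (ι → ℝ) → ℝ, F = fun z => (1 + r * (s * t) + (r * R) ^ 2) -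
      (r * (τ * (2 - τ)) * B z - r * τ ^ 2 * (B z * A z)) := ⟨_, rfl⟩
  have hi1 : Integrable (fun z => r * (τ * (2 - τ)) * B z - r * τ ^ 2 * (B z * A z))
      (Measure.pi fun _ : ι => ρ) := (hiB.const_mul _).sub (hiBA.const_mul _)
  have hiF : Integrable F (Measure.pi fun _ : ι => ρ) := by
    rw [hF]
    exact (integrable_const _).sub hi1
  have hptF : ∀ z, Real.exp (r * D z) ≤ F z := fun z => by
    have h1 : |r * D z| ≤ r * R := by
      rw [abs_mul, abs_of_nonneg hr]
      exact mul_le_mul_of_nonneg_left (hDR z) hr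
    have h2 := (abs_le.1 (Real.abs_exp_sub_one_sub_id_le (h1.trans hrR))).2
    have h3 : (r * D z) ^ 2 ≤ (r * R) ^ 2 := sq_le_sq' (by linarith [(abs_le.1 h1).1])
      (abs_le.1 h1).2
    have h4 := htan z
    have h5 : (τ * (2 - τ) - τ ^ 2 * A z) * B z ≤ (1 + A z)⁻¹ * B z :=
      mul_le_mul_of_nonneg_right h4 (hAB z).2.1
    have h6 := mul_le_mul_of_nonneg_left h5 hr
    have h7 : r * D z = r * (s * t) - r * ((1 + A z)⁻¹ * B z) := by rw [hD]; ring
    simp only [hF]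
    nlinarith
  have hEF : ∫ z, F z ∂(Measure.pi fun _ : ι => ρ) ≤ 1 + (r * R) ^ 2 := by
    rw [hF, integral_sub (integrable_const _) hi1,
      integral_sub (hiB.const_mul _) (hiBA.const_mul _), integral_const_mul, integral_const_mul,
      hEB]
    simp only [integral_const, probReal_univ, smul_eq_mul, one_mul]
    have h1 : r * τ ^ 2 * ∫ z, B z * A z ∂(Measure.pi fun _ : ι => ρ) ≤
        r * τ ^ 2 * (t * T + (2 + 4 * H ^ 4) * δ⁻¹ * t) :=
      mul_le_mul_of_nonneg_left hEBA (by positivity)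
    have h2 : s * t ≤ (τ - (2 + 4 * H ^ 4) * δ⁻¹) * t := by
      rw [hτ]
      exact mul_le_mul_of_nonneg_right hsT ht0
    have h3 : r * (s * t) ≤ r * ((τ - (2 + 4 * H ^ 4) * δ⁻¹) * t) :=
      mul_le_mul_of_nonneg_left h2 hr
    obtain ⟨k, hk⟩ : ∃ k, k = (2 + 4 * H ^ 4) * δ⁻¹ := ⟨_, rfl⟩
    have hk0 : 0 ≤ k := by rw [hk]; positivity
    rw [← hk] at h1 h3
    have h4 : τ ^ 2 ≤ 1 := pow_le_one₀ hτ0.le hτ1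
    have h5 : τ * T = 1 - τ := by linarith
    have h6 : r * τ ^ 2 * (t * T + k * t) ≤ r * t * (τ * (1 - τ)) + r * (k * t) := by
      have e1 : r * τ ^ 2 * (t * T + k * t) = r * t * (τ * (τ * T)) + τ ^ 2 * (r * (k * t)) := by
        ring
      have e2 : τ ^ 2 * (r * (k * t)) ≤ 1 * (r * (k * t)) :=
        mul_le_mul_of_nonneg_right h4 (by positivity)
      rw [e1, h5]
      linarith
    have h7 : r * (τ * (2 - τ)) * t = r * t * (τ * (1 - τ)) + r * (τ * t) := by ring
    have h8 : r * ((τ - k) * t) = r * (τ * t) - r * (k * t) := by ring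
    linarith
  have hfin : ∫⁻ z, ENNReal.ofReal (Real.exp (r * D z)) ∂(Measure.pi fun _ : ι => ρ) ≤
      ENNReal.ofReal (Real.exp ((r * R) ^ 2)) :=
    lintegral_ofReal_le_of_integral_le hiF (fun _ => (Real.exp_pos _).le) hptF
      (hEF.trans (by linarith [Real.add_one_le_exp ((r * R) ^ 2)]))
  rw [← hg]
  calc ∫⁻ z, ENNReal.ofReal (Real.exp (r * (resolventTrace (W + Matrix.vecMulVec z z) u - φ)))
        ∂(Measure.pi fun _ : ι => ρ)
      ≤ ∫⁻ z, ENNReal.ofReal (Real.exp (r * (g - φ))) * ENNReal.ofReal (Real.exp (r * D z))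
        ∂(Measure.pi fun _ : ι => ρ) := by
        refine lintegral_mono fun z => ?_
        rw [← ENNReal.ofReal_mul (Real.exp_pos _).le, ← Real.exp_add, ← mul_add]
        exact ENNReal.ofReal_le_ofReal
          (Real.exp_le_exp.2 (mul_le_mul_of_nonneg_left (hDg z) hr))
    _ = ENNReal.ofReal (Real.exp (r * (g - φ))) *
        ∫⁻ z, ENNReal.ofReal (Real.exp (r * D z)) ∂(Measure.pi fun _ : ι => ρ) :=
        lintegral_const_mul' _ _ ENNReal.ofReal_ne_top
    _ ≤ ENNReal.ofReal (Real.exp (r * (g - φ))) * ENNReal.ofReal (Real.exp ((r * R) ^ 2)) := by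
        gcongr
    _ = _ := by rw [← ENNReal.ofReal_mul (Real.exp_pos _).le, ← Real.exp_add]

theorem continuous_resolventTrace_add {u : ℝ} (hu : 0 < u) {W : Matrix ι ι ℝ} (hW : W.PosSemidef)
    (m : ℕ) : Continuous fun Z : Fin m → ι → ℝ => resolventTrace (W + gramSum Z) u := by
  have h1 : Continuous fun Z : Fin m → ι → ℝ => u • (1 : Matrix ι ι ℝ) + (W + gramSum Z) :=
    continuous_const.add (continuous_const.add continuous_gramSum)
  have h2 : Continuous fun Z : Fin m → ι → ℝ => (u • (1 : Matrix ι ι ℝ) + (W + gramSum Z))⁻¹ := by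
    simp only [Matrix.inv_def, Ring.inverse_eq_inv']
    exact (h1.matrix_det.inv₀ fun Z =>
      (posDef_smul_one_add hu (hW.add (gramSum_posSemidef Z))).det_pos.ne').smul h1.matrix_adjugate
  exact h2.matrix_trace

/-- The trace of the resolvent stays below `φ` while the barrier moves from `δ + m s` to `δ`.
In the induction a starting trace above `φ` is harmless, as the bound then exceeds one. -/
theorem measure_resolventTrace_gt_le (m : ℕ) (ρ : Fin m → Measure ℝ)
    [∀ l, IsProbabilityMeasure (ρ l)] (h : ∀ l, IsUnitSubGaussian H (ρ l))
    (hc : ∀ l, ∫ x, x ∂(ρ l) = 0)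
    {W : Matrix ι ι ℝ} (hW : W.PosSemidef) {s δ φ r R : ℝ} (hδ : 0 < δ)
    (hs : 0 ≤ s) (hr : 0 ≤ r) (hR : R = s * (Fintype.card ι * δ⁻¹ ^ 2) + δ⁻¹) (hrR : r * R ≤ 1)
    (hsφ : s ≤ (1 + φ + s * (Fintype.card ι * δ⁻¹ ^ 2))⁻¹ - (2 + 4 * H ^ 4) * δ⁻¹) :
    (Measure.pi fun l : Fin m => Measure.pi fun _ : ι => ρ l)
      {Z | φ < resolventTrace (W + gramSum Z) δ} ≤
      ENNReal.ofReal (Real.exp (r * (resolventTrace W (δ + m * s) - φ) + m * (r * R) ^ 2)) := by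
  induction m generalizing W with
  | zero =>
    by_cases hgt : φ < resolventTrace W δ
    · refine prob_le_one.trans ?_
      rw [← ENNReal.ofReal_one]
      refine ENNReal.ofReal_le_ofReal (Real.one_le_exp ?_)
      have := mul_nonneg hr (sub_nonneg.2 hgt.le)
      simpa using this
    · simp [gramSum, hgt]
  | succ m ih =>
    obtain ⟨u, hu⟩ : ∃ u, u = δ + m * s := ⟨_, rfl⟩
    have hus : δ + (m + 1 : ℕ) * s = u + s := by rw [hu]; push_cast; ring
    rw [hus]
    by_cases hgt : φ < resolventTrace W (u + s)
    · refine prob_le_one.trans ?_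
      rw [← ENNReal.ofReal_one]
      refine ENNReal.ofReal_le_ofReal (Real.one_le_exp ?_)
      have := mul_nonneg hr (sub_nonneg.2 hgt.le)
      positivity
    rw [not_lt] at hgt
    have hδu : δ ≤ u := by rw [hu]; linarith [mul_nonneg (Nat.cast_nonneg (α := ℝ) m) hs]
    have hmp := measurePreserving_piFinSuccAbove
      (fun l : Fin (m + 1) => Measure.pi fun _ : ι => ρ l) 0
    set e := MeasurableEquiv.piFinSuccAbove (fun _ : Fin (m + 1) => ι → ℝ) 0
    obtain ⟨S, hS⟩ : ∃ S : Set ((ι → ℝ) × (Fin m → ι → ℝ)),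
        S = {z | φ < resolventTrace (W + Matrix.vecMulVec z.1 z.1 + gramSum z.2) δ} := ⟨_, rfl⟩
    have hpre : {Z : Fin (m + 1) → ι → ℝ | φ < resolventTrace (W + gramSum Z) δ} = e ⁻¹' S := by
      ext Z
      have : gramSum Z = Matrix.vecMulVec (e Z).1 (e Z).1 + gramSum (e Z).2 := by
        rw [gramSum, Fin.sum_univ_succ]
        rfl
      rw [hS, Set.mem_preimage, Set.mem_ofPred_eq, Set.mem_ofPred_eq, this, add_assoc]
    have hSm : MeasurableSet S := by
      have h1 : S = e.symm ⁻¹' {Z | φ < resolventTrace (W + gramSum Z) δ} := by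
        rw [hpre, ← Set.preimage_comp]
        simp
      rw [h1]
      exact e.symm.measurable
        (isOpen_lt continuous_const (continuous_resolventTrace_add hδ hW _)).measurableSet
    rw [hpre, hmp.measure_preimage hSm.nullMeasurableSet, Measure.prod_apply hSm]
    have hstep : ∀ z : ι → ℝ, (Measure.pi fun l : Fin m => Measure.pi fun _ : ι => ρ l.succ)
        (Prod.mk z ⁻¹' S) ≤ ENNReal.ofReal (Real.exp (m * (r * R) ^ 2)) *
          ENNReal.ofReal (Real.exp (r * (resolventTrace (W + Matrix.vecMulVec z z) u - φ))) :=
        fun z => by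
      have h1 := ih (fun l => ρ l.succ) (fun l => h _) (fun l => hc _)
        (hW.add (posSemidef_vecMulVec z))
      rw [← ENNReal.ofReal_mul (Real.exp_pos _).le, ← Real.exp_add, add_comm _ (r * _), hu]
      refine le_trans (le_of_eq ?_) h1
      rw [hS]
      rfl
    calc ∫⁻ z, (Measure.pi fun l : Fin m => Measure.pi fun _ : ι => ρ l.succ)
          (Prod.mk z ⁻¹' S) ∂(Measure.pi fun _ : ι => ρ 0)
        ≤ ∫⁻ z, ENNReal.ofReal (Real.exp (m * (r * R) ^ 2)) *
          ENNReal.ofReal (Real.exp (r * (resolventTrace (W + Matrix.vecMulVec z z) u - φ)))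
          ∂(Measure.pi fun _ : ι => ρ 0) := lintegral_mono hstep
      _ = ENNReal.ofReal (Real.exp (m * (r * R) ^ 2)) * ∫⁻ z,
          ENNReal.ofReal (Real.exp (r * (resolventTrace (W + Matrix.vecMulVec z z) u - φ)))
          ∂(Measure.pi fun _ : ι => ρ 0) := lintegral_const_mul' _ _ ENNReal.ofReal_ne_top
      _ ≤ ENNReal.ofReal (Real.exp (m * (r * R) ^ 2)) *
          ENNReal.ofReal (Real.exp (r * (resolventTrace W (u + s) - φ) + (r * R) ^ 2)) := by
          gcongr
          exact lintegral_exp_resolventTrace_le (h 0) (hc 0) hW hδ hδu hs hr hgt hR hrR hsφ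
      _ = _ := by
          rw [← ENNReal.ofReal_mul (Real.exp_pos _).le, ← Real.exp_add]
          congr 2
          push_cast
          ring

end Barrier

/-! ### The least singular value of a rectangular random matrix -/

section TwoGroups

variable {ι κ : Type*} [Fintype ι] [DecidableEq ι] [Fintype κ]

theorem dotProduct_gramSum_eq_sqForm {ι : Type*} [Fintype ι] {m : ℕ} (Z : Fin m → ι → ℝ)
    (w : ι → ℝ) :
    w ⬝ᵥ gramSum Z *ᵥ w = sqForm Z w := dotProduct_gramSum Z w

/-- The eigenvectors of `W` with eigenvalue below `δ` span a space of dimension at most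
`2 δ tr (W + δ)⁻¹`. If a second form is bounded below on that space, and above everywhere, then the
sum of the two forms is bounded below everywhere. -/
theorem exists_small_subspace {W : Matrix ι ι ℝ} (hW : W.PosSemidef) {δ φ : ℝ} (hδ : 0 < δ)
    (hφ : resolventTrace W δ ≤ φ) :
    ∃ (E : Finset ι) (U : Matrix ι ι ℝ), (E.card : ℝ) ≤ 2 * δ * φ ∧
      (∀ u : E → ℝ, ∑ i, (∑ e : E, U i e * u e) ^ 2 = ∑ e, u e ^ 2) ∧
      ∀ (a : κ → ι → ℝ) (B b : ℝ), 0 < B → 0 ≤ b → b ≤ 2 * B → δ ≤ 2 * B →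
        (∀ v, sqForm a v ≤ B * ∑ i, v i ^ 2) →
        (∀ u : E → ℝ, b * ∑ e, u e ^ 2 ≤ sqForm (fun l (e : E) => ∑ i, a l i * U i e) u) →
        ∀ w, δ * b / (4 * B) * ∑ i, w i ^ 2 ≤ w ⬝ᵥ W *ᵥ w + sqForm a w := by
  classical
  obtain ⟨U, d, hd, hU, hU', hWd, hinv⟩ := exists_spectral_resolvent hW
  let E : Finset ι := Finset.univ.filter fun i => d i < δ
  have horth : ∀ c : ι → ℝ, ∑ i, (U *ᵥ c) i ^ 2 = ∑ i, c i ^ 2 := fun c => by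
    have h1 := sum_sq_transpose_mulVec (U := Uᵀ) (by rw [Matrix.transpose_transpose]; exact hU) c
    rw [Matrix.transpose_transpose] at h1
    rw [h1]
    simp [dotProduct, sq]
  have hsub : ∀ u : E → ℝ, ∀ i, ∑ e : E, U i e * u e =
      (U *ᵥ fun j => if h : j ∈ E then u ⟨j, h⟩ else 0) i := fun u i => by
    rw [Matrix.mulVec, dotProduct, ← Finset.sum_subset (Finset.subset_univ E) (fun j _ hj => by
      simp [hj]), ← Finset.sum_coe_sort E]
    exact Finset.sum_congr rfl fun e _ => by simp
  refine ⟨E, U, ?_, fun u => ?_, fun a B b hB hb hbB hδB hup hlow w => ?_⟩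
  · rw [resolventTrace, hinv δ hδ, spectral_trace hU] at hφ
    have h1 : ∑ i ∈ E, (2 * δ)⁻¹ ≤ ∑ i, (δ + d i)⁻¹ := by
      refine (Finset.sum_le_sum fun i hi => ?_).trans (Finset.sum_le_sum_of_subset_of_nonneg
        (Finset.subset_univ E) fun i _ _ => inv_nonneg.2 (by linarith [hd i]))
      have h2 : d i < δ := (Finset.mem_filter.1 hi).2
      exact inv_anti₀ (by linarith [hd i]) (by linarith)
    rw [Finset.sum_const, nsmul_eq_mul] at h1
    have h3 : (E.card : ℝ) * (2 * δ)⁻¹ ≤ φ := h1.trans hφ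
    rw [← div_eq_mul_inv, div_le_iff₀ (by positivity)] at h3
    linarith
  · simp only [hsub]
    rw [horth, ← Finset.sum_subset (Finset.subset_univ E) (fun j _ hj => by simp [hj]),
      ← Finset.sum_coe_sort E]
    exact Finset.sum_congr rfl fun e _ => by simp
  · obtain ⟨c, hc⟩ : ∃ c, c = Uᵀ *ᵥ w := ⟨_, rfl⟩
    have hwc : w = U *ᵥ c := by rw [hc, Matrix.mulVec_mulVec, hU', Matrix.one_mulVec]
    -- the components of `w` outside and inside the space of small eigenvalues
    let c₁ : ι → ℝ := fun j => if j ∈ E then 0 else c j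
    let c₂ : ι → ℝ := fun j => if j ∈ E then c j else 0
    have hsq : ∑ i, w i ^ 2 = ∑ j, c₁ j ^ 2 + ∑ j, c₂ j ^ 2 := by
      rw [hwc, horth, ← Finset.sum_add_distrib]
      refine Finset.sum_congr rfl fun j _ => ?_
      by_cases hj : j ∈ E <;> simp [c₁, c₂, hj]
    have hWw : δ * ∑ j, c₁ j ^ 2 ≤ w ⬝ᵥ W *ᵥ w := by
      rw [hWd, spectral_form, ← hc, Finset.mul_sum]
      refine Finset.sum_le_sum fun j _ => ?_
      by_cases hj : j ∈ E
      · simp only [c₁, if_pos hj]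
        have := mul_nonneg (hd j) (sq_nonneg (c j))
        simpa using this
      · have h1 : δ ≤ d j := by
          by_contra hlt
          exact hj (Finset.mem_filter.2 ⟨Finset.mem_univ j, not_le.1 hlt⟩)
        simp only [c₁, if_neg hj]
        exact mul_le_mul_of_nonneg_right h1 (sq_nonneg _)
    have hdiff : ∀ i, (U *ᵥ c₂) i - w i = -(U *ᵥ c₁) i := fun i => by
      have h1 : c = c₁ + c₂ := by
        ext j
        by_cases hj : j ∈ E <;> simp [c₁, c₂, hj]
      rw [hwc, h1, Matrix.mulVec_add, Pi.add_apply]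
      ring
    have h1 := sqForm_le_add a (U *ᵥ c₂) w
    have h2 : sqForm a (fun i => (U *ᵥ c₂) i - w i) ≤ B * ∑ j, c₁ j ^ 2 := by
      refine (hup _).trans (le_of_eq ?_)
      simp only [hdiff, neg_sq, horth]
    have h3 : b * ∑ j, c₂ j ^ 2 ≤ sqForm a (U *ᵥ c₂) := by
      have h4 := hlow fun e => c e
      have h5 : ∑ e : E, c e ^ 2 = ∑ j, c₂ j ^ 2 := by
        rw [← Finset.sum_subset (Finset.subset_univ E) (fun j _ hj => by simp [c₂, hj]),
          ← Finset.sum_coe_sort E]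
        exact Finset.sum_congr rfl fun e _ => by simp [c₂]
      have h6 : sqForm (fun l (e : E) => ∑ i, a l i * U i e) (fun e => c e) =
          sqForm a (U *ᵥ c₂) := by
        refine Finset.sum_congr rfl fun l _ => ?_
        congr 1
        have h7 : ∀ i, (U *ᵥ c₂) i = ∑ e : E, U i e * c e := fun i => by
          rw [hsub (fun e : E => c e) i]
          congr 2
        simp only [h7, Finset.sum_mul, Finset.mul_sum]
        rw [Finset.sum_comm]
        exact Finset.sum_congr rfl fun i _ => Finset.sum_congr rfl fun e _ => by ring
      rw [h5, h6] at h4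
      exact h4
    obtain ⟨p, hp⟩ : ∃ p, p = ∑ j, c₁ j ^ 2 := ⟨_, rfl⟩
    obtain ⟨q, hq⟩ : ∃ q, q = ∑ j, c₂ j ^ 2 := ⟨_, rfl⟩
    have hp0 : 0 ≤ p := hp ▸ Finset.sum_nonneg fun j _ => sq_nonneg _
    have hF := sqForm_nonneg a w
    rw [hsq]
    rw [← hp] at h2 hWw ⊢
    rw [← hq] at h3 ⊢
    have h8 : b / 2 * q - B * p ≤ sqForm a w := by linarith
    -- only the fraction `t` of the second form is used, so that its negative part is absorbed
    obtain ⟨t, ht⟩ : ∃ t, t = δ / (2 * B) := ⟨_, rfl⟩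
    have ht0 : 0 ≤ t := by rw [ht]; positivity
    have ht1 : t ≤ 1 := by rw [ht, div_le_one (by positivity)]; exact hδB
    have htB : t * B = δ / 2 := by rw [ht]; field_simp
    have h9 : t * (b / 2 * q - B * p) ≤ sqForm a w :=
      (mul_le_mul_of_nonneg_left h8 ht0).trans (mul_le_of_le_one_left hF ht1)
    have h10 : δ * b / (4 * B) = t * (b / 2) := by rw [ht]; field_simp; norm_num
    have h11 : t * (b / 2) ≤ δ / 2 := by
      rw [← htB]
      exact mul_le_mul_of_nonneg_left (by linarith) ht0
    have h12 : t * (b / 2) * p ≤ δ / 2 * p := mul_le_mul_of_nonneg_right h11 hp0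
    have h13 : t * (b / 2 * q - B * p) = t * (b / 2) * q - δ / 2 * p := by rw [← htB]; ring
    rw [h10]
    linarith

/-- Two independent groups of columns: the first group controls all directions but those of a
space of small dimension, on which the second group is bounded below. -/
theorem measure_two_groups_lt_le {m : ℕ} {P₁ : Measure (Fin m → ι → ℝ)} [IsProbabilityMeasure P₁]
    {ρ : κ → Measure ℝ} [∀ l, IsProbabilityMeasure (ρ l)] {H : ℝ} (hH : 0 < H)
    (h : ∀ l, IsUnitSubGaussian H (ρ l)) (hc : ∀ l, ∫ x, x ∂(ρ l) = 0) {δ φ B : ℝ} (hδ : 0 < δ)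
    (hB : 0 < B) (hδB : δ ≤ 2 * B) {j : ℕ} (hj : 1 ≤ j)
    (hBj : B * (1 / 4) ^ j ≤ (Fintype.card κ : ℝ) / 64)
    (hcB : (Fintype.card κ : ℝ) / 64 ≤ 2 * B) :
    (P₁.prod (Measure.pi fun l => Measure.pi fun _ : ι => ρ l))
      {z | (∀ v, sqForm z.2 v ≤ B * ∑ i, v i ^ 2) ∧
        ∃ w, sqForm z.1 w + sqForm z.2 w <
          δ * ((Fintype.card κ : ℝ) / 64) / (4 * B) * ∑ i, w i ^ 2} ≤
      P₁ {Z | φ < resolventTrace (gramSum Z) δ} +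
        ENNReal.ofReal (Real.exp (2 * (j * (2 * δ * φ)) -
          Fintype.card κ / (4 * (288 * H ^ 4)))) := by
  obtain ⟨M, hM⟩ : ∃ M : ℝ, M = Fintype.card κ := ⟨_, rfl⟩
  rw [← hM] at hBj hcB ⊢
  have hM0 : 0 ≤ M := hM ▸ Nat.cast_nonneg _
  obtain ⟨S, hS⟩ : ∃ S : Set ((Fin m → ι → ℝ) × (κ → ι → ℝ)),
      S = {z | (∀ v, sqForm z.2 v ≤ B * ∑ i, v i ^ 2) ∧
        ∃ w, sqForm z.1 w + sqForm z.2 w < δ * (M / 64) / (4 * B) * ∑ i, w i ^ 2} := ⟨_, rfl⟩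
  have hcont1 : ∀ v, Continuous fun z : (Fin m → ι → ℝ) × (κ → ι → ℝ) => sqForm z.1 v :=
    fun v => by unfold sqForm; fun_prop
  have hcont2 : ∀ v, Continuous fun z : (Fin m → ι → ℝ) × (κ → ι → ℝ) => sqForm z.2 v :=
    fun v => by unfold sqForm; fun_prop
  have hSm : MeasurableSet S := by
    have h1 : S = (⋂ v, {z | sqForm z.2 v ≤ B * ∑ i, v i ^ 2}) ∩
        ⋃ w, {z | sqForm z.1 w + sqForm z.2 w <
          δ * (M / 64) / (4 * B) * ∑ i, w i ^ 2} := by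
      ext z
      simp [hS]
    rw [h1]
    exact (isClosed_iInter fun v => isClosed_le (hcont2 v) continuous_const).measurableSet.inter
      (isOpen_iUnion fun w => isOpen_lt ((hcont1 w).add (hcont2 w))
        continuous_const).measurableSet
  obtain ⟨T, hT⟩ : ∃ T : Set (Fin m → ι → ℝ), T = {Z | φ < resolventTrace (gramSum Z) δ} :=
    ⟨_, rfl⟩
  have hTm : MeasurableSet T := by
    have h1 := continuous_resolventTrace_add hδ (Matrix.PosSemidef.zero (n := ι) (R := ℝ)) m
    simp only [zero_add] at h1
    rw [hT]
    exact (isOpen_lt continuous_const h1).measurableSet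
  obtain ⟨ε, hε⟩ : ∃ ε, ε = ENNReal.ofReal (Real.exp (2 * (j * (2 * δ * φ)) -
          M / (4 * (288 * H ^ 4)))) := ⟨_, rfl⟩
  rw [← hS, ← hT, ← hε, Measure.prod_apply hSm]
  have hslice : ∀ Z, (Measure.pi fun l => Measure.pi fun _ : ι => ρ l) (Prod.mk Z ⁻¹' S) ≤
      T.indicator 1 Z + ε := fun Z => by
    by_cases hZ : Z ∈ T
    · rw [Set.indicator_of_mem hZ]
      exact prob_le_one.trans le_self_add
    rw [Set.indicator_of_notMem hZ, zero_add]
    have hZφ : resolventTrace (gramSum Z) δ ≤ φ := by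
      rw [hT] at hZ
      exact not_lt.1 hZ
    obtain ⟨E, U, hcard, horth, hcomb⟩ :=
      exists_small_subspace (κ := κ) (gramSum_posSemidef Z) hδ hZφ
    have hlow := measure_sqForm_lt_le (P := fun l => Measure.pi fun _ : ι => ρ l)
      (Y := fun (_ : κ) (x : ι → ℝ) (e : E) => ∑ i, x i * U i e) (K := 288 * H ^ 4) (B := B)
      (fun l e => measurable_inner_pi _) (by positivity) (fun l u hu => by
        have h1 : ∀ x : ι → ℝ, ∑ e : E, (∑ i, x i * U i e) * u e =
            ∑ i, x i * ∑ e : E, U i e * u e := fun x => by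
          simp only [Finset.sum_mul, Finset.mul_sum]
          rw [Finset.sum_comm]
          exact Finset.sum_congr rfl fun i _ => Finset.sum_congr rfl fun e _ => by ring
        simp only [h1]
        exact lintegral_exp_neg_inner_sq_le (ρ := fun _ : ι => ρ l) (fun _ => h l) hH
          (fun _ _ _ => by rw [hc l, zero_mul]) ((horth u).trans hu)) hj hB.le (hM ▸ hBj)
    rw [← hM] at hlow
    refine (measure_mono ?_).trans (hlow.trans ?_)
    · intro x hx
      rw [Set.mem_preimage, hS] at hx
      obtain ⟨hup, w, hw⟩ := hx
      refine ⟨fun v => ?_, ?_⟩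
      · have h1 := hup fun i => ∑ e : E, U i e * v e
        rw [horth] at h1
        refine le_trans (le_of_eq ?_) h1
        refine Finset.sum_congr rfl fun l _ => ?_
        congr 1
        simp only [Finset.sum_mul, Finset.mul_sum]
        rw [Finset.sum_comm]
        exact Finset.sum_congr rfl fun i _ => Finset.sum_congr rfl fun e _ => by ring
      · by_contra hcon
        push Not at hcon
        have h2 := hcomb x B (M / 64) hB (by positivity) hcB hδB hup hcon w
        rw [dotProduct_gramSum_eq_sqForm] at h2
        exact absurd h2 (not_le.2 hw)
    · rw [hε]
      refine ENNReal.ofReal_le_ofReal (Real.exp_le_exp.2 ?_)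
      have h3 : (j : ℝ) * (Fintype.card E : ℝ) ≤ j * (2 * δ * φ) := by
        rw [Fintype.card_coe]
        exact mul_le_mul_of_nonneg_left hcard (Nat.cast_nonneg _)
      linarith
  calc ∫⁻ Z, (Measure.pi fun l => Measure.pi fun _ : ι => ρ l) (Prod.mk Z ⁻¹' S) ∂P₁
      ≤ ∫⁻ Z, (T.indicator 1 Z + ε) ∂P₁ := lintegral_mono hslice
    _ = P₁ T + ε := by
        rw [lintegral_add_right _ measurable_const, lintegral_indicator_one hTm]
        simp

end TwoGroups

/-! ### Independent columns: bounds with exponentially small failure probability -/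

section Rectangular

variable {ι κ : Type*} [Fintype ι] [Fintype κ] {ρ : κ → Measure ℝ}
  [∀ l, IsProbabilityMeasure (ρ l)] {H : ℝ}

theorem measure_sum_sq_gt_le {ρ : Measure ℝ} [IsProbabilityMeasure ρ]
    (h : IsUnitSubGaussian H ρ) :
    (Measure.pi fun _ : ι => ρ) {z | 3 * H ^ 2 * Fintype.card ι < ∑ i, z i ^ 2} ≤
      ENNReal.ofReal (Real.exp (-Fintype.card ι)) := by
  have hH := h.pos
  have hY : ∀ (_ : ι) (_ : Unit), Measurable fun x : ℝ => x := fun _ _ => measurable_id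
  have h2 : (2 : ℝ) ≤ Real.exp 1 := by linarith [Real.add_one_le_exp (1 : ℝ)]
  refine (measure_mono ?_).trans ((measure_exp_sqForm_le (P := fun _ : ι => ρ) (ι := Unit)
    (Y := fun _ x _ => x) hY (w := fun _ => 1) (H ^ 2)⁻¹ (3 * Fintype.card ι) (u := fun _ => 1)
    fun _ => ?_).trans ?_)
  · intro z hz
    rw [Set.mem_ofPred_eq] at hz ⊢
    simp only [sqForm, Finset.univ_unique, Finset.sum_singleton, mul_one]
    rw [← div_eq_inv_mul, le_div_iff₀ (by positivity)]
    linarith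
  · simp only [Finset.univ_unique, Finset.sum_singleton, mul_one, ← div_eq_inv_mul]
    refine h.exp_sq.trans ?_
    rw [show (2 : ℝ≥0∞) = ENNReal.ofReal 2 by simp]
    exact ENNReal.ofReal_le_ofReal h2
  · refine ENNReal.ofReal_le_ofReal (Real.exp_le_exp.2 ?_)
    simp only [Finset.sum_const, Finset.card_univ, nsmul_eq_mul, mul_one]
    have : (0 : ℝ) ≤ Fintype.card ι := Nat.cast_nonneg _
    linarith

/-- Upper bound for a weighted form of independent columns. The columns are centred, except
possibly one, whose contribution is bounded by its squared norm. The constant `80` is the `10` of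
`sqForm_le_of_net` times the `8` of `lintegral_exp_sq_le_of_laplace`; `243 = 80 * 3 + 3` collects
the cardinality of the net, the probability, and the column that is not centred. -/
theorem measure_weighted_gt_le (h : ∀ l, IsUnitSubGaussian H (ρ l)) (hH : 0 < H)
    (hc : ∀ l l', l ≠ l' → (∫ x, x ∂(ρ l)) * ∫ x, x ∂(ρ l') = 0) {w : κ → ℝ}
    (hw0 : ∀ l, 0 ≤ w l) (hw1 : ∀ l, w l ≤ 1) {B : ℝ}
    (hB : H ^ 2 * (80 * ∑ l, w l + 243 * Fintype.card ι) ≤ B) :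
    (Measure.pi fun l => Measure.pi fun _ : ι => ρ l)
      {Z | ∃ u : ι → ℝ, B * ∑ i, u i ^ 2 < ∑ l, w l * (∑ i, Z l i * u i) ^ 2} ≤
      ENNReal.ofReal (2 * Real.exp (-Fintype.card ι)) := by
  classical
  obtain ⟨n, hn⟩ : ∃ n : ℝ, n = Fintype.card ι := ⟨_, rfl⟩
  rw [← hn] at hB ⊢
  let Cen : κ → Prop := fun l => ∫ x, x ∂(ρ l) = 0
  let Y : κ → (ι → ℝ) → ι → ℝ := fun l x i => if Cen l then √(w l) * x i else 0
  let v : κ → ℝ := fun l => if Cen l then w l else 0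
  have hv : ∑ l, v l ≤ ∑ l, w l := Finset.sum_le_sum fun l _ => by
    by_cases hl : Cen l <;> simp [v, hl, hw0 l]
  have hv0 : 0 ≤ ∑ l, v l := Finset.sum_nonneg fun l _ => by
    by_cases hl : Cen l <;> simp [v, hl, hw0 l]
  have hYinner : ∀ l x (u : ι → ℝ), (∑ i, Y l x i * u i) ^ 2 =
      if Cen l then w l * (∑ i, x i * u i) ^ 2 else 0 := fun l x u => by
    by_cases hl : Cen l
    · simp only [Y, if_pos hl, mul_assoc]
      rw [← Finset.mul_sum, mul_pow, Real.sq_sqrt (hw0 l)]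
    · simp [Y, hl]
  have hbulk := measure_sqForm_gt_le (P := fun l => Measure.pi fun _ : ι => ρ l) (Y := Y)
    (w := v) (h := 8 * H ^ 2) (fun l i => by
      by_cases hl : Cen l
      · simp only [Y, if_pos hl]
        exact (measurable_pi_apply i).const_mul _
      · simp only [Y, if_neg hl]
        exact measurable_const) (by positivity) hv0 (fun l u hu => by
      simp only [hYinner]
      by_cases hl : Cen l
      · simp only [if_pos hl, v]
        have h1 := lintegral_exp_mul_sq_le_of_laplace
          (P := Measure.pi fun _ : ι => ρ l) (measurable_inner_pi u) hH
          (lintegral_exp_inner_le_of_centered (ρ := fun _ : ι => ρ l) (fun _ => h l)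
            (fun _ => hl) hu) (hw0 l) (hw1 l)
        refine le_trans (le_of_eq (lintegral_congr fun x => ?_)) h1
        congr 2
        field_simp
      · simp [hl, v]) (N := n) hn.ge
  have hsub : {Z : κ → ι → ℝ | ∃ u : ι → ℝ, B * ∑ i, u i ^ 2 <
      ∑ l, w l * (∑ i, Z l i * u i) ^ 2} ⊆
      {Z | ∃ u, 10 * (8 * H ^ 2 * (∑ l, v l + 3 * n)) * ∑ i, u i ^ 2 <
        sqForm (fun l => Y l (Z l)) u} ∪
      {Z | ∃ l, ¬ Cen l ∧ 3 * H ^ 2 * n < ∑ i, Z l i ^ 2} := by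
    rintro Z ⟨u, hu⟩
    by_contra hcon
    simp only [Set.mem_union, Set.mem_ofPred_eq, not_or, not_exists, not_and, not_lt] at hcon
    obtain ⟨h1, h2⟩ := hcon
    have h3 : ∑ l, w l * (∑ i, Z l i * u i) ^ 2 = sqForm (fun l => Y l (Z l)) u +
        ∑ l, if Cen l then 0 else w l * (∑ i, Z l i * u i) ^ 2 := by
      simp only [sqForm, hYinner]
      rw [← Finset.sum_add_distrib]
      exact Finset.sum_congr rfl fun l _ => by by_cases hl : Cen l <;> simp [hl]
    have hu0 : 0 ≤ ∑ i, u i ^ 2 := Finset.sum_nonneg fun i _ => sq_nonneg _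
    have hn0 : 0 ≤ n := hn ▸ Nat.cast_nonneg _
    have h4 : ∑ l, (if Cen l then 0 else w l * (∑ i, Z l i * u i) ^ 2) ≤
        3 * H ^ 2 * n * ∑ i, u i ^ 2 := by
      by_cases hall : ∀ l, Cen l
      · simp only [hall, if_true, Finset.sum_const_zero]
        positivity
      · push Not at hall
        obtain ⟨l₀, hl₀⟩ := hall
        rw [Finset.sum_eq_single l₀ (fun l _ hl => if_pos
          ((mul_eq_zero.1 (hc l l₀ hl)).resolve_right hl₀)) (by simp), if_neg hl₀]
        calc w l₀ * (∑ i, Z l₀ i * u i) ^ 2 ≤ (∑ i, Z l₀ i * u i) ^ 2 :=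
              mul_le_of_le_one_left (sq_nonneg _) (hw1 l₀)
          _ ≤ (∑ i, Z l₀ i ^ 2) * ∑ i, u i ^ 2 := Finset.sum_mul_sq_le_sq_mul_sq _ _ _
          _ ≤ _ := mul_le_mul_of_nonneg_right (h2 l₀ hl₀) hu0
    have h5 : 10 * (8 * H ^ 2 * (∑ l, v l + 3 * n)) + 3 * H ^ 2 * n ≤ B := by
      refine le_trans ?_ hB
      have : H ^ 2 * ∑ l, v l ≤ H ^ 2 * ∑ l, w l := mul_le_mul_of_nonneg_left hv (by positivity)
      nlinarith
    have h6 := mul_le_mul_of_nonneg_right h5 hu0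
    have h7 := h1 u
    linarith
  have hmean : (Measure.pi fun l => Measure.pi fun _ : ι => ρ l)
      {Z | ∃ l, ¬ Cen l ∧ 3 * H ^ 2 * n < ∑ i, Z l i ^ 2} ≤ ENNReal.ofReal (Real.exp (-n)) := by
    by_cases hall : ∀ l, Cen l
    · simp [hall]
    · push Not at hall
      obtain ⟨l₀, hl₀⟩ := hall
      have hT : MeasurableSet {z : ι → ℝ | 3 * H ^ 2 * n < ∑ i, z i ^ 2} :=
        (isOpen_lt continuous_const (by fun_prop)).measurableSet
      have h1 := measure_sum_sq_gt_le (ι := ι) (h l₀)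
      rw [← hn] at h1
      refine (measure_mono ?_).trans (((measurePreserving_eval
        (fun l => Measure.pi fun _ : ι => ρ l) l₀).measure_preimage
        hT.nullMeasurableSet).le.trans h1)
      rintro Z ⟨l, hl, hlt⟩
      have : l = l₀ := by
        by_contra hne
        exact ((mul_eq_zero.1 (hc l l₀ hne)).elim hl hl₀)
      subst this
      exact hlt
  refine (measure_mono hsub).trans ((measure_union_le _ _).trans ((add_le_add hbulk hmean).trans
    (le_of_eq ?_)))
  rw [← ENNReal.ofReal_add (Real.exp_pos _).le (Real.exp_pos _).le, two_mul]

end Rectangular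

theorem resolventTrace_zero {ι : Type*} [Fintype ι] [DecidableEq ι] {u : ℝ} (hu : u ≠ 0) :
    resolventTrace (0 : Matrix ι ι ℝ) u = Fintype.card ι / u := by
  have h : (u • (1 : Matrix ι ι ℝ) + 0)⁻¹ = u⁻¹ • 1 := by
    refine Matrix.inv_eq_right_inv ?_
    rw [add_zero, smul_mul_smul_comm, mul_inv_cancel₀ hu, one_mul, one_smul]
  rw [resolventTrace, h, Matrix.trace_smul, Matrix.trace_one, smul_eq_mul, inv_mul_eq_div]

/-- The barrier argument with `m ≥ (1 + γ) n` columns: the barrier starts at `γ n / 2`, where the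
trace of the resolvent is `2 / γ`, and moves by at most `γ / (2 (1 + γ))` per column, which is less
than `1 / (1 + φ)` for `φ = 2 / γ + 1 / 2`. -/
theorem exists_measure_resolventTrace_gt_le {γ H θ : ℝ} (hγ : 0 < γ) (hθ : 0 < θ)
    (hθγ : θ ≤ γ / 2) :
    ∃ (c : ℝ) (n₀ : ℕ), 0 < c ∧ ∀ n : ℕ, n₀ ≤ n → ∀ m : ℕ, (1 + γ) * n ≤ m →
      (m : ℝ) ≤ (2 + γ) * n → ∀ (ρ : Fin m → Measure ℝ) [∀ l, IsProbabilityMeasure (ρ l)],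
      (∀ l, IsUnitSubGaussian H (ρ l)) → (∀ l, ∫ x, x ∂(ρ l) = 0) →
      (Measure.pi fun l : Fin m => Measure.pi fun _ : Fin n => ρ l)
        {Z | 2 / γ + 1 / 2 < resolventTrace (gramSum Z) (θ * n)} ≤
        ENNReal.ofReal (Real.exp (-(c * n))) := by
  obtain ⟨φ, hφ⟩ : ∃ φ, φ = 2 / γ + 1 / 2 := ⟨_, rfl⟩
  obtain ⟨s₁, hs₁⟩ : ∃ s₁, s₁ = γ / (2 * (1 + γ)) := ⟨_, rfl⟩
  have hs₁0 : 0 < s₁ := by rw [hs₁]; positivity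
  have hφ0 : 0 < φ := by rw [hφ]; positivity
  obtain ⟨R₀, hR₀⟩ : ∃ R₀, R₀ = s₁ / θ ^ 2 + 1 / θ + 1 := ⟨_, rfl⟩
  have hR₀1 : 1 ≤ R₀ := by
    have : 0 ≤ s₁ / θ ^ 2 + 1 / θ := by positivity
    linarith
  obtain ⟨r₀, hr₀⟩ : ∃ r₀, r₀ = 1 / (4 * (2 + γ) * R₀ ^ 2) := ⟨_, rfl⟩
  have hr₀0 : 0 < r₀ := by rw [hr₀]; positivity
  have hlim : Tendsto (fun n : ℕ => (1 + φ + s₁ / θ ^ 2 * (n : ℝ)⁻¹)⁻¹ -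
      (2 + 4 * H ^ 4) / θ * (n : ℝ)⁻¹) atTop (𝓝 ((1 + φ + s₁ / θ ^ 2 * 0)⁻¹ -
      (2 + 4 * H ^ 4) / θ * 0)) := by
    have h0 : Tendsto (fun n : ℕ => (n : ℝ)⁻¹) atTop (𝓝 0) := tendsto_inv_atTop_nhds_zero_nat
    exact ((tendsto_const_nhds.add (h0.const_mul _)).inv₀ (by positivity)).sub (h0.const_mul _)
  have hslt : s₁ < (1 + φ + s₁ / θ ^ 2 * 0)⁻¹ - (2 + 4 * H ^ 4) / θ * 0 := by
    rw [mul_zero, mul_zero, add_zero, sub_zero, hs₁, hφ, lt_inv_comm₀ (by positivity)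
      (by positivity), inv_div]
    have : 2 * (1 + γ) / γ = 2 / γ + 2 := by field_simp
    rw [this]
    linarith
  obtain ⟨n₀, hn₀⟩ := eventually_atTop.1 (hlim.eventually (le_mem_nhds hslt))
  refine ⟨r₀ / 4, max n₀ 1, by positivity, fun n hn m hm1 hm2 ρ _ h hc => ?_⟩
  have hn1 : 1 ≤ n := le_trans (le_max_right _ _) hn
  have hnpos : (0 : ℝ) < n := by exact_mod_cast hn1
  have hmpos : (0 : ℝ) < m := lt_of_lt_of_le (by positivity) hm1
  have hnn := hn₀ n (le_trans (le_max_left _ _) hn)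
  obtain ⟨δ, hδ⟩ : ∃ δ, δ = θ * n := ⟨_, rfl⟩
  have hδ0 : 0 < δ := by rw [hδ]; positivity
  obtain ⟨s, hs⟩ : ∃ s, s = (γ / 2 - θ) * n / m := ⟨_, rfl⟩
  have hs0 : 0 ≤ s := by
    rw [hs]
    exact div_nonneg (mul_nonneg (by linarith) hnpos.le) hmpos.le
  have hss₁ : s ≤ s₁ := by
    calc s ≤ γ / 2 * n / ((1 + γ) * n) := by
          rw [hs]
          have : γ / 2 - θ ≤ γ / 2 := by linarith
          gcongr
      _ = s₁ := by rw [hs₁]; field_simp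
  have hend : δ + m * s = γ / 2 * n := by
    rw [hs, hδ]
    field_simp
    ring
  obtain ⟨R, hR⟩ : ∃ R, R = s * ((Fintype.card (Fin n) : ℝ) * δ⁻¹ ^ 2) + δ⁻¹ := ⟨_, rfl⟩
  have hcard : (Fintype.card (Fin n) : ℝ) * δ⁻¹ ^ 2 = 1 / θ ^ 2 * (n : ℝ)⁻¹ := by
    rw [Fintype.card_fin, hδ]
    field_simp
  have hRn : n * R ≤ R₀ := by
    have h1 : n * R = s / θ ^ 2 + 1 / θ := by
      rw [hR, hcard, hδ]
      field_simp
    rw [h1, hR₀]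
    have : s / θ ^ 2 ≤ s₁ / θ ^ 2 := by gcongr
    linarith
  have hR0 : 0 ≤ R := by rw [hR]; positivity
  have hrR : r₀ * n * R ≤ r₀ * R₀ := by
    rw [mul_assoc]
    gcongr
  have hrR1 : r₀ * R₀ ≤ 1 := by
    have h1 : r₀ * R₀ = 1 / (4 * (2 + γ) * R₀) := by rw [hr₀]; field_simp
    rw [h1, div_le_one (by positivity)]
    nlinarith
  have hsφ : s ≤ (1 + φ + s * ((Fintype.card (Fin n) : ℝ) * δ⁻¹ ^ 2))⁻¹ -
      (2 + 4 * H ^ 4) * δ⁻¹ := by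
    have h1 : (1 + φ + s₁ / θ ^ 2 * (n : ℝ)⁻¹)⁻¹ ≤
        (1 + φ + s * ((Fintype.card (Fin n) : ℝ) * δ⁻¹ ^ 2))⁻¹ := by
      refine inv_anti₀ (by positivity) ?_
      have h2 : s * ((Fintype.card (Fin n) : ℝ) * δ⁻¹ ^ 2) ≤ s₁ / θ ^ 2 * (n : ℝ)⁻¹ := by
        rw [hcard]
        calc s * (1 / θ ^ 2 * (n : ℝ)⁻¹) ≤ s₁ * (1 / θ ^ 2 * (n : ℝ)⁻¹) := by gcongr
          _ = _ := by ring
      linarith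
    have h3 : (2 + 4 * H ^ 4) * δ⁻¹ = (2 + 4 * H ^ 4) / θ * (n : ℝ)⁻¹ := by
      rw [hδ]
      field_simp
    rw [h3]
    linarith
  have hmain := measure_resolventTrace_gt_le (ι := Fin n) m ρ h hc Matrix.PosSemidef.zero hδ0 hs0
    (r := r₀ * n) (by positivity) hR (hrR.trans hrR1) hsφ
  simp only [zero_add] at hmain
  rw [hδ, hφ] at hmain
  refine hmain.trans (ENNReal.ofReal_le_ofReal (Real.exp_le_exp.2 ?_))
  rw [← hδ, hend, resolventTrace_zero (by positivity), Fintype.card_fin]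
  have h4 : (n : ℝ) / (γ / 2 * n) = 2 / γ := by field_simp
  have h5 : m * (r₀ * n * R) ^ 2 ≤ (2 + γ) * n * (r₀ * R₀) ^ 2 := by gcongr
  have h6 : (2 + γ) * n * (r₀ * R₀) ^ 2 = r₀ / 4 * n := by
    have : (r₀ * R₀) ^ 2 = r₀ * (r₀ * R₀ ^ 2) := by ring
    rw [this]
    nth_rw 2 [hr₀]
    field_simp
  rw [h4]
  linarith

/-- Lower bound for the least singular value of a matrix with `n` rows and independent centred
sub-Gaussian columns, whose number exceeds `n` by a constant factor. -/
theorem exists_measure_two_groups_lt_le {γ H : ℝ} (hγ : 0 < γ) (hH : 1 ≤ H) :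
    ∃ (c c₁ : ℝ) (n₀ : ℕ), 0 < c ∧ 0 < c₁ ∧ ∀ n : ℕ, n₀ ≤ n → ∀ m m' : ℕ, (1 + γ) * n ≤ m →
      (m : ℝ) ≤ (2 + γ) * n → γ * n ≤ m' → (m' : ℝ) ≤ (1 + γ) * n →
      ∀ (ρ : Fin m → Measure ℝ) [∀ l, IsProbabilityMeasure (ρ l)]
        (ρ' : Fin m' → Measure ℝ) [∀ l, IsProbabilityMeasure (ρ' l)],
      (∀ l, IsUnitSubGaussian H (ρ l)) → (∀ l, ∫ x, x ∂(ρ l) = 0) →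
      (∀ l, IsUnitSubGaussian H (ρ' l)) → (∀ l, ∫ x, x ∂(ρ' l) = 0) →
      ((Measure.pi fun l => Measure.pi fun _ : Fin n => ρ l).prod
        (Measure.pi fun l => Measure.pi fun _ : Fin n => ρ' l))
        {z | ∃ w, sqForm z.1 w + sqForm z.2 w < c * n * ∑ i, w i ^ 2} ≤
        ENNReal.ofReal (4 * Real.exp (-(c₁ * n))) := by
  have hH0 : 0 < H := by linarith
  obtain ⟨φ, hφ⟩ : ∃ φ, φ = 2 / γ + 1 / 2 := ⟨_, rfl⟩
  have hφ0 : 0 < φ := by rw [hφ]; positivity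
  obtain ⟨B₀, hB₀⟩ : ∃ B₀, B₀ = H ^ 2 * (80 * (1 + γ) + 243) := ⟨_, rfl⟩
  have hB₀0 : 0 < B₀ := by rw [hB₀]; positivity
  have hB₀1 : 1 + γ ≤ B₀ := by
    have : 1 ≤ H ^ 2 := one_le_pow₀ hH
    rw [hB₀]
    nlinarith
  obtain ⟨j, hj1, hj⟩ : ∃ j : ℕ, 1 ≤ j ∧ B₀ * (1 / 4) ^ j ≤ γ / 64 := by
    obtain ⟨j, hj⟩ := exists_pow_lt_of_lt_one (show 0 < γ / 64 / B₀ by positivity)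
      (show (1 / 4 : ℝ) < 1 by norm_num)
    refine ⟨j + 1, by lia, ?_⟩
    rw [lt_div_iff₀ hB₀0] at hj
    have : (1 / 4 : ℝ) ^ (j + 1) ≤ (1 / 4) ^ j :=
      pow_le_pow_of_le_one (by norm_num) (by norm_num) (by lia)
    nlinarith
  have hj0 : (0 : ℝ) < j := by exact_mod_cast hj1
  obtain ⟨K, hK⟩ : ∃ K, K = 288 * H ^ 4 := ⟨_, rfl⟩
  have hK0 : 0 < K := by rw [hK]; positivity
  -- small enough for the dimension of the space of small eigenvalues
  obtain ⟨θ, hθ⟩ : ∃ θ, θ = min (γ / 2) (γ / (32 * j * φ * K)) := ⟨_, rfl⟩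
  have hθ0 : 0 < θ := by rw [hθ]; positivity
  have hθ1 : θ ≤ γ / 2 := by rw [hθ]; exact min_le_left _ _
  have hθ2 : 4 * j * θ * φ ≤ γ / (8 * K) := by
    have h1 : θ ≤ γ / (32 * j * φ * K) := by rw [hθ]; exact min_le_right _ _
    calc 4 * j * θ * φ ≤ 4 * j * (γ / (32 * j * φ * K)) * φ := by gcongr
      _ = γ / (8 * K) := by field_simp; norm_num
  obtain ⟨c₂, n₀, hc₂, hbar⟩ := exists_measure_resolventTrace_gt_le (H := H) hγ hθ0 hθ1
  obtain ⟨c₁, hc₁⟩ : ∃ c₁, c₁ = min (min c₂ (γ / (8 * K))) 1 := ⟨_, rfl⟩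
  refine ⟨θ * γ / (256 * B₀), c₁, max n₀ 1, by positivity, by rw [hc₁]; positivity,
    fun n hn m m' hm1 hm2 hm'1 hm'2 ρ _ ρ' _ h hc h' hc' => ?_⟩
  have hn1 : 1 ≤ n := le_trans (le_max_right _ _) hn
  have hnpos : (0 : ℝ) < n := by exact_mod_cast hn1
  have hbar' := hbar n (le_trans (le_max_left _ _) hn) m hm1 hm2 ρ h hc
  rw [← hφ] at hbar'
  have htwo := measure_two_groups_lt_le
    (P₁ := Measure.pi fun l => Measure.pi fun _ : Fin n => ρ l) (ρ := ρ') (φ := φ)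
    (δ := θ * n) (B := B₀ * n) (j := j) hH0 h' hc' (by positivity) (by positivity) (by
      have : θ ≤ 2 * B₀ := by linarith
      nlinarith) hj1 (by
      rw [Fintype.card_fin]
      calc B₀ * n * (1 / 4) ^ j = B₀ * (1 / 4) ^ j * n := by ring
        _ ≤ γ / 64 * n := by gcongr
        _ ≤ m' / 64 := by linarith) (by
      rw [Fintype.card_fin]
      nlinarith)
  rw [Fintype.card_fin, ← hK] at htwo
  have hupper := measure_weighted_gt_le (ι := Fin n) (w := fun _ => 1) h' hH0
    (fun l l' _ => by rw [hc' l, zero_mul]) (fun _ => zero_le_one) (fun _ => le_rfl)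
    (B := B₀ * n) (by
      simp only [Finset.sum_const, Finset.card_univ, Fintype.card_fin, nsmul_eq_mul, mul_one]
      rw [hB₀, mul_assoc]
      refine mul_le_mul_of_nonneg_left ?_ (by positivity)
      linarith)
  rw [Fintype.card_fin] at hupper
  have hup2 : ((Measure.pi fun l => Measure.pi fun _ : Fin n => ρ l).prod
      (Measure.pi fun l => Measure.pi fun _ : Fin n => ρ' l))
      {z | ∃ v, B₀ * n * ∑ i, v i ^ 2 < sqForm z.2 v} ≤
      ENNReal.ofReal (2 * Real.exp (-n)) := by
    have hm : MeasurableSet {Z : Fin m' → Fin n → ℝ | ∃ v, B₀ * n * ∑ i, v i ^ 2 < sqForm Z v} := by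
      have : {Z : Fin m' → Fin n → ℝ | ∃ v, B₀ * n * ∑ i, v i ^ 2 < sqForm Z v} =
          ⋃ v, {Z | B₀ * n * ∑ i, v i ^ 2 < sqForm Z v} := by
        ext Z
        simp
      rw [this]
      refine (isOpen_iUnion fun v => isOpen_lt continuous_const ?_).measurableSet
      unfold sqForm
      fun_prop
    refine le_trans (le_of_eq ((measurePreserving_snd (μ := Measure.pi fun l =>
      Measure.pi fun _ : Fin n => ρ l)).measure_preimage hm.nullMeasurableSet)) ?_
    simp only [one_mul] at hupper
    exact hupper
  have hsub : {z : (Fin m → Fin n → ℝ) × (Fin m' → Fin n → ℝ) |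
      ∃ w, sqForm z.1 w + sqForm z.2 w < θ * γ / (256 * B₀) * n * ∑ i, w i ^ 2} ⊆
      {z | (∀ v, sqForm z.2 v ≤ B₀ * n * ∑ i, v i ^ 2) ∧
        ∃ w, sqForm z.1 w + sqForm z.2 w <
          θ * n * ((m' : ℝ) / 64) / (4 * (B₀ * n)) * ∑ i, w i ^ 2} ∪
      {z | ∃ v, B₀ * n * ∑ i, v i ^ 2 < sqForm z.2 v} := by
    rintro z ⟨w, hw⟩
    by_cases hz : ∃ v, B₀ * n * ∑ i, v i ^ 2 < sqForm z.2 v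
    · exact Or.inr hz
    · push Not at hz
      refine Or.inl ⟨hz, w, lt_of_lt_of_le hw (mul_le_mul_of_nonneg_right ?_
        (Finset.sum_nonneg fun i _ => sq_nonneg _))⟩
      calc θ * γ / (256 * B₀) * n = θ * n * (γ * n / 64) / (4 * (B₀ * n)) := by
            field_simp
            norm_num
        _ ≤ _ := by gcongr
  have he1 : Real.exp (-(c₂ * n)) ≤ Real.exp (-(c₁ * n)) := by
    have : c₁ ≤ c₂ := by rw [hc₁]; exact (min_le_left _ _).trans (min_le_left _ _)
    exact Real.exp_le_exp.2 (by nlinarith)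
  have he2 : Real.exp (2 * (j * (2 * (θ * n) * φ)) - m' / (4 * K)) ≤ Real.exp (-(c₁ * n)) := by
    have h1 : c₁ ≤ γ / (8 * K) := by rw [hc₁]; exact (min_le_left _ _).trans (min_le_right _ _)
    have h2 : γ * n / (4 * K) ≤ m' / (4 * K) := by gcongr
    have h3 : γ * n / (4 * K) = 2 * (γ / (8 * K) * n) := by field_simp; norm_num
    have h4 : 4 * j * θ * φ * n ≤ γ / (8 * K) * n := by gcongr
    have h5 : c₁ * n ≤ γ / (8 * K) * n := by gcongr
    exact Real.exp_le_exp.2 (by linarith)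
  have he3 : Real.exp (-n) ≤ Real.exp (-(c₁ * n)) := by
    have : c₁ ≤ 1 := by rw [hc₁]; exact min_le_right _ _
    exact Real.exp_le_exp.2 (by nlinarith)
  refine (measure_mono hsub).trans ((measure_union_le _ _).trans
    ((add_le_add (htwo.trans (add_le_add hbar' le_rfl)) hup2).trans ?_))
  rw [← ENNReal.ofReal_add (Real.exp_pos _).le (Real.exp_pos _).le,
    ← ENNReal.ofReal_add (by positivity) (by positivity)]
  exact ENNReal.ofReal_le_ofReal (by linarith)

/-! ### Independent features: from samples to independent columns -/

/-- Transposing a matrix of independent entries whose law depends on the column only. -/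
theorem map_pi_pi_swap {ι κ X : Type*} [Fintype ι] [Fintype κ] [MeasurableSpace X]
    (ρ : κ → Measure X) [∀ l, IsProbabilityMeasure (ρ l)] :
    (Measure.pi fun _ : ι => Measure.pi ρ).map (fun f l i => f i l) =
      Measure.pi fun l => Measure.pi fun _ : ι => ρ l := by
  have h1 : (Measure.pi fun _ : ι => Measure.pi ρ).map (fun f (q : κ × ι) => f q.2 q.1) =
      Measure.pi fun q : κ × ι => ρ q.1 := by
    refine (Measure.pi_eq fun s hs => ?_).symm
    rw [Measure.map_apply (by fun_prop) (MeasurableSet.univ_pi hs)]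
    have : (fun (f : ι → κ → X) (q : κ × ι) => f q.2 q.1) ⁻¹' Set.pi Set.univ s =
        Set.pi Set.univ fun i => Set.pi Set.univ fun l => s (l, i) := by
      ext f
      simp only [Set.mem_preimage, Set.mem_pi, Set.mem_univ, true_imp_iff, Prod.forall]
      exact forall_comm
    rw [this, Measure.pi_pi]
    simp only [Measure.pi_pi]
    rw [Fintype.prod_prod_type, Finset.prod_comm]
  have h2 : (Measure.pi fun l => Measure.pi fun _ : ι => ρ l).map
      (fun f (q : κ × ι) => f q.1 q.2) = Measure.pi fun q : κ × ι => ρ q.1 := by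
    refine (Measure.pi_eq fun s hs => ?_).symm
    rw [Measure.map_apply (by fun_prop) (MeasurableSet.univ_pi hs)]
    have : (fun (f : κ → ι → X) (q : κ × ι) => f q.1 q.2) ⁻¹' Set.pi Set.univ s =
        Set.pi Set.univ fun l => Set.pi Set.univ fun i => s (l, i) := by
      ext f
      simp only [Set.mem_preimage, Set.mem_pi, Set.mem_univ, true_imp_iff, Prod.forall]
    rw [this, Measure.pi_pi]
    simp only [Measure.pi_pi]
    rw [Fintype.prod_prod_type]
  have hcurry : Measurable fun (g : κ × ι → X) (l : κ) (i : ι) => g (l, i) := by fun_prop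
  calc (Measure.pi fun _ : ι => Measure.pi ρ).map (fun f l i => f i l)
      = ((Measure.pi fun _ : ι => Measure.pi ρ).map (fun f (q : κ × ι) => f q.2 q.1)).map
          fun g l i => g (l, i) := by
        rw [Measure.map_map hcurry (by fun_prop)]
        rfl
    _ = ((Measure.pi fun l => Measure.pi fun _ : ι => ρ l).map
          (fun f (q : κ × ι) => f q.1 q.2)).map fun g l i => g (l, i) := by rw [h1, h2]
    _ = _ := by
        rw [Measure.map_map hcurry (by fun_prop)]
        exact Measure.map_id

section Columns

variable {p : ℕ∞} {eig : Idx p → ℝ} {μ : Measure (Idx p → ℝ)}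

/-- The law of a whitened coordinate. -/
def coordLaw (eig : Idx p → ℝ) (μ : Measure (Idx p → ℝ)) (l : Idx p) : Measure ℝ :=
  μ.map fun x => whiten eig x l

instance [IsProbabilityMeasure μ] (l : Idx p) : IsProbabilityMeasure (coordLaw eig μ l) :=
  Measure.isProbabilityMeasure_map (measurable_whiten l).aemeasurable

theorem IndependentFeatures.isUnitSubGaussian {G : ℝ} (h : IndependentFeatures G eig μ)
    (hμ : IsFeatureLaw eig μ) (hG : 0 < G) (l : Idx p) :
    IsUnitSubGaussian (2 * G) (coordLaw eig μ l) where
  pos := by positivity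
  exp_sq := by
    have h1 : subGaussianNorm (fun x : Idx p → ℝ => whiten eig x l) μ < ENNReal.ofReal (2 * G) :=
      lt_of_le_of_lt (h.2 l) ((ENNReal.ofReal_lt_ofReal_iff (by positivity)).2 (by linarith))
    simp only [subGaussianNorm, iInf_lt_iff] at h1
    obtain ⟨t, ⟨ht0, ht⟩, htG⟩ := h1
    have htG' : t < 2 * G := (ENNReal.ofReal_lt_ofReal_iff (by positivity)).1 htG
    rw [coordLaw, lintegral_map (by fun_prop) (measurable_whiten l)]
    refine le_trans (lintegral_mono fun x => ?_) ht
    refine ENNReal.ofReal_le_ofReal (Real.exp_le_exp.2 ?_)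
    gcongr
  second_moment := by
    rw [coordLaw, integral_map (measurable_whiten l).aemeasurable (by fun_prop)]
    have := hμ.integral_whiten_mul l l
    simpa [sq] using this

/-- Independent coordinates are uncorrelated, while the second moment matrix is diagonal, so that
at most one of them is not centred. -/
theorem IndependentFeatures.mean_mul_mean {G : ℝ} (h : IndependentFeatures G eig μ)
    (hμ : IsFeatureLaw eig μ) {l l' : Idx p} (hl : l ≠ l') :
    (∫ x, x ∂(coordLaw eig μ l)) * ∫ x, x ∂(coordLaw eig μ l') = 0 := by
  have h1 := (h.1.indepFun hl).integral_fun_mul_eq_mul_integral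
    (measurable_whiten l).aestronglyMeasurable (measurable_whiten l').aestronglyMeasurable
  rw [hμ.integral_whiten_mul, if_neg hl] at h1
  rw [coordLaw, coordLaw, integral_map (measurable_whiten l).aemeasurable (by fun_prop),
    integral_map (measurable_whiten l').aemeasurable (by fun_prop)]
  exact h1.symm

theorem IndependentFeatures.map_whiten {G : ℝ} (h : IndependentFeatures G eig μ) {κ : Type*}
    [Fintype κ] {e : κ → Idx p} (he : Function.Injective e) :
    μ.map (fun x l => whiten eig x (e l)) = Measure.pi fun l => coordLaw eig μ (e l) :=
  (h.1.precomp he).map_fun_eq_pi_map fun l => (measurable_whiten (e l)).aemeasurable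

theorem le_card_headSet {N : ℕ} (hN : (N : ℕ∞) ≤ p) : N ≤ (headSet p N).card := by
  classical
  have h1 : Finset.range N ⊆ (headSet p N).image fun l => l.1 := fun i hi => by
    have hi' := Finset.mem_range.1 hi
    exact Finset.mem_image.2 ⟨⟨i, lt_of_lt_of_le (Nat.cast_lt.2 hi') hN⟩, by simpa using hi', rfl⟩
  calc N = (Finset.range N).card := (Finset.card_range N).symm
    _ ≤ _ := (Finset.card_le_card h1).trans Finset.card_image_le

/-- Between the levels `k` and `N` at least `N - k - 1` coordinates are centred. -/
theorem IndependentFeatures.exists_columns {G : ℝ} (h : IndependentFeatures G eig μ)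
    (hμ : IsFeatureLaw eig μ) {k N M : ℕ} (hN : (N : ℕ∞) ≤ p) (hM : M + k + 1 ≤ N)
    {κ : Type*} [Fintype κ] (hκ : Fintype.card κ = M) :
    ∃ e : κ → Idx p, Function.Injective e ∧ ∀ l, k ≤ (e l).1 ∧ (e l).1 < N ∧
      ∫ x, x ∂(coordLaw eig μ (e l)) = 0 := by
  classical
  let Cen : Idx p → Prop := fun l => ∫ x, x ∂(coordLaw eig μ l) = 0
  let T : Finset (Idx p) := ((headSet p N).filter fun l => k ≤ l.1).filter Cen
  have hbad : ((headSet p N).filter fun l => ¬ Cen l).card ≤ 1 := by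
    refine Finset.card_le_one.2 fun l hl l' hl' => ?_
    by_contra hne
    exact (mul_eq_zero.1 (h.mean_mul_mean hμ hne)).elim (Finset.mem_filter.1 hl).2
      (Finset.mem_filter.1 hl').2
  have hcover : headSet p N ⊆ T ∪ (headSet p k ∪ (headSet p N).filter fun l => ¬ Cen l) :=
    fun l hl => by
      simp only [T, Finset.mem_union, Finset.mem_filter, mem_headSet] at hl ⊢
      by_cases h1 : Cen l
      · by_cases h2 : k ≤ l.1
        · exact Or.inl ⟨⟨hl, h2⟩, h1⟩
        · exact Or.inr (Or.inl (not_le.1 h2))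
      · exact Or.inr (Or.inr ⟨hl, h1⟩)
  have hT : M ≤ T.card := by
    have h1 := (le_card_headSet hN).trans (Finset.card_le_card hcover)
    have h2 := Finset.card_union_le T (headSet p k ∪ (headSet p N).filter fun l => ¬ Cen l)
    have h3 := Finset.card_union_le (headSet p k) ((headSet p N).filter fun l => ¬ Cen l)
    have h4 := card_headSet_le p k
    lia
  obtain ⟨f⟩ := Function.Embedding.nonempty_of_card_le (α := κ) (β := T)
    (by rw [hκ, Fintype.card_coe]; exact hT)
  refine ⟨fun l => (f l).1, Subtype.val_injective.comp f.injective, fun l => ?_⟩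
  have := (f l).2
  simp only [T, Finset.mem_filter, mem_headSet] at this
  exact ⟨this.1.2, this.1.1, this.2⟩

variable [IsProbabilityMeasure μ]

/-- The whitened columns of a sample are independent, with i.i.d. entries. -/
theorem IndependentFeatures.map_columns {G : ℝ} (h : IndependentFeatures G eig μ) {κ : Type*}
    [Fintype κ] {e : κ → Idx p} (he : Function.Injective e) (n : ℕ) :
    (Measure.pi fun _ : Fin n => μ).map (fun X l i => whiten eig (X i) (e l)) =
      Measure.pi fun l => Measure.pi fun _ : Fin n => coordLaw eig μ (e l) := by
  have hf : Measurable fun (x : Idx p → ℝ) (l : κ) => whiten eig x (e l) :=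
    measurable_pi_lambda _ fun l => measurable_whiten (e l)
  have : IsProbabilityMeasure (μ.map fun (x : Idx p → ℝ) (l : κ) => whiten eig x (e l)) :=
    Measure.isProbabilityMeasure_map hf.aemeasurable
  rw [← map_pi_pi_swap (ι := Fin n), ← h.map_whiten he,
    ← Measure.pi_map_pi fun _ => hf.aemeasurable]
  exact (Measure.map_map (g := fun (f : Fin n → κ → ℝ) l i => f i l) (by fun_prop)
    (measurable_pi_lambda _ fun i => hf.comp (measurable_pi_apply i))).symm

theorem IndependentFeatures.measure_columns_le {G : ℝ} (h : IndependentFeatures G eig μ)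
    {κ : Type*} [Fintype κ] {e : κ → Idx p} (he : Function.Injective e) (n : ℕ)
    (s : Set (κ → Fin n → ℝ)) :
    (Measure.pi fun _ : Fin n => μ) {X | (fun l i => whiten eig (X i) (e l)) ∈ s} ≤
      (Measure.pi fun l => Measure.pi fun _ : Fin n => coordLaw eig μ (e l)) s := by
  rw [← h.map_columns he n]
  exact Measure.le_map_apply (measurable_pi_lambda _ fun l => measurable_pi_lambda _ fun i =>
    (measurable_whiten (e l)).comp (measurable_pi_apply i)).aemeasurable s

theorem colDot_sq_eq (hpos : ∀ l, 0 < eig l) {n : ℕ} (X : Fin n → Idx p → ℝ) (w : Fin n → ℝ)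
    (l : Idx p) : colDot X w l ^ 2 = eig l * (∑ i, whiten eig (X i) l * w i) ^ 2 := by
  have h1 : ∑ i, whiten eig (X i) l * w i = colDot X w l / √(eig l) := by
    rw [colDot, Finset.sum_div]
    exact Finset.sum_congr rfl fun i _ => by rw [whiten]; ring
  rw [h1, div_pow, Real.sq_sqrt (hpos l).le, mul_div_cancel₀ _ (hpos l).ne']

/-- Upper bound for the form of the tail, by finite truncations. -/
theorem IndependentFeatures.measure_tailForm_gt_le {G : ℝ} (h : IndependentFeatures G eig μ)
    (hμ : IsFeatureLaw eig μ) (hG : 0 < G) {k : ℕ} {L R B : ℝ} (hL0 : 0 < L)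
    (hL : ∀ l : Idx p, k ≤ l.1 → eig l ≤ L)
    (hR : ∀ t : Finset (Idx p), (∀ l ∈ t, k ≤ l.1) → ∑ l ∈ t, eig l ≤ L * R) (n : ℕ)
    (hB : L * ((2 * G) ^ 2 * (80 * R + 243 * n)) ≤ B) :
    (Measure.pi fun _ : Fin n => μ) {X | ∃ u : Fin n → ℝ, B * ∑ i, u i ^ 2 < tailForm k X u} ≤
      ENNReal.ofReal (2 * Real.exp (-n)) := by
  classical
  let S : ℕ → Finset (Idx p) := fun D => (headSet p D).filter fun l => k ≤ l.1
  have hSmono : Monotone S := fun D D' hD l hl => by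
    simp only [S, Finset.mem_filter, mem_headSet] at hl ⊢
    exact ⟨lt_of_lt_of_le hl.1 hD, hl.2⟩
  let Ev : ℕ → Set (Fin n → Idx p → ℝ) := fun D =>
    {X | ∃ u : Fin n → ℝ, B * ∑ i, u i ^ 2 < ∑ l ∈ S D, colDot X u l ^ 2}
  have hEvmono : Monotone Ev := fun D D' hD X ⟨u, hu⟩ => ⟨u, lt_of_lt_of_le hu
    (Finset.sum_le_sum_of_subset_of_nonneg (hSmono hD) fun _ _ _ => sq_nonneg _)⟩
  have hsub : {X | ∃ u : Fin n → ℝ, B * ∑ i, u i ^ 2 < tailForm k X u} ⊆ ⋃ D, Ev D := by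
    rintro X ⟨u, hu⟩
    by_contra hcon
    simp only [Ev, Set.mem_iUnion, Set.mem_ofPred_eq, not_exists, not_lt] at hcon
    refine absurd hu (not_lt.2 ?_)
    have h0 : 0 ≤ B * ∑ i, u i ^ 2 :=
      (Finset.sum_nonneg fun _ _ => sq_nonneg _).trans (hcon 0 u)
    refine Real.tsum_le_of_sum_le (fun l => ?_) (fun t => ?_)
    · split_ifs
      · positivity
      · exact le_rfl
    · refine le_trans ?_ (hcon (t.sup (fun l => l.1) + 1) u)
      rw [← Finset.sum_filter]
      refine Finset.sum_le_sum_of_subset_of_nonneg (fun l hl => ?_) fun _ _ _ => sq_nonneg _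
      rw [Finset.mem_filter] at hl
      simp only [S, Finset.mem_filter, mem_headSet]
      exact ⟨Nat.lt_succ_of_le (Finset.le_sup (f := fun l : Idx p => l.1) hl.1), hl.2⟩
  refine (measure_mono hsub).trans ?_
  rw [hEvmono.measure_iUnion]
  refine iSup_le fun D => ?_
  have hSk : ∀ l ∈ S D, k ≤ l.1 := fun l hl => (Finset.mem_filter.1 hl).2
  have hw := measure_weighted_gt_le (ι := Fin n) (κ := S D) (ρ := fun l => coordLaw eig μ l.1)
    (w := fun l => eig l.1 / L) (B := B / L) (fun l => h.isUnitSubGaussian hμ hG l.1)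
    (by positivity) (fun l l' hl => h.mean_mul_mean hμ fun h' => hl (Subtype.ext h'))
    (fun l => div_nonneg (hμ.eig_pos _).le hL0.le)
    (fun l => (div_le_one hL0).2 (hL l.1 (hSk l.1 l.2))) (by
      rw [le_div_iff₀ hL0, Fintype.card_fin]
      refine le_trans ?_ hB
      have h1 : ∑ l : S D, eig l.1 / L ≤ R := by
        rw [← Finset.sum_div, div_le_iff₀ hL0, Finset.sum_coe_sort (S D) eig]
        linarith [hR (S D) hSk]
      rw [mul_comm _ L]
      gcongr)
  rw [Fintype.card_fin] at hw
  refine le_trans (measure_mono fun X hX => ?_) ((h.measure_columns_le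
    (e := fun l : S D => l.1) Subtype.val_injective n _).trans hw)
  obtain ⟨u, hu⟩ := hX
  refine ⟨u, ?_⟩
  have h2 : ∑ l : S D, eig l.1 / L * (∑ i, whiten eig (X i) l.1 * u i) ^ 2 =
      (∑ l ∈ S D, colDot X u l ^ 2) / L := by
    rw [← Finset.sum_coe_sort (S D), Finset.sum_div]
    exact Finset.sum_congr rfl fun l _ => by rw [colDot_sq_eq hμ.eig_pos]; ring
  rw [h2, div_mul_eq_mul_div]
  gcongr

/-- Lower bound for the head of the whitened sample. -/
theorem IndependentFeatures.measure_head_lt_le {G : ℝ} (h : IndependentFeatures G eig μ)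
    (hμ : IsFeatureLaw eig μ) (hG : 0 < G) {k n j : ℕ} (hj : 1 ≤ j)
    (hBj : (2 * G) ^ 2 * (80 * k + 243 * n) * (1 / 4) ^ j ≤ (n : ℝ) / 64) :
    (Measure.pi fun _ : Fin n => μ)
      {X | ∃ v : Idx p → ℝ, ∑ i, (∑ l ∈ headSet p k, whiten eig (X i) l * v l) ^ 2 <
        n / 64 * ∑ l ∈ headSet p k, v l ^ 2} ≤
      ENNReal.ofReal (2 * Real.exp (-n)) +
        ENNReal.ofReal (Real.exp (2 * (j * k) - n / (4 * (288 * (2 * G) ^ 4)))) := by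
  classical
  obtain ⟨B, hB⟩ : ∃ B, B = (2 * G) ^ 2 * (80 * (k : ℝ) + 243 * n) := ⟨_, rfl⟩
  have hB0 : 0 ≤ B := by rw [hB]; positivity
  rw [← hB] at hBj
  have hcard : Fintype.card (headSet p k) ≤ k := by
    rw [Fintype.card_coe]
    exact card_headSet_le p k
  have hinj : Function.Injective fun l : headSet p k => l.1 := Subtype.val_injective
  have hlow := measure_sqForm_lt_le (κ := Fin n) (ι := headSet p k) (P := fun _ => μ)
    (Y := fun _ x l => whiten eig x l.1) (K := 288 * (2 * G) ^ 4) (B := B)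
    (fun _ l => measurable_whiten l.1) (by positivity) (fun _ u hu => by
      have h1 := lintegral_exp_neg_inner_sq_le (ρ := fun l : headSet p k => coordLaw eig μ l.1)
        (fun l => h.isUnitSubGaussian hμ hG l.1) (by positivity)
        (fun l l' hl => h.mean_mul_mean hμ fun h' => hl (Subtype.ext h')) hu
      rw [← h.map_whiten hinj, lintegral_map
        (((measurable_inner_pi u).pow_const 2).const_mul _).exp.ennreal_ofReal
        (measurable_pi_lambda _ fun l => measurable_whiten l.1)] at h1
      exact h1) hj hB0 (by rwa [Fintype.card_fin])
  have hup := measure_weighted_gt_le (ι := Fin n) (κ := headSet p k)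
    (ρ := fun l => coordLaw eig μ l.1) (w := fun _ => 1) (B := B)
    (fun l => h.isUnitSubGaussian hμ hG l.1) (by positivity)
    (fun l l' hl => h.mean_mul_mean hμ fun h' => hl (Subtype.ext h')) (fun _ => zero_le_one)
    (fun _ => le_rfl) (by
      simp only [Finset.sum_const, Finset.card_univ, nsmul_eq_mul, mul_one]
      rw [hB, Fintype.card_fin]
      have : (Fintype.card (headSet p k) : ℝ) ≤ k := by exact_mod_cast hcard
      gcongr)
  rw [Fintype.card_fin] at hup hlow
  have hup' := (h.measure_columns_le hinj n _).trans hup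
  refine le_trans (measure_mono ?_) ((measure_union_le _ _).trans (add_le_add hup'
    (hlow.trans (ENNReal.ofReal_le_ofReal (Real.exp_le_exp.2 ?_)))))
  · rintro X ⟨v, hv⟩
    by_cases hbad : ∃ u : Fin n → ℝ, B * ∑ i, u i ^ 2 <
        ∑ l : headSet p k, 1 * (∑ i, whiten eig (X i) l.1 * u i) ^ 2
    · exact Or.inl hbad
    · push Not at hbad
      refine Or.inr ⟨fun u => ?_, fun l => v l.1, ?_⟩
      · exact sum_sq_transpose_le (Z := fun (l : headSet p k) i => whiten eig (X i) l.1) hB0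
          (fun u => by simpa only [one_mul] using hbad u) u
      · simp only [sqForm]
        rw [Finset.sum_coe_sort (headSet p k) fun l => v l ^ 2]
        refine lt_of_le_of_lt (le_of_eq (Finset.sum_congr rfl fun i _ => ?_)) hv
        rw [Finset.sum_coe_sort (headSet p k) fun l => whiten eig (X i) l * v l]
  · have h2 : (j : ℝ) * (Fintype.card (headSet p k) : ℝ) ≤ j * k := by
      have : (Fintype.card (headSet p k) : ℝ) ≤ k := by exact_mod_cast hcard
      gcongr
    linarith

theorem sum_sqForm_le_tailForm (hpos : ∀ l, 0 < eig l) {n k : ℕ} {X : Fin n → Idx p → ℝ}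
    (hX : ∀ i, Summable fun l => X i l ^ 2) {κ : Type*} [Fintype κ] {e : κ → Idx p}
    (he : Function.Injective e) (hk : ∀ l, k ≤ (e l).1) {c : ℝ} (hc : ∀ l, c ≤ eig (e l))
    (w : Fin n → ℝ) :
    c * sqForm (fun l i => whiten eig (X i) (e l)) w ≤ tailForm k X w := by
  classical
  calc c * sqForm (fun l i => whiten eig (X i) (e l)) w
      ≤ ∑ l, colDot X w (e l) ^ 2 := by
        rw [sqForm, Finset.mul_sum]
        refine Finset.sum_le_sum fun l _ => ?_
        rw [colDot_sq_eq hpos]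
        exact mul_le_mul_of_nonneg_right (hc l) (sq_nonneg _)
    _ = ∑ l ∈ Finset.univ.image e, if k ≤ l.1 then colDot X w l ^ 2 else 0 := by
        rw [Finset.sum_image fun l _ l' _ hll => he hll]
        exact Finset.sum_congr rfl fun l _ => (if_pos (hk l)).symm
    _ ≤ tailForm k X w := (summable_tailForm hX k w).sum_le_tsum _ fun l _ => by
        split_ifs
        · positivity
        · exact le_rfl

end Columns

/-! ### Independent features: choice of the truncation levels -/

section Independent

variable {p : ℕ∞} {eig : Idx p → ℝ} {μ : Measure (Idx p → ℝ)}

theorem IndependentFeatures.mono {G G' : ℝ} (h : IndependentFeatures G eig μ) (hG : G ≤ G') :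
    IndependentFeatures G' eig μ :=
  ⟨h.1, fun k => (h.2 k).trans (ENNReal.ofReal_le_ofReal hG)⟩

variable [IsProbabilityMeasure μ]

/-- Events on two disjoint groups of whitened columns, in terms of the product law of the groups. -/
theorem IndependentFeatures.measure_two_groups_le {G : ℝ} (h : IndependentFeatures G eig μ)
    {κ κ' : Type*} [Fintype κ] [Fintype κ'] {e : κ ⊕ κ' → Idx p} (he : Function.Injective e)
    (n : ℕ) (s : Set ((κ → Fin n → ℝ) × (κ' → Fin n → ℝ))) :
    (Measure.pi fun _ : Fin n => μ) {X | ((fun l i => whiten eig (X i) (e (.inl l))),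
      (fun l i => whiten eig (X i) (e (.inr l)))) ∈ s} ≤
      ((Measure.pi fun l => Measure.pi fun _ : Fin n => coordLaw eig μ (e (.inl l))).prod
        (Measure.pi fun l => Measure.pi fun _ : Fin n => coordLaw eig μ (e (.inr l)))) s := by
  refine (h.measure_columns_le he n
    (MeasurableEquiv.sumPiEquivProdPi (fun _ : κ ⊕ κ' => Fin n → ℝ) ⁻¹' s)).trans (le_of_eq ?_)
  exact (measurePreserving_sumPiEquivProdPi
    fun l : κ ⊕ κ' => Measure.pi fun _ : Fin n => coordLaw eig μ (e l)).measure_preimage_equiv s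

/-- The variance bound, given a lower bound `htwo` for the least singular value of a matrix with
`n` rows and `m + m'` independent centred columns. The columns are taken among the coordinates
between the levels `k` and `N`. -/
theorem IndependentFeatures.measure_not_varianceBound_le {ν : Measure ℝ} [IsProbabilityMeasure ν]
    {G σ lam : ℝ} (h : IndependentFeatures G eig μ) (hμ : IsFeatureLaw eig μ)
    (hν : IsNoiseLaw σ ν) (hG : 0 < G) (hlam : 0 ≤ lam) {n m m' N k j : ℕ} (hn : 1 ≤ n)
    (hN : (N : ℕ∞) ≤ p) (hM : m + m' + k + 1 ≤ N) {s L R S c B : ℝ} {δ : ℝ≥0∞} (hs0 : 0 < s)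
    (hs : ∀ l : Idx p, l.1 < N → s ≤ eig l) (hc : 0 < c)
    (htwo : ∀ (ρ : Fin m → Measure ℝ) [∀ l, IsProbabilityMeasure (ρ l)]
      (ρ' : Fin m' → Measure ℝ) [∀ l, IsProbabilityMeasure (ρ' l)],
      (∀ l, IsUnitSubGaussian (2 * G) (ρ l)) → (∀ l, ∫ x, x ∂(ρ l) = 0) →
      (∀ l, IsUnitSubGaussian (2 * G) (ρ' l)) → (∀ l, ∫ x, x ∂(ρ' l) = 0) →
      ((Measure.pi fun l => Measure.pi fun _ : Fin n => ρ l).prod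
        (Measure.pi fun l => Measure.pi fun _ : Fin n => ρ' l))
        {z | ∃ w, sqForm z.1 w + sqForm z.2 w < c * n * ∑ i, w i ^ 2} ≤ δ)
    (hL0 : 0 < L) (hL : ∀ l : Idx p, k ≤ l.1 → eig l ≤ L)
    (hR : ∀ t : Finset (Idx p), (∀ l ∈ t, k ≤ l.1) → ∑ l ∈ t, eig l ≤ L * R)
    (hS : L * ((2 * G) ^ 2 * (80 * R + 243 * n)) + n * lam ≤ S) (hj : 1 ≤ j)
    (hBj : (2 * G) ^ 2 * (80 * k + 243 * n) * (1 / 4) ^ j ≤ (n : ℝ) / 64)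
    (hB : n * (4 * S / (s * (c * n) * (n / 64)) + L / (s * (c * n))) * σ ^ 2 ≤ B) :
    (Measure.pi fun _ : Fin n => μ) {X | ¬ VarianceBound μ ν lam B X} ≤
      ENNReal.ofReal (2 * Real.exp (-n)) + (ENNReal.ofReal (2 * Real.exp (-n)) +
        ENNReal.ofReal (Real.exp (2 * (j * k) - n / (4 * (288 * (2 * G) ^ 4))))) + δ := by
  have hn0 : (0 : ℝ) < n := by exact_mod_cast hn
  have hR0 : 0 ≤ R := by
    have h1 := hR ∅ (by simp)
    rw [Finset.sum_empty] at h1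
    exact nonneg_of_mul_nonneg_right h1 hL0
  have hS0 : 0 < S := lt_of_lt_of_le (by positivity) hS
  obtain ⟨e, he, hek⟩ := h.exists_columns hμ hN hM (κ := Fin m ⊕ Fin m')
    (by rw [Fintype.card_sum, Fintype.card_fin, Fintype.card_fin])
  have hlow := (h.measure_two_groups_le he n _).trans (htwo
    (fun l => coordLaw eig μ (e (.inl l))) (fun l => coordLaw eig μ (e (.inr l)))
    (fun l => h.isUnitSubGaussian hμ hG _) (fun l => (hek _).2.2)
    (fun l => h.isUnitSubGaussian hμ hG _) (fun l => (hek _).2.2))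
  have hup := h.measure_tailForm_gt_le hμ hG hL0 hL hR n le_rfl
  have hhead := h.measure_head_lt_le hμ hG hj hBj
  refine le_trans ?_ ((measure_union_le _ _).trans (add_le_add
    ((measure_union_le _ _).trans (add_le_add hup hhead)) hlow))
  refine measure_mono_ae ?_
  filter_upwards [hμ.ae_rows_summable n] with X hX hbad
  by_contra hcon
  obtain ⟨hcon', hcon3⟩ := not_or.1 hcon
  obtain ⟨hcon1, hcon2⟩ := not_or.1 hcon'
  refine hbad (varianceBound_of_forms hμ hν hX k (s := s * (c * n)) (by positivity) hS0
    (τ := n / 64) (by positivity) hL0.le hlam hL (fun w => ?_) (fun w => ?_)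
    (fun v => not_lt.1 fun hv => hcon2 ⟨v, hv⟩) hB)
  · refine le_trans ?_ (sum_sqForm_le_tailForm hμ.eig_pos hX he (fun l => (hek l).1)
      (fun l => hs (e l) (hek l).2.1) w)
    have h1 := mul_le_mul_of_nonneg_left (not_lt.1 fun hw => hcon3 ⟨w, hw⟩) hs0.le
    rw [sqForm, Fintype.sum_sum_type]
    simp only [sqForm] at h1
    linarith
  · have hw : 0 ≤ ∑ i, w i ^ 2 := Finset.sum_nonneg fun i _ => sq_nonneg _
    have h1 := mul_le_mul_of_nonneg_right hS hw
    have h2 := not_lt.1 fun hw => hcon1 ⟨w, hw⟩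
    linarith

/-- The variance bound under independent features for one large sample size, with truncation
levels proportional to `n`. -/
theorem IndependentFeatures.measure_not_varianceBound_le_of_large {ν : Measure ℝ}
    [IsProbabilityMeasure ν] {a cE CE G σ lam rR η γ κ c c₁ d : ℝ} {n j : ℕ}
    (h : IndependentFeatures G eig μ) (hμ : IsFeatureLaw eig μ) (hν : IsNoiseLaw σ ν) (ha : 0 < a)
    (hcE : 0 < cE) (hCE : 0 < CE) (hdec : PolyDecay a cE CE eig) (hG : 0 < G) (hlam : 0 ≤ lam)
    (hnlam : n * lam ≤ rR * (n : ℝ) ^ (-a)) (hn : 1 ≤ n) (hγ : 0 < γ) (hη : η = 1 + 4 * γ)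
    (hp : ENNReal.ofReal (η * n) ≤ (p : ℝ≥0∞)) (hc : 0 < c)
    (htwo : ∀ m m' : ℕ, (1 + γ) * n ≤ m →
      (m : ℝ) ≤ (2 + γ) * n → γ * n ≤ m' → (m' : ℝ) ≤ (1 + γ) * n →
      ∀ (ρ : Fin m → Measure ℝ) [∀ l, IsProbabilityMeasure (ρ l)]
        (ρ' : Fin m' → Measure ℝ) [∀ l, IsProbabilityMeasure (ρ' l)],
      (∀ l, IsUnitSubGaussian (2 * G) (ρ l)) → (∀ l, ∫ x, x ∂(ρ l) = 0) →
      (∀ l, IsUnitSubGaussian (2 * G) (ρ' l)) → (∀ l, ∫ x, x ∂(ρ' l) = 0) →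
      ((Measure.pi fun l => Measure.pi fun _ : Fin n => ρ l).prod
        (Measure.pi fun l => Measure.pi fun _ : Fin n => ρ' l))
        {z | ∃ w, sqForm z.1 w + sqForm z.2 w < c * n * ∑ i, w i ^ 2} ≤
        ENNReal.ofReal (4 * Real.exp (-(c₁ * n))))
    (hj : 1 ≤ j) (hjG : (2 * G) ^ 2 * 323 * (1 / 4) ^ j ≤ (1 : ℝ) / 64)
    (hd : d = 1 / (8 * (288 * (2 * G) ^ 4))) (hκ : 0 < κ) (hκ1 : κ ≤ 1) (hκγ : κ ≤ γ)
    (hκj : 2 * (j * κ) ≤ d) (hn1 : 4 ≤ γ * n) (hn2 : 1 ≤ κ * n) :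
    (Measure.pi fun _ : Fin n => μ) {X | ¬ VarianceBound μ ν lam
      ((256 * (CE * (κ / 2) ^ (-1 - a) * ((2 * G) ^ 2 * (80 / a + 243)) + rR) +
        CE * (κ / 2) ^ (-1 - a)) / (cE * η ^ (-1 - a) * c) * σ ^ 2) X} ≤
      ENNReal.ofReal (2 * Real.exp (-n)) + (ENNReal.ofReal (2 * Real.exp (-n)) +
        ENNReal.ofReal (Real.exp (-(d * n)))) + ENNReal.ofReal (4 * Real.exp (-(c₁ * n))) := by
  have hn0 : (0 : ℝ) < n := by exact_mod_cast hn
  have hnr : (1 : ℝ) ≤ n := by exact_mod_cast hn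
  have hη0 : 0 < η := by rw [hη]; linarith
  obtain ⟨y, hy⟩ : ∃ y : ℝ, y = (n : ℝ) ^ (-1 - a) := ⟨_, rfl⟩
  have hy0 : 0 < y := by rw [hy]; positivity
  have hny : (n : ℝ) ^ (-a) = n * y := by
    rw [hy, show -a = 1 + (-1 - a) by ring, Real.rpow_add hn0, Real.rpow_one]
  obtain ⟨D, hD⟩ : ∃ D : ℝ, D = (κ / 2) ^ (-1 - a) := ⟨_, rfl⟩
  have hD0 : 0 < D := by rw [hD]; positivity
  obtain ⟨E, hE⟩ : ∃ E : ℝ, E = η ^ (-1 - a) := ⟨_, rfl⟩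
  have hE0 : 0 < E := by rw [hE]; positivity
  -- the dimension of the head, a small multiple of `n`
  obtain ⟨k, hkup, hklow⟩ : ∃ k : ℕ, (k : ℝ) ≤ κ * n ∧ κ * n / 2 ≤ k :=
    ⟨⌊κ * n⌋₊, Nat.floor_le (by positivity), half_le_floor hn2⟩
  have hkn : (k : ℝ) ≤ n := hkup.trans (by nlinarith)
  have hk0 : (0 : ℝ) < k := by linarith
  have hk1 : 1 ≤ k := by exact_mod_cast hk0
  have hky : (k : ℝ) ^ (-1 - a) ≤ D * y := by
    rw [hD, hy, ← Real.mul_rpow (by positivity) hn0.le]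
    exact Real.rpow_le_rpow_of_nonpos (by positivity) (by linarith) (by linarith)
  -- the `(1 + 4 γ) n` coordinates below `η n` have room for the head, for two groups of
  -- `(1 + γ) n` and `γ n` columns, for one coordinate that is not centred, and for the roundings
  have hm1 := Nat.ceil_lt_add_one (a := (1 + γ) * n) (by positivity)
  have hm2 := Nat.ceil_lt_add_one (a := γ * n) (by positivity)
  obtain ⟨m, hm⟩ : ∃ m, m = ⌈(1 + γ) * n⌉₊ := ⟨_, rfl⟩
  obtain ⟨m', hm'⟩ : ∃ m', m' = ⌈γ * n⌉₊ := ⟨_, rfl⟩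
  obtain ⟨N, hN⟩ : ∃ N, N = ⌊η * n⌋₊ := ⟨_, rfl⟩
  rw [← hm] at hm1
  rw [← hm'] at hm2
  have hNup : (N : ℝ) ≤ η * n := hN ▸ Nat.floor_le (by positivity)
  have hNlow : η * n < N + 1 := hN ▸ Nat.lt_floor_add_one _
  have hM : m + m' + k + 1 ≤ N := by
    have h1 : (m + m' + k + 1 : ℝ) ≤ N := by
      have : κ * n ≤ γ * n := by gcongr
      rw [hη] at hNlow
      linarith
    exact_mod_cast h1
  have hN0 : (0 : ℝ) < N := by
    have : (1 : ℕ) ≤ N := by lia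
    exact_mod_cast this
  refine (h.measure_not_varianceBound_le hμ hν hG hlam hn (natCast_le_of_ofReal_le hNup hp) hM
    (s := cE * (E * y)) (L := CE * (D * y)) (R := n / a)
    (S := CE * (D * y) * ((2 * G) ^ 2 * (80 * (n / a) + 243 * n)) + rR * (n * y))
    (by positivity) (fun l hl => ?_) hc
    (htwo m m' (hm ▸ Nat.le_ceil _) (by linarith) (hm' ▸ Nat.le_ceil _) (by linarith))
    (by positivity) (fun l hl => ?_) (fun t ht => ?_) ?_ hj ?_ ?_).trans ?_
  · refine le_trans (mul_le_mul_of_nonneg_left ?_ hcE.le) (hdec l).1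
    rw [hE, hy, ← Real.mul_rpow hη0.le hn0.le]
    refine Real.rpow_le_rpow_of_nonpos (by positivity) (le_trans ?_ hNup) (by linarith)
    exact_mod_cast hl
  · exact (hdec.le_of_le ha hCE.le hk1 hl).trans (mul_le_mul_of_nonneg_left hky hCE.le)
  · refine (hdec.sum_le ha hCE.le hk1 t ht).trans ?_
    rw [show -a = 1 + (-1 - a) by ring, Real.rpow_add hk0, Real.rpow_one]
    calc CE / a * (k * (k : ℝ) ^ (-1 - a)) ≤ CE / a * (n * (D * y)) := by gcongr
      _ = CE * (D * y) * (n / a) := by ring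
  · rw [← hny]
    linarith
  · calc (2 * G) ^ 2 * (80 * k + 243 * n) * (1 / 4) ^ j
        ≤ (2 * G) ^ 2 * (80 * n + 243 * n) * (1 / 4) ^ j := by gcongr
      _ = (2 * G) ^ 2 * 323 * (1 / 4) ^ j * n := by ring
      _ ≤ 1 / 64 * n := by gcongr
      _ = n / 64 := by ring
  · refine le_of_eq ?_
    rw [← hD, ← hE]
    congr 1
    field_simp
    ring
  · gcongr
    have h1 : (n : ℝ) / (4 * (288 * (2 * G) ^ 4)) = 2 * (d * n) := by
      rw [hd]
      field_simp
      ring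
    have h2 : 2 * (j * (k : ℝ)) ≤ d * n := by
      calc 2 * (j * (k : ℝ)) ≤ 2 * (j * (κ * n)) := by gcongr
        _ = 2 * (j * κ) * n := by ring
        _ ≤ d * n := by gcongr
    rw [h1]
    linarith

end Independent

theorem independentFeatures_variance (a : ℝ) (ha : 0 < a) (b : WithTop ℝ)
    (hb : ((1 + a : ℝ) : WithTop ℝ) ≤ b) (cE CE : ℝ) (hcE : 0 < cE) (cR CR : ℝ) (hcR : 0 < cR)
    (G η : ℝ) (hη : 1 < η) :
    ∃ c₁ C : ℝ, 0 < c₁ ∧ 0 < C ∧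
      ∀ n : ℕ, 1 ≤ n →
      ∀ (p : ℕ∞), ENNReal.ofReal (η * n) < (p : ℝ≥0∞) →
      ∀ (eig : Idx p → ℝ) (μ : Measure (Idx p → ℝ))
        [IsProbabilityMeasure μ] (ν : Measure ℝ) [IsProbabilityMeasure ν] (σ lam : ℝ),
        IsFeatureLaw eig μ → PolyDecay a cE CE eig → IndependentFeatures G eig μ →
        IsNoiseLaw σ ν → RidgeOrder b cR CR n lam →
        (Measure.pi fun _ : Fin n => μ) {X | ¬ VarianceBound μ ν lam (C * σ ^ 2) X} ≤
          ENNReal.ofReal (3 * Real.exp (-c₁ * n)) := by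
  -- enlarging the constants to at least one removes the case distinction on their signs
  obtain ⟨G', hG', hGG'⟩ : ∃ G', 1 ≤ G' ∧ G ≤ G' := ⟨max G 1, le_max_right _ _, le_max_left _ _⟩
  obtain ⟨CE', hCE', hCC'⟩ : ∃ C', 1 ≤ C' ∧ CE ≤ C' := ⟨max CE 1, le_max_right _ _, le_max_left _ _⟩
  obtain ⟨γ, hγ⟩ : ∃ γ, γ = (η - 1) / 4 := ⟨_, rfl⟩
  have hγ0 : 0 < γ := by rw [hγ]; linarith
  have hηγ : η = 1 + 4 * γ := by rw [hγ]; ring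
  obtain ⟨c, c₁, n₀, hc, hc₁, htwo⟩ :=
    exists_measure_two_groups_lt_le hγ0 (H := 2 * G') (by linarith)
  -- the fineness of the net on the sphere of the head; `323 = 80 + 243` comes from `k ≤ n` in the
  -- upper bound for the norm of the head
  obtain ⟨j, hj, hjG⟩ : ∃ j : ℕ, 1 ≤ j ∧ (2 * G') ^ 2 * 323 * (1 / 4) ^ j ≤ (1 : ℝ) / 64 := by
    have hA : 0 < (2 * G') ^ 2 * 323 := by positivity
    obtain ⟨i, hi⟩ := exists_pow_lt_of_lt_one (show 0 < 1 / 64 / ((2 * G') ^ 2 * 323) by positivity)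
      (show (1 / 4 : ℝ) < 1 by norm_num)
    refine ⟨i + 1, by lia, ?_⟩
    have h1 : (1 / 4 : ℝ) ^ (i + 1) ≤ (1 / 4) ^ i :=
      pow_le_pow_of_le_one (by norm_num) (by norm_num) (by lia)
    rw [lt_div_iff₀ hA] at hi
    calc (2 * G') ^ 2 * 323 * (1 / 4) ^ (i + 1) ≤ (2 * G') ^ 2 * 323 * (1 / 4) ^ i := by gcongr
      _ ≤ 1 / 64 := by linarith
  have hj0 : (0 : ℝ) < j := by exact_mod_cast hj
  obtain ⟨d, hd⟩ : ∃ d, d = 1 / (8 * (288 * (2 * G') ^ 4)) := ⟨_, rfl⟩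
  have hd0 : 0 < d := by rw [hd]; positivity
  -- the head is so small that the cardinality of this net is beaten by the failure probability
  -- at one of its points
  obtain ⟨κ, hκ, hκ1, hκγ, hκj⟩ : ∃ κ : ℝ, 0 < κ ∧ κ ≤ 1 ∧ κ ≤ γ ∧ 2 * (j * κ) ≤ d := by
    refine ⟨min (min 1 γ) (d / (2 * j)), by positivity,
      (min_le_left _ _).trans (min_le_left _ _), (min_le_left _ _).trans (min_le_right _ _), ?_⟩
    have h1 : min (min 1 γ) (d / (2 * j)) ≤ d / (2 * j) := min_le_right _ _
    rw [le_div_iff₀ (by positivity)] at h1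
    linarith
  obtain ⟨r, hr, hr1, hrd, hrc⟩ : ∃ r : ℝ, 0 < r ∧ r ≤ 1 ∧ r ≤ d ∧ r ≤ c₁ :=
    ⟨min (min 1 d) c₁, by positivity, (min_le_left _ _).trans (min_le_left _ _),
      (min_le_left _ _).trans (min_le_right _ _), min_le_right _ _⟩
  obtain ⟨n₁, hn₁⟩ := exists_nat_ge (max (max (4 / γ) (1 / κ)) (4 / r))
  obtain ⟨N, hN⟩ : ∃ N, N = n₀ + n₁ + 1 := ⟨_, rfl⟩
  have hN0 : (0 : ℝ) < N := by rw [hN]; positivity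
  have hη0 : 0 < η := by linarith
  have hCE0 : 0 < CE' := by linarith
  refine ⟨min (r / 2) (1 / N), (256 * (CE' * (κ / 2) ^ (-1 - a) * ((2 * G') ^ 2 * (80 / a + 243)) +
    |CR|) + CE' * (κ / 2) ^ (-1 - a)) / (cE * η ^ (-1 - a) * c), by positivity, ?_,
    fun n hn p hp eig μ _ ν _ σ lam hμ hdec hG hν hR => ?_⟩
  · positivity
  have hn0 : (0 : ℝ) < n := by exact_mod_cast hn
  rcases lt_or_ge n N with hnN | hnN
  · -- for small `n` the bound on the probability is at least one
    refine prob_le_one.trans ?_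
    rw [ENNReal.one_le_ofReal]
    have h1 : min (r / 2) (1 / (N : ℝ)) * n ≤ 1 := by
      have h2 : (n : ℝ) ≤ N := by exact_mod_cast hnN.le
      calc min (r / 2) (1 / (N : ℝ)) * n ≤ 1 / N * N := by
            gcongr
            exact min_le_right _ _
        _ = 1 := by field_simp
    have h3 : Real.exp (-1) ≤ Real.exp (-min (r / 2) (1 / (N : ℝ)) * n) :=
      Real.exp_le_exp.2 (by linarith)
    have h4 : 1 ≤ 3 * Real.exp (-1) := by
      rw [Real.exp_neg, ← div_eq_mul_inv, one_le_div (Real.exp_pos 1)]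
      exact Real.exp_one_lt_three.le
    linarith
  · have hnn₁ : (n₁ : ℝ) ≤ n := by exact_mod_cast (by lia : n₁ ≤ n)
    have hnmax := hn₁.trans hnn₁
    simp only [max_le_iff] at hnmax
    obtain ⟨⟨hn1, hn2⟩, hn3⟩ := hnmax
    rw [div_le_iff₀ hγ0, mul_comm] at hn1
    rw [div_le_iff₀ hκ, mul_comm] at hn2
    rw [div_le_iff₀ hr, mul_comm] at hn3
    obtain ⟨hlam, hnlam⟩ := hR.bounds hb hcR hn
    refine ((hG.mono hGG').measure_not_varianceBound_le_of_large hμ hν ha hcE hCE0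
      (hdec.mono hCC') (by linarith) hlam hnlam hn hγ0 hηγ hp.le hc (htwo n (by lia)) hj hjG hd hκ
      hκ1 hκγ hκj hn1 hn2).trans ?_
    rw [← ENNReal.ofReal_add (by positivity) (by positivity),
      ← ENNReal.ofReal_add (by positivity) (by positivity),
      ← ENNReal.ofReal_add (by positivity) (by positivity)]
    refine ENNReal.ofReal_le_ofReal ?_
    have hle : ∀ x : ℝ, r ≤ x → Real.exp (-(x * n)) ≤ Real.exp (-(r * n)) := fun x hx =>
      Real.exp_le_exp.2 (neg_le_neg (mul_le_mul_of_nonneg_right hx hn0.le))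
    have e1 := hle 1 hr1
    rw [one_mul] at e1
    have e2 := hle d hrd
    have e3 := hle c₁ hrc
    have e4 : Real.exp (-(r * n)) = Real.exp (-(r / 2 * n)) * Real.exp (-(r / 2 * n)) := by
      rw [← Real.exp_add]
      congr 1
      ring
    -- half of the exponent absorbs the number of the events
    have e5 : 3 * Real.exp (-(r / 2 * n)) ≤ 1 := by
      rw [Real.exp_neg, ← div_eq_mul_inv, div_le_one (Real.exp_pos _)]
      linarith [Real.add_one_le_exp (r / 2 * n)]
    have e6 : Real.exp (-(r / 2 * n)) ≤ Real.exp (-min (r / 2) (1 / (N : ℝ)) * n) := by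
      rw [neg_mul]
      exact Real.exp_le_exp.2 (neg_le_neg (mul_le_mul_of_nonneg_right (min_le_left _ _) hn0.le))
    have e7 : 0 < Real.exp (-(r / 2 * n)) := Real.exp_pos _
    nlinarith

end RidgeVariance

end

theorem mainTheorem6 (a : ℝ) (ha : 0 < a) (b : WithTop ℝ) (hb : ((1 + a : ℝ) : WithTop ℝ) ≤ b)
    (cE CE : ℝ) (hcE : 0 < cE) (cR CR : ℝ) (hcR : 0 < cR) :
    -- generic features
    (∀ α β : ℝ, 0 < α → ∀ p : ℕ → ℕ∞,
      Tendsto (fun n : ℕ => (p n : ℝ≥0∞) / ENNReal.ofReal ((n : ℝ) ^ 2 * Real.log n))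
        atTop (𝓝 ⊤) →
      ∃ C q : ℝ, 0 < C ∧ 0 ≤ q ∧ ∃ φ : ℕ → ℝ,
        φ =o[atTop] (fun n : ℕ => 1 / Real.log n) ∧
        ∀ n : ℕ, 1 ≤ n →
        ∀ (eig : RidgeVariance.Idx (p n) → ℝ) (μ : Measure (RidgeVariance.Idx (p n) → ℝ))
          [IsProbabilityMeasure μ] (ν : Measure ℝ) [IsProbabilityMeasure ν] (σ lam : ℝ),
          RidgeVariance.IsFeatureLaw eig μ →
          RidgeVariance.PolyDecay a cE CE eig →
          RidgeVariance.GenericFeatures α β eig μ →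
          RidgeVariance.IsNoiseLaw σ ν →
          RidgeVariance.RidgeOrder b cR CR n lam →
          (Measure.pi fun _ : Fin n => μ) {X | ¬ RidgeVariance.VarianceBound μ ν lam
            (C * σ ^ 2 * (n : ℝ) ^ (2 * a) * Real.log n ^ q) X} ≤ ENNReal.ofReal (φ n)) ∧
    -- independent sub-Gaussian features
    (∀ G η : ℝ, 0 < G → 1 < η →
      ∃ c₁ C : ℝ, 0 < c₁ ∧ 0 < C ∧
        ∀ n : ℕ, 1 ≤ n →
        ∀ (p : ℕ∞), ENNReal.ofReal (η * n) < (p : ℝ≥0∞) →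
        ∀ (eig : RidgeVariance.Idx p → ℝ) (μ : Measure (RidgeVariance.Idx p → ℝ))
          [IsProbabilityMeasure μ] (ν : Measure ℝ) [IsProbabilityMeasure ν] (σ lam : ℝ),
          RidgeVariance.IsFeatureLaw eig μ →
          RidgeVariance.PolyDecay a cE CE eig →
          RidgeVariance.IndependentFeatures G eig μ →
          RidgeVariance.IsNoiseLaw σ ν →
          RidgeVariance.RidgeOrder b cR CR n lam →
          (Measure.pi fun _ : Fin n => μ) {X | ¬ RidgeVariance.VarianceBound μ ν lam
            (C * σ ^ 2) X} ≤ ENNReal.ofReal (3 * Real.exp (-c₁ * n))) := by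
    exact ⟨fun α β hα p hp => RidgeVariance.genericFeatures_variance a ha b hb cE CE hcE cR CR hcR
      α β hα p hp,
    fun G η _ hη => RidgeVariance.independentFeatures_variance a ha b hb cE CE hcE cR CR hcR G η hη⟩
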